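/- **Setting.** Let $0<\alpha<2$, $b=1-\alpha$, and let $\theta:\mathbb R^2\times(0,\infty)\to\mathbb R$, $u$ solve the dissipative SQG equation $$\partial_t\theta+u\cdot\nabla\theta+\Lambda^\alpha\theta=0,\qquad u=(-\partial_2\Psi,\partial_1\Psi),\qquad \Lambda\Psi=-\theta ,$$ where $(\Lambda^\alpha f)^\wedge(\xi)=|\xi|^\alpha\hat f(\xi)$, in the weak sense on $\mathbb R^2\times(0,\infty)$ with $\theta\in L^\infty(0,\infty;L^2(\mathbb R^2))$. Fix $x_0\in\mathbb R^2$, $R_0,R^*,T,C_0>0$, $\frac12<\delta<1$ with $2T\ge R_0^\alpha$, and assume that $\theta,u$ are smooth on $B(x_0,2R_0)\times(0,2T)$. Let $$\theta^*(x,z,t)=\int_{\mathbb R^2}\frac{\alpha}{2\pi}\frac{z^\alpha}{(|x-y|^2+z^2)^{(2+\alpha)/2}}\,\theta(y,t)\,dy,\qquad w(z)=\frac{2^{\alpha-1}\Gamma(\alpha/2)}{\Gamma(1-\alpha/2)}\,z^{b}\qquad(z>0),$$ so that $\theta^*$ solves $\nabla\cdot(z^b\nabla\theta^*)=0$ with trace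 $\theta$, and $w$ is $z^b$ normalized so that $\Lambda^\alpha\theta=\lim_{z\to0}(-w\,\partial_z\theta^*)$ ($w=1$ if $\alpha=1$). **Cut-offs.** Fix the following. * $\eta\in C_0^\infty(0,\infty)$, $0\le\eta\le1$, $\eta=0$ off $[T/3,5T/3]$, $\eta=1$ on $[2T/3,4T/3]$, $|\eta'|\le \frac{C_0}{T}\eta^{2\delta-1}$. * $\psi_0\in C_0^\infty(B(x_0,2R_0))$, $0\le\psi_0\le1$, $\psi_0=1$ on $B(x_0,R_0)$, satisfying with $R=R_0$ the bounds $$|\partial_i\psi|\le \tfrac{C_0}{R}\psi^\delta,\qquad |\partial_i\partial_j\psi|\le \tfrac{C_0}{R^2}\psi^{2\delta-1}.\tag{1}$$ * $\psi^*\in C^\infty([0,\infty))$, nonincreasing, $\psi^*=1$ on $[0,R^*]$, $\psi^*=0$ on $[R^*+R_0,\infty)$, with $|\psi^{*\prime}|\le\frac{C_0}{R_0}(\psi^*)^{\delta}$, and with $|\psi^{*\prime\prime}|$ and $|\frac{b}{z}\psi^{*\prime}|$ both at most $\frac{C_0}{R_0^2}(\psi^*)^{2\delta-1}$ for $z>0$.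 Put $\phi_0=\eta\psi_0$, $\phi_0^*=\eta\psi_0\psi^*$. For $0<R\le R_0$ call a ball $B(c,R)$ interior if $\overline{B(c,R)}\subset B(x_0,R_0)$. For $r>0$ let $W_r(c)$ be the set of $x$ with $R_0\le|x-x_0|<2R_0$ such that the ray from $x_0$ through $x$ meets $\partial B(c,r)\setminus B(x_0,R_0)$. Put $S_0=B(c,R)\cap B(x_0,R_0)$, $S_1=W_R(c)$, $S_2=(B(c,2R)\cup W_{2R}(c))\setminus(S_0\cup S_1)$. The enlarged element $E(c)$ is $B(c,2R)$ if $B(c,R)$ is interior, and $S_0\cup S_1\cup S_2$ otherwise. A cut-off for $B(c,R)$ is $\phi=\eta\psi$ with $\psi\in C_0^\infty(\mathbb R^2)$, $0\le\psi\le\psi_0$, $\psi$ satisfying (1), $\psi=0$ off $E(c)$, and $\psi=1$ on $B(c,R)$ if $B(c,R)$ is interior, while otherwise $\psi=1$ on $S_0$ and $\psi=\psi_0$ on $S_1$. **Covers.** For positive integers $K_1,K_2$, a $(K_1,K_2)$-cover at scale $R$ is a cover of $B(x_0,R_0)$ by balls $B(x_i,R)$, $1\le i\le n$, with $(R_0/R)^2\le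 n\le K_1(R_0/R)^2$, such that each $x\in B(x_0,2R_0)$ lies in at most $K_2$ of the sets $E(x_i)$. For cut-offs $\phi_i=\eta\psi_i$ of its elements let $$F_i=\frac1T\int_0^{2T}\frac1{R^2}\int_{\mathbb R^2}\tfrac12\theta^2\,(u\cdot\nabla\phi_i)\,dx\,dt,\qquad \langle F\rangle_R=\frac1n\sum_{i=1}^nF_i .$$ **Macro-scale quantities.** With $\nabla$ the gradient in $(x,z)$, $$\vartheta_0=\frac1T\int_0^{2T}\frac1{R_0^2}\int\tfrac12\theta^2\phi_0^{2\delta-1}\,dx\,dt,\qquad \vartheta_0^*=\frac1T\int_0^{2T}\frac1{R_0^2}\int\!\int_0^\infty w\,\tfrac12{\theta^*}^2{\phi_0^*}^{2\delta-1}\,dz\,dx\,dt,$$ $$\varepsilon_0^*=\frac1T\int_0^{2T}\frac1{R_0^2}\int\!\int_0^\infty w\,|\nabla\theta^*|^2\phi_0^*\,dz\,dx\,dt,\qquad \sigma_0=\max\Big\{\Big(\frac{\vartheta_0}{\varepsilon_0^*}\Big)^{1/\alpha},\Big(\frac{\vartheta_0^*}{\varepsilon_0^*}\Big)^{1/2}\Big\},$$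 where $\varepsilon_0^*>0$ is assumed. **Theorem.** Fix positive integers $K_1,K_2$ and let $\beta=\min\{(8C_0K_1K_2)^{-1/2},(8C_0K_1K_2)^{-1/\alpha}\}$. If $\sigma_0<\beta R_0$, then for every $R>0$ with $\sigma_0/\beta\le R\le R_0$, every $(K_1,K_2)$-cover at scale $R$ and every choice of cut-offs for its elements, $$\frac1{4K_1}\,\varepsilon_0^*\le\langle F\rangle_R\le4K_2\,\varepsilon_0^* .$$ -/

import Mathlib

open Set MeasureTheory Metric
open scoped FourierTransform ContDiff

noncomputable section

namespace SQG

/-- The Euclidean plane. -/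
abbrev Plane : Type := EuclideanSpace ℝ (Fin 2)

/-- The standard basis vectors of the plane. -/
def e (i : Fin 2) : Plane := EuclideanSpace.single i 1

/-! ### The equation -/

/-- The fractional Laplacian `Λ^α` of a function on the plane: the Fourier multiplier `|ξ|^α`.
Mathlib uses the kernel `exp (-2πi x·ξ)` for the Fourier transform, hence the factor `2π`. -/
def fracLap (α : ℝ) (g : Plane → ℝ) (x : Plane) : ℝ :=
  (𝓕⁻ (fun ξ : Plane =>
    (((2 * Real.pi * ‖ξ‖) ^ α : ℝ) : ℂ) * 𝓕 (fun y : Plane => (g y : ℂ)) ξ) x).re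

/-- The Fourier transform of a square integrable function. -/
def l2Fourier (f : Plane → ℝ) (hf : MemLp (fun x => (f x : ℂ)) 2 volume) : Plane → ℂ :=
  (𝓕 (hf.toLp (fun x => (f x : ℂ))) : Lp ℂ 2 (volume : Measure Plane))

/-- `u = (-∂₂Ψ, ∂₁Ψ)` for a streamfunction with `ΛΨ = -θ`, on the Fourier side
(at one time; `θ` and `u` in `L²`, and `Ψhat` is the Fourier transform of `Ψ`). -/
def IsVelocityOf (θ : Plane → ℝ) (u : Plane → Plane) : Prop :=
  ∃ (hθ : MemLp (fun x => (θ x : ℂ)) 2 volume)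
    (hu₁ : MemLp (fun x => (u x 0 : ℂ)) 2 volume)
    (hu₂ : MemLp (fun x => (u x 1 : ℂ)) 2 volume)
    (Ψhat : Plane → ℂ), ∀ᵐ ξ : Plane,
      ((2 * Real.pi * ‖ξ‖ : ℝ) : ℂ) * Ψhat ξ = -l2Fourier θ hθ ξ ∧
      l2Fourier (fun x => u x 0) hu₁ ξ = -(2 * Real.pi * Complex.I * (ξ 1 : ℂ) * Ψhat ξ) ∧
      l2Fourier (fun x => u x 1) hu₂ ξ = 2 * Real.pi * Complex.I * (ξ 0 : ℂ) * Ψhat ξ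

/-- Test functions on `(0,∞) × ℝ²`. -/
structure IsTestFunction (g : ℝ → Plane → ℝ) : Prop where
  smooth : ContDiff ℝ ∞ (fun p : ℝ × Plane => g p.1 p.2)
  compact : HasCompactSupport (fun p : ℝ × Plane => g p.1 p.2)
  support : tsupport (fun p : ℝ × Plane => g p.1 p.2) ⊆ Ioi 0 ×ˢ univ

/-- `(θ, u)` is a weak solution, with `θ` in `L^∞(0,∞; L²)`, of the dissipative SQG equation
`∂ₜθ + u·∇θ + Λ^α θ = 0`, `u = (-∂₂Ψ, ∂₁Ψ)`, `ΛΨ = -θ` on `ℝ² × (0,∞)`. -/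
structure IsSolution (α : ℝ) (θ : ℝ → Plane → ℝ) (u : ℝ → Plane → Plane) : Prop where
  meas_θ : AEStronglyMeasurable (fun p : ℝ × Plane => θ p.1 p.2)
    (volume.restrict (Ioi 0 ×ˢ univ))
  meas_u : AEStronglyMeasurable (fun p : ℝ × Plane => u p.1 p.2)
    (volume.restrict (Ioi 0 ×ˢ univ))
  bounded : ∃ M : NNReal, ∀ᵐ t ∂(volume.restrict (Ioi (0 : ℝ))), eLpNorm (θ t) 2 volume ≤ M
  velocity : ∀ᵐ t ∂(volume.restrict (Ioi (0 : ℝ))), IsVelocityOf (θ t) (u t)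
  weak : ∀ g : ℝ → Plane → ℝ, IsTestFunction g →
    ∫ t in Ioi (0 : ℝ), ∫ x : Plane,
      θ t x * (deriv (fun s => g s x) t + fderiv ℝ (g t) x (u t x) - fracLap α (g t) x) = 0

/-- `θ` and `u` are smooth on `B(x₀, 2R₀) × (0, 2T)`. -/
def SmoothOnMacro (x₀ : Plane) (R₀ T : ℝ) (θ : ℝ → Plane → ℝ) (u : ℝ → Plane → Plane) : Prop :=
  ContDiffOn ℝ ∞ (fun p : ℝ × Plane => θ p.1 p.2) (Ioo 0 (2 * T) ×ˢ ball x₀ (2 * R₀)) ∧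
  ContDiffOn ℝ ∞ (fun p : ℝ × Plane => u p.1 p.2) (Ioo 0 (2 * T) ×ˢ ball x₀ (2 * R₀))

/-! ### The extension to the upper half-space -/

/-- The Poisson kernel of `∇·(z^(1-α) ∇L) = 0` on `ℝ² × (0,∞)`. -/
def poissonKernel (α : ℝ) (x : Plane) (z : ℝ) : ℝ :=
  α / (2 * Real.pi) * (z ^ α / (‖x‖ ^ 2 + z ^ 2) ^ ((2 + α) / 2))

/-- The extension operator `L`. -/
def ext (α : ℝ) (f : Plane → ℝ) (x : Plane) (z : ℝ) : ℝ :=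
  if z = 0 then f x else ∫ y : Plane, poissonKernel α (x - y) z * f y

/-- The weight `z^b`, `b = 1 - α`, normalized so that `Λ^α f = lim_{z → 0} (-weight(z) ∂_z L f)`
holds exactly; the constant is `1` for `α = 1`. -/
def weight (α z : ℝ) : ℝ :=
  2 ^ (α - 1) * Real.Gamma (α / 2) / Real.Gamma (1 - α / 2) * z ^ (1 - α)

/-- `|∇v|²` for a function `v` of `(x, z)`, the gradient being taken in all three variables. -/
def gradSq (v : Plane → ℝ → ℝ) (x : Plane) (z : ℝ) : ℝ :=
  ‖fderiv ℝ (fun y => v y z) x‖ ^ 2 + (deriv (fun s => v x s) z) ^ 2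

/-! ### Refined cut-off functions -/

/-- Refined temporal cut-off functions. -/
structure IsTimeCutoff (T C₀ δ : ℝ) (η : ℝ → ℝ) : Prop where
  smooth : ContDiff ℝ ∞ η
  nonneg : ∀ t, 0 ≤ η t
  le_one : ∀ t, η t ≤ 1
  eq_zero : ∀ t, t ∉ Icc (T / 3) (5 * T / 3) → η t = 0
  eq_one : ∀ t ∈ Icc (2 * T / 3) (4 * T / 3), η t = 1
  deriv_le : ∀ t, |deriv η t| ≤ C₀ / T * η t ^ (2 * δ - 1)

/-- Smoothness, size and gradient restrictions for a spatial cut-off function at scale `R`. -/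
structure IsSpaceCutoff (R C₀ δ : ℝ) (ψ : Plane → ℝ) : Prop where
  smooth : ContDiff ℝ ∞ ψ
  compact : HasCompactSupport ψ
  nonneg : ∀ x, 0 ≤ ψ x
  le_one : ∀ x, ψ x ≤ 1
  deriv_le : ∀ x i, |fderiv ℝ ψ x (e i)| ≤ C₀ / R * ψ x ^ δ
  deriv2_le : ∀ x i j,
    |fderiv ℝ (fun y => fderiv ℝ ψ y (e i)) x (e j)| ≤ C₀ / R ^ 2 * ψ x ^ (2 * δ - 1)

/-- The macro-scale spatial cut-off function `ψ₀`, for the ball `B(x₀, R₀)`. -/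
structure IsMacroCutoff (x₀ : Plane) (R₀ C₀ δ : ℝ) (ψ₀ : Plane → ℝ) : Prop where
  cutoff : IsSpaceCutoff R₀ C₀ δ ψ₀
  eq_one : ∀ x ∈ ball x₀ R₀, ψ₀ x = 1
  support : tsupport ψ₀ ⊆ ball x₀ (2 * R₀)

/-- The vertical cut-off function `ψ*`: equal to `1` on `[0, R*]`, it decreases to `0` across
`[R*, R* + R₀)`. Its gradient restrictions mirror those of `ψ₀`, the second-order one being
imposed on both parts of the operator `z^(-b) ∂_z (z^b ∂_z) = ∂_z² + (b/z) ∂_z`, `b = 1 - α`. -/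
structure IsVerticalCutoff (α Rs R₀ C₀ δ : ℝ) (ψs : ℝ → ℝ) : Prop where
  smooth : ContDiffOn ℝ ∞ ψs (Ici 0)
  anti : AntitoneOn ψs (Ici 0)
  eq_one : ∀ z ∈ Icc 0 Rs, ψs z = 1
  eq_zero : ∀ z, Rs + R₀ ≤ z → ψs z = 0
  deriv_le : ∀ z, 0 < z → |deriv ψs z| ≤ C₀ / R₀ * ψs z ^ δ
  deriv2_le : ∀ z, 0 < z → |deriv (deriv ψs) z| ≤ C₀ / R₀ ^ 2 * ψs z ^ (2 * δ - 1)
  deriv_div_le : ∀ z, 0 < z → |(1 - α) / z * deriv ψs z| ≤ C₀ / R₀ ^ 2 * ψs z ^ (2 * δ - 1)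

/-- A ball of the cover is interior if its closure is contained in `B(x₀, R₀)`. -/
def Interior (x₀ : Plane) (R₀ : ℝ) (c : Plane) (R : ℝ) : Prop :=
  closedBall c R ⊆ ball x₀ R₀

/-- The points `x` of the annulus `R₀ ≤ |x - x₀| < 2R₀` such that the ray from `x₀` through `x`
meets `∂B(c, r)` outside `B(x₀, R₀)`. -/
def shadow (x₀ : Plane) (R₀ : ℝ) (c : Plane) (r : ℝ) : Set Plane :=
  {x | R₀ ≤ dist x x₀ ∧ dist x x₀ < 2 * R₀ ∧
    ∃ s : ℝ, 0 ≤ s ∧ x₀ + s • (x - x₀) ∈ sphere c r \ ball x₀ R₀}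

def S0 (x₀ : Plane) (R₀ : ℝ) (c : Plane) (R : ℝ) : Set Plane := ball c R ∩ ball x₀ R₀

def S1 (x₀ : Plane) (R₀ : ℝ) (c : Plane) (R : ℝ) : Set Plane := shadow x₀ R₀ c R

def S2 (x₀ : Plane) (R₀ : ℝ) (c : Plane) (R : ℝ) : Set Plane :=
  (ball c (2 * R) ∪ shadow x₀ R₀ c (2 * R)) ∩ (S0 x₀ R₀ c R ∪ S1 x₀ R₀ c R)ᶜ

open Classical in
/-- The enlarged cover element, to which the cut-off function of `B(c, R)` is confined. -/
def region (x₀ : Plane) (R₀ : ℝ) (c : Plane) (R : ℝ) : Set Plane :=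
  if Interior x₀ R₀ c R then ball c (2 * R)
  else S0 x₀ R₀ c R ∪ S1 x₀ R₀ c R ∪ S2 x₀ R₀ c R

/-- Spatial cut-off functions `ψ` of a cover element `B(c, R)`, subordinate to `ψ₀`. -/
structure IsElementCutoff (x₀ : Plane) (R₀ C₀ δ : ℝ) (ψ₀ : Plane → ℝ) (c : Plane) (R : ℝ)
    (ψ : Plane → ℝ) : Prop where
  cutoff : IsSpaceCutoff R C₀ δ ψ
  le_macro : ∀ x, ψ x ≤ ψ₀ x
  support : Function.support ψ ⊆ region x₀ R₀ c R
  interior : Interior x₀ R₀ c R → ∀ x ∈ ball c R, ψ x = 1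
  boundary₀ : ¬ Interior x₀ R₀ c R → ∀ x ∈ S0 x₀ R₀ c R, ψ x = 1
  boundary₁ : ¬ Interior x₀ R₀ c R → ∀ x ∈ S1 x₀ R₀ c R, ψ x = ψ₀ x

/-- `(K₁, K₂)`-covers of `B(x₀, R₀)` at scale `R` by balls `B(c i, R)`. -/
structure IsCover (K₁ K₂ : ℕ) (x₀ : Plane) (R₀ R : ℝ) {n : ℕ} (c : Fin n → Plane) : Prop where
  covers : ball x₀ R₀ ⊆ ⋃ i, ball (c i) R
  le_card : (R₀ / R) ^ 2 ≤ (n : ℝ)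
  card_le : (n : ℝ) ≤ K₁ * (R₀ / R) ^ 2
  multiplicity : ∀ x ∈ ball x₀ (2 * R₀), {i : Fin n | x ∈ region x₀ R₀ (c i) R}.ncard ≤ K₂

/-! ### Averages -/

/-- `ϑ₀`, with `φ₀ = η ψ₀`. -/
def vartheta (R₀ T δ : ℝ) (η : ℝ → ℝ) (ψ₀ : Plane → ℝ) (θ : ℝ → Plane → ℝ) : ℝ :=
  1 / T * ∫ t in (0 : ℝ)..(2 * T), 1 / R₀ ^ 2 * ∫ x : Plane,
    1 / 2 * θ t x ^ 2 * (η t * ψ₀ x) ^ (2 * δ - 1)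

/-- `ϑ₀*`, with `φ₀* = η ψ₀ ψ*`. -/
def varthetaStar (α R₀ T δ : ℝ) (η : ℝ → ℝ) (ψ₀ : Plane → ℝ) (ψs : ℝ → ℝ)
    (θ : ℝ → Plane → ℝ) : ℝ :=
  1 / T * ∫ t in (0 : ℝ)..(2 * T), 1 / R₀ ^ 2 * ∫ x : Plane, ∫ z in Ioi (0 : ℝ),
    weight α z * (1 / 2 * ext α (θ t) x z ^ 2) * (η t * ψ₀ x * ψs z) ^ (2 * δ - 1)

/-- `ε₀*`. -/
def epsStar (α R₀ T : ℝ) (η : ℝ → ℝ) (ψ₀ : Plane → ℝ) (ψs : ℝ → ℝ)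
    (θ : ℝ → Plane → ℝ) : ℝ :=
  1 / T * ∫ t in (0 : ℝ)..(2 * T), 1 / R₀ ^ 2 * ∫ x : Plane, ∫ z in Ioi (0 : ℝ),
    weight α z * gradSq (ext α (θ t)) x z * (η t * ψ₀ x * ψs z)

/-- `σ₀`, as a function of the averages `ϑ₀`, `ϑ₀*`, `ε₀*`. -/
def sigma (α v vs es : ℝ) : ℝ := max ((v / es) ^ (1 / α)) ((vs / es) ^ (1 / 2 : ℝ))

/-- `β = min {(8 C₀ K₁ K₂)^(-1/2), (8 C₀ K₁ K₂)^(-1/α)}`. -/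
def beta (α C₀ : ℝ) (K₁ K₂ : ℕ) : ℝ :=
  min ((8 * C₀ * K₁ * K₂) ^ (-(1 / 2) : ℝ)) ((8 * C₀ * K₁ * K₂) ^ (-(1 / α)))

/-- The localized, space-time averaged flux through the cut-off function `φ = η ψ` at scale `R`. -/
def flux (R T : ℝ) (η : ℝ → ℝ) (ψ : Plane → ℝ) (θ : ℝ → Plane → ℝ) (u : ℝ → Plane → Plane) : ℝ :=
  1 / T * ∫ t in (0 : ℝ)..(2 * T), 1 / R ^ 2 * ∫ x : Plane,
    1 / 2 * θ t x ^ 2 * fderiv ℝ (fun y => η t * ψ y) x (u t x)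

/-- The ensemble average `⟨F⟩_R`. -/
def meanFlux (R T : ℝ) (η : ℝ → ℝ) {n : ℕ} (ψ : Fin n → Plane → ℝ) (θ : ℝ → Plane → ℝ)
    (u : ℝ → Plane → Plane) : ℝ :=
  1 / (n : ℝ) * ∑ i, flux R T η (ψ i) θ u

end SQG

end

noncomputable section

namespace SQG

open Filter Topology

/-! The flux through a cover element is a localized dissipation rate up to lower order terms, and
these are small above the scale `σ₀/β`.

Write `φ = ηψ` for a cut-off of one element. Since `θ` is smooth where `φ` lives, `θφ` is an
admissible test function; since `u` is divergence free, the weak equation becomes `∬ ½θ² u·∇φ = ∬ θ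
Λ^α(θφ) - ∬ ½θ² ∂ₜφ` (`localized_identity`). At almost every time the nonlocal term is local in the
extension (`energy_balance`): `∫ θ Λ^α(θφ) = ∬ w|∇θ*|² φψ* - ½ ∬ w θ*² (Δφ ψ* + φ z^(-b)(z^b
ψ*')')`. The first term on the right is the dissipation. By the refined cut-off bounds the others
are at most `4C₀/R²` times a local version of `ϑ₀*`, and the term with `∂ₜφ` is at most `C₀/T` times
a local version of `ϑ₀`.

The cut-offs satisfy `ψ₀ ≤ Σ ψ_i ≤ K₂ ψ₀` (`le_sum_cutoff`, `sum_cutoff_le`), so the summed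
dissipation lies between the macroscopic one and `K₂` times it, and the summed errors carry a factor
`K₂` (`cover_flux_bounds`). The definition of `β` makes the errors at most `ε₀*/(2K₁)` and
`ε₀*/(4K₁)`, and the normalizing factor `(R₀/R)²/n` lies in `[1/K₁, 1]` (`averages_le_of_sigma_le`,
`average_bounds`).

The analytic core is `energy_balance` for a function `f` that is only in `L²` globally and smooth
near the support of `ψ`. Above a height `a > 0` it is an exact integration by parts. As `a → 0` the
boundary term tends to `∫ f Λ^α(fψ)` (`boundary_flux_tendsto`): the operator `f ↦ w ∂_z f*` is
symmetric, so it can be moved onto the test function `fψ`. There it is a regularized Riesz potential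
of the Laplacian, whose limit is `-Λ^α` with the exact constant (`vflux_eq_potential`,
`fracLap_eq_potential`). The remainder contains `f* - f`, which tends to zero boundedly on the
support of `ψ`. Integrability of the dissipation density up to `z = 0` is a by-product, because the
density is nonnegative and its truncated integrals converge. -/

/-! ### Kernels on the half-space -/

/-- The decay weight `(1 + |x|²)⁻¹`, a square integrable function on the plane. -/
def decay (x : Plane) : ℝ := (1 + ‖x‖ ^ 2)⁻¹

lemma decay_pos (x : Plane) : 0 < decay x := by unfold decay; positivity

lemma decay_continuous : Continuous decay := by
  unfold decay
  exact Continuous.inv₀ (by fun_prop) (fun x => by positivity)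

lemma decay_memLp : MemLp decay 2 (volume : Measure Plane) := by
  rw [memLp_two_iff_integrable_sq decay_continuous.aestronglyMeasurable]
  -- The square of the decay weight is `(1 + |x|²)^(-4/2)`, integrable because `4` exceeds the
  -- dimension `2`.
  have h := integrable_rpow_neg_one_add_norm_sq (E := Plane) (μ := volume) (r := 4)
    (by simp; norm_num)
  refine h.congr (Filter.Eventually.of_forall fun x => ?_)
  have : (-4 / 2 : ℝ) = -((2 : ℕ) : ℝ) := by norm_num
  simp only [decay]
  rw [this, Real.rpow_neg (by positivity), Real.rpow_natCast, inv_pow]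

/-- Peetre's inequality for the decay weight. -/
lemma decay_sub_le (x y : Plane) : decay (x - y) ≤ 2 * (1 + ‖x‖ ^ 2) * decay y := by
  unfold decay
  have h : 1 + ‖y‖ ^ 2 ≤ 2 * (1 + ‖x‖ ^ 2) * (1 + ‖x - y‖ ^ 2) := by
    have h1 : ‖y‖ ≤ ‖x‖ + ‖x - y‖ := by
      calc ‖y‖ = ‖x - (x - y)‖ := by congr 1; abel
        _ ≤ _ := norm_sub_le _ _
    have h2 : ‖y‖ ^ 2 ≤ (‖x‖ + ‖x - y‖) ^ 2 := by gcongr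
    nlinarith [sq_nonneg (‖x‖ - ‖x - y‖), sq_nonneg (‖x‖ * ‖x - y‖)]
  rw [← div_eq_mul_inv, le_div_iff₀ (by positivity), inv_mul_le_iff₀ (by positivity)]
  linarith

lemma decay_sub_le_of_norm_le {r : ℝ} {x : Plane} (hx : ‖x‖ ≤ r) (y : Plane) :
    decay (x - y) ≤ 2 * (1 + r ^ 2) * decay y := by
  refine (decay_sub_le x y).trans ?_
  have := decay_pos y
  gcongr

lemma integrable_decay_mul {f : Plane → ℝ} (hf : MemLp f 2 volume) (C : ℝ) :
    Integrable (fun y => C * decay y * |f y|) := by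
  have h := (decay_memLp.integrable_mul hf.abs).const_mul C
  refine h.congr (Eventually.of_forall fun y => ?_)
  simp [mul_assoc]

/-- Kernels on the half-space that are dominated by the decay weight, locally uniformly in the
height. -/
structure IsDecaying (k : Plane → ℝ → ℝ) : Prop where
  cont : ContinuousOn (fun p : Plane × ℝ => k p.1 p.2) (univ ×ˢ Ioi 0)
  bound : ∀ a, 0 < a → ∃ C, ∀ x z, a ≤ z → |k x z| ≤ C * decay x

/-- The convolution `x ↦ ∫ k(x - y, z) f(y) dy`, at height `z`. -/
def hconv (k : Plane → ℝ → ℝ) (f : Plane → ℝ) (x : Plane) (z : ℝ) : ℝ :=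
  ∫ y, k (x - y) z * f y

lemma IsDecaying.continuous_left {k : Plane → ℝ → ℝ} (hk : IsDecaying k) {z : ℝ} (hz : 0 < z) :
    Continuous fun x => k x z := by
  have h : ContinuousOn (fun x : Plane => k x z) univ :=
    hk.cont.comp (f := fun x : Plane => (x, z)) (by fun_prop) (fun x _ => ⟨mem_univ _, hz⟩)
  exact continuousOn_univ.1 h

lemma IsDecaying.aestronglyMeasurable {k : Plane → ℝ → ℝ} (hk : IsDecaying k) {f : Plane → ℝ}
    (hf : MemLp f 2 volume) (x : Plane) {z : ℝ} (hz : 0 < z) :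
    AEStronglyMeasurable (fun y => k (x - y) z * f y) volume :=
  ((hk.continuous_left hz).comp (continuous_const.sub continuous_id)).aestronglyMeasurable.mul
    hf.aestronglyMeasurable

lemma IsDecaying.nonneg_const {k : Plane → ℝ → ℝ} (hk : IsDecaying k) {a : ℝ} (ha : 0 < a) :
    ∃ C, 0 ≤ C ∧ ∀ x z, a ≤ z → |k x z| ≤ C * decay x := by
  obtain ⟨C, hC⟩ := hk.bound a ha
  refine ⟨|C|, abs_nonneg _, fun x z hz => (hC x z hz).trans ?_⟩
  have := decay_pos x
  gcongr
  exact le_abs_self C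

/-- Peetre's inequality moves the translation by `x` into the constant. This leaves one integrable
majorant for all `x` in a ball and all heights above `a`, as dominated convergence and
differentiation under the integral require. -/
lemma IsDecaying.dominated {k : Plane → ℝ → ℝ} (hk : IsDecaying k) (f : Plane → ℝ)
    {a : ℝ} (ha : 0 < a) (r : ℝ) :
    ∃ C, ∀ x z, ‖x‖ ≤ r → a ≤ z → ∀ y, ‖k (x - y) z * f y‖ ≤ C * decay y * |f y| := by
  obtain ⟨C, hC0, hC⟩ := hk.nonneg_const ha
  refine ⟨C * (2 * (1 + r ^ 2)), fun x z hx hz y => ?_⟩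
  rw [norm_mul, Real.norm_eq_abs, Real.norm_eq_abs]
  refine mul_le_mul_of_nonneg_right ((hC _ z hz).trans ?_) (abs_nonneg _)
  have := decay_sub_le_of_norm_le hx y
  calc C * decay (x - y) ≤ C * (2 * (1 + r ^ 2) * decay y) := by gcongr
    _ = _ := by ring

lemma IsDecaying.integrable {k : Plane → ℝ → ℝ} (hk : IsDecaying k) {f : Plane → ℝ}
    (hf : MemLp f 2 volume) (x : Plane) {z : ℝ} (hz : 0 < z) :
    Integrable fun y => k (x - y) z * f y := by
  obtain ⟨C, hC⟩ := hk.dominated f hz ‖x‖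
  exact (integrable_decay_mul hf C).mono' (hk.aestronglyMeasurable hf x hz)
    (Eventually.of_forall (hC x z le_rfl le_rfl))

lemma hconv_continuousOn {k : Plane → ℝ → ℝ} (hk : IsDecaying k) {f : Plane → ℝ}
    (hf : MemLp f 2 volume) :
    ContinuousOn (fun p : Plane × ℝ => hconv k f p.1 p.2) (univ ×ˢ Ioi 0) := by
  rintro ⟨x, z⟩ ⟨-, hz⟩
  have hz : 0 < z := hz
  refine ContinuousAt.continuousWithinAt ?_
  obtain ⟨C, hC⟩ := hk.dominated f (half_pos hz) (‖x‖ + 1)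
  have hev : ∀ᶠ p : Plane × ℝ in 𝓝 (x, z), ‖p.1‖ ≤ ‖x‖ + 1 ∧ z / 2 ≤ p.2 := by
    have h1 : ∀ᶠ p : Plane × ℝ in 𝓝 (x, z), ‖p.1‖ < ‖x‖ + 1 :=
      (continuous_fst.norm.tendsto (x, z)).eventually_lt_const (by simp)
    have h2 : ∀ᶠ p : Plane × ℝ in 𝓝 (x, z), z / 2 < p.2 :=
      (continuous_snd.tendsto (x, z)).eventually_const_lt (by simp; linarith)
    filter_upwards [h1, h2] with p h1 h2 using ⟨h1.le, h2.le⟩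
  refine continuousAt_of_dominated (bound := fun y => C * decay y * |f y|) ?_ ?_
    (integrable_decay_mul hf C) ?_
  · filter_upwards [hev] with p hp
    exact hk.aestronglyMeasurable hf p.1 (by linarith [hp.2])
  · filter_upwards [hev] with p hp
    exact Eventually.of_forall (hC _ _ hp.1 hp.2)
  · refine Eventually.of_forall fun y => ?_
    have h1 : ContinuousAt (fun p : Plane × ℝ => k p.1 p.2) (x - y, z) :=
      hk.cont.continuousAt ((isOpen_univ.prod isOpen_Ioi).mem_nhds ⟨mem_univ _, hz⟩)
    have h2 : ContinuousAt (fun p : Plane × ℝ => (p.1 - y, p.2)) (x, z) := by fun_prop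
    exact (ContinuousAt.comp (f := fun p : Plane × ℝ => (p.1 - y, p.2)) (x := (x, z)) h1 h2).mul
      continuousAt_const

lemma hconv_hasDerivAt {k k' : Plane → ℝ → ℝ} (hk : IsDecaying k) (hk' : IsDecaying k')
    (hd : ∀ x z, 0 < z → HasDerivAt (k x) (k' x z) z) {f : Plane → ℝ}
    (hf : MemLp f 2 volume) (x : Plane) {z : ℝ} (hz : 0 < z) :
    HasDerivAt (hconv k f x) (hconv k' f x z) z := by
  obtain ⟨C, hC⟩ := hk'.dominated f (half_pos hz) ‖x‖
  refine (hasDerivAt_integral_of_dominated_loc_of_deriv_le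
    (bound := fun y => C * decay y * |f y|) (F := fun z y => k (x - y) z * f y)
    (F' := fun z y => k' (x - y) z * f y)
    (Ioi_mem_nhds (half_lt_self hz)) ?_ (hk.integrable hf x hz)
    (hk'.aestronglyMeasurable hf x hz) ?_ (integrable_decay_mul hf C) ?_).2
  · filter_upwards [Ioi_mem_nhds hz] with w hw
    exact hk.aestronglyMeasurable hf x hw
  · exact Eventually.of_forall fun y w hw => hC x w le_rfl (le_of_lt hw) y
  · refine Eventually.of_forall fun y w hw => ?_
    exact (hd (x - y) w ((half_pos hz).trans hw)).mul_const (f y)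

/-- The gradient kernel is dominated uniformly for base points within distance one of `x`, which
permits differentiation under the integral sign. The derivative is described by its values on
vectors, since only the directions `e i` are used. -/
lemma hconv_hasFDerivAt {k : Plane → ℝ → ℝ} {k' : Plane → Plane →L[ℝ] ℝ}
    (hk : IsDecaying k) {z : ℝ} (hz : 0 < z)
    (hcont : Continuous k') {C : ℝ} (hC0 : 0 ≤ C) (hC : ∀ x, ‖k' x‖ ≤ C * decay x)
    (hd : ∀ x, HasFDerivAt (fun x => k x z) (k' x) x) {f : Plane → ℝ}
    (hf : MemLp f 2 volume) (x : Plane) :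
    ∃ L : Plane →L[ℝ] ℝ, HasFDerivAt (fun x => hconv k f x z) L x ∧
      ∀ v, L v = ∫ y, k' (x - y) v * f y := by
  have hbd : ∀ x', ‖x'‖ ≤ ‖x‖ + 1 → ∀ y,
      ‖f y • k' (x' - y)‖ ≤ C * (2 * (1 + (‖x‖ + 1) ^ 2)) * decay y * |f y| := by
    intro x' hx' y
    rw [norm_smul, Real.norm_eq_abs, mul_comm]
    refine mul_le_mul_of_nonneg_right ((hC _).trans ?_) (abs_nonneg _)
    have := decay_sub_le_of_norm_le hx' y
    calc C * decay (x' - y) ≤ C * (2 * (1 + (‖x‖ + 1) ^ 2) * decay y) := by gcongr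
      _ = _ := by ring
  have hmeas : AEStronglyMeasurable (fun y => f y • k' (x - y)) volume :=
    hf.aestronglyMeasurable.smul
      (hcont.comp (continuous_const.sub continuous_id)).aestronglyMeasurable
  refine ⟨∫ y, f y • k' (x - y), hasFDerivAt_integral_of_dominated_of_fderiv_le
    (bound := fun y => C * (2 * (1 + (‖x‖ + 1) ^ 2)) * decay y * |f y|)
    (F := fun x y => k (x - y) z * f y)
    (F' := fun x y => f y • k' (x - y))
    (ball_mem_nhds x one_pos) ?_ (hk.integrable hf x hz) hmeas ?_ (integrable_decay_mul hf _) ?_, fun v => ?_⟩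
  · exact Eventually.of_forall fun w => hk.aestronglyMeasurable hf w hz
  · refine Eventually.of_forall fun y w hw => hbd w ?_ y
    have h1 : ‖w‖ ≤ ‖x‖ + ‖w - x‖ := by simpa using norm_add_le x (w - x)
    have h2 : ‖w - x‖ < 1 := by simpa [dist_eq_norm] using hw
    linarith
  · refine Eventually.of_forall fun y w _ => ?_
    have h1 : HasFDerivAt (fun w : Plane => w - y) (ContinuousLinearMap.id ℝ Plane) w :=
      (hasFDerivAt_id w).sub_const y
    have h2 := ((hd (w - y)).comp w h1).mul_const (f y)
    simpa using h2
  · rw [ContinuousLinearMap.integral_apply]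
    · refine integral_congr_ae (Eventually.of_forall fun y => ?_)
      simp [mul_comm]
    · exact (integrable_decay_mul hf _).mono' hmeas
        (Eventually.of_forall (hbd x (by linarith)))

/-! ### Powers of the distance to the boundary point -/

/-- The kernel `(|x|² + z²)^(-s)`. -/
def pker (s : ℝ) (x : Plane) (z : ℝ) : ℝ := (‖x‖ ^ 2 + z ^ 2) ^ (-s)

lemma base_pos (x : Plane) {z : ℝ} (hz : 0 < z) : 0 < ‖x‖ ^ 2 + z ^ 2 := by positivity

lemma pker_pos (s : ℝ) (x : Plane) {z : ℝ} (hz : 0 < z) : 0 < pker s x z :=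
  Real.rpow_pos_of_pos (base_pos x hz) _

lemma pker_nonneg (s : ℝ) (x : Plane) (z : ℝ) : 0 ≤ pker s x z :=
  Real.rpow_nonneg (by positivity) _

lemma pker_neg (s : ℝ) (x : Plane) (z : ℝ) : pker s (-x) z = pker s x z := by simp [pker]

lemma pker_sub_comm (s : ℝ) (x y : Plane) (z : ℝ) : pker s (x - y) z = pker s (y - x) z := by
  rw [← pker_neg, neg_sub]

/-- Each derivative of a power of the distance raises `s` by one and produces a polynomial factor.
This identity and the bounds derived from it absorb that factor, so all derivatives remain dominated
by kernels of the same family. -/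
lemma base_mul_pker (s : ℝ) (x : Plane) {z : ℝ} (hz : 0 < z) :
    (‖x‖ ^ 2 + z ^ 2) * pker (s + 1) x z = pker s x z := by
  unfold pker
  nth_rw 1 [← Real.rpow_one (‖x‖ ^ 2 + z ^ 2)]
  rw [← Real.rpow_add (base_pos x hz)]
  congr 1; ring

lemma sqrt_mul_pker (s : ℝ) (x : Plane) {z : ℝ} (hz : 0 < z) :
    (‖x‖ ^ 2 + z ^ 2) ^ (1 / 2 : ℝ) * pker (s + 1) x z = pker (s + 1 / 2) x z := by
  unfold pker
  rw [← Real.rpow_add (base_pos x hz)]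
  congr 1; ring

lemma le_sqrt_of_sq_le {r N : ℝ} (h : r ^ 2 ≤ N) : r ≤ N ^ (1 / 2 : ℝ) := by
  rw [← Real.sqrt_eq_rpow]; exact Real.le_sqrt_of_sq_le h

lemma norm_mul_pker_le (s : ℝ) (x : Plane) {z : ℝ} (hz : 0 < z) :
    ‖x‖ * pker (s + 1) x z ≤ pker (s + 1 / 2) x z := by
  rw [← sqrt_mul_pker s x hz]
  have := pker_pos (s + 1) x hz
  gcongr
  exact le_sqrt_of_sq_le (by nlinarith)

lemma height_mul_pker_le (s : ℝ) (x : Plane) {z : ℝ} (hz : 0 < z) :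
    z * pker (s + 1) x z ≤ pker (s + 1 / 2) x z := by
  rw [← sqrt_mul_pker s x hz]
  have := pker_pos (s + 1) x hz
  gcongr
  exact le_sqrt_of_sq_le (by nlinarith [sq_nonneg ‖x‖])

lemma norm_sq_mul_pker_le (s : ℝ) (x : Plane) {z : ℝ} (hz : 0 < z) :
    ‖x‖ ^ 2 * pker (s + 1) x z ≤ pker s x z := by
  rw [← base_mul_pker s x hz]
  have := pker_pos (s + 1) x hz
  gcongr
  nlinarith

lemma height_sq_mul_pker_le (s : ℝ) (x : Plane) {z : ℝ} (hz : 0 < z) :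
    z ^ 2 * pker (s + 1) x z ≤ pker s x z := by
  rw [← base_mul_pker s x hz]
  have := pker_pos (s + 1) x hz
  gcongr
  nlinarith [sq_nonneg ‖x‖]

lemma pker_continuousOn (s : ℝ) :
    ContinuousOn (fun p : Plane × ℝ => pker s p.1 p.2) (univ ×ˢ Ioi 0) := by
  unfold pker
  refine ContinuousOn.rpow_const (by fun_prop) (fun p hp => Or.inl ?_)
  exact (base_pos p.1 hp.2).ne'

/-- For `z ≥ a` the base `|x|² + z²` is comparable from below with `1 + |x|²`, and `s ≥ 1` makes the
power decay at least as fast as the decay weight. -/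
lemma pker_le_decay {s a : ℝ} (hs : 1 ≤ s) (ha : 0 < a) (x : Plane) {z : ℝ} (hz : a ≤ z) :
    pker s x z ≤ (min 1 (a ^ 2)) ^ (-s) * decay x := by
  have hm : 0 < min 1 (a ^ 2) := lt_min one_pos (by positivity)
  have h1 : min 1 (a ^ 2) * (1 + ‖x‖ ^ 2) ≤ ‖x‖ ^ 2 + z ^ 2 := by
    have h2 : a ^ 2 ≤ z ^ 2 := by gcongr
    have h3 := min_le_left 1 (a ^ 2)
    have h4 := min_le_right 1 (a ^ 2)
    nlinarith [sq_nonneg ‖x‖]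
  unfold pker decay
  calc (‖x‖ ^ 2 + z ^ 2) ^ (-s) ≤ (min 1 (a ^ 2) * (1 + ‖x‖ ^ 2)) ^ (-s) :=
        Real.rpow_le_rpow_of_nonpos (by positivity) h1 (by linarith)
    _ = (min 1 (a ^ 2)) ^ (-s) * (1 + ‖x‖ ^ 2) ^ (-s) :=
        Real.mul_rpow hm.le (by positivity)
    _ ≤ _ := by
        gcongr
        rw [← Real.rpow_neg_one]
        exact Real.rpow_le_rpow_of_exponent_le (by nlinarith [sq_nonneg ‖x‖]) (by linarith)

lemma isDecaying_of_le_pker {k : Plane → ℝ → ℝ} {s C : ℝ} (hs : 1 ≤ s)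
    (hcont : ContinuousOn (fun p : Plane × ℝ => k p.1 p.2) (univ ×ˢ Ioi 0))
    (hC0 : 0 ≤ C) (hC : ∀ x z, 0 < z → |k x z| ≤ C * pker s x z) : IsDecaying k where
  cont := hcont
  bound a ha := by
    refine ⟨C * (min 1 (a ^ 2)) ^ (-s), fun x z hz => (hC x z (ha.trans_le hz)).trans ?_⟩
    rw [mul_assoc]
    gcongr
    exact pker_le_decay hs ha x hz

lemma isDecaying_pker {s : ℝ} (hs : 1 ≤ s) : IsDecaying (pker s) :=
  isDecaying_of_le_pker hs (pker_continuousOn s) zero_le_one fun x z hz => by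
    rw [abs_of_pos (pker_pos s x hz), one_mul]

lemma isDecaying_height_mul_pker {s : ℝ} (hs : 1 ≤ s) (c : ℝ) :
    IsDecaying fun x z => c * (z * pker (s + 1) x z) := by
  refine isDecaying_of_le_pker (s := s + 1 / 2) (C := |c|) (by linarith) ?_ (abs_nonneg c) ?_
  · exact continuousOn_const.mul (continuousOn_snd.mul (pker_continuousOn _))
  · intro x z hz
    have := pker_pos (s + 1) x hz
    rw [abs_mul, abs_of_pos (mul_pos hz this)]
    gcongr
    exact height_mul_pker_le s x hz

lemma abs_coord_le (x : Plane) (i : Fin 2) : |x i| ≤ ‖x‖ := by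
  simpa using PiLp.norm_apply_le x i

lemma isDecaying_coord_mul_pker {s : ℝ} (hs : 1 ≤ s) (i : Fin 2) :
    IsDecaying fun x z => x i * pker (s + 1) x z := by
  refine isDecaying_of_le_pker (s := s + 1 / 2) (C := 1) (by linarith) ?_ zero_le_one ?_
  · exact ContinuousOn.mul (by fun_prop) (pker_continuousOn _)
  · intro x z hz
    have := pker_pos (s + 1) x hz
    rw [abs_mul, abs_of_pos this, one_mul]
    refine le_trans ?_ (norm_mul_pker_le s x hz)
    gcongr
    exact abs_coord_le x i

lemma isDecaying_coord_sq_mul_pker {s : ℝ} (hs : 1 ≤ s) (i : Fin 2) :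
    IsDecaying fun x z => x i ^ 2 * pker (s + 1) x z := by
  refine isDecaying_of_le_pker (s := s) (C := 1) hs ?_ zero_le_one ?_
  · exact ContinuousOn.mul (by fun_prop) (pker_continuousOn _)
  · intro x z hz
    have := pker_pos (s + 1) x hz
    rw [abs_mul, abs_of_pos this, one_mul, abs_of_nonneg (sq_nonneg _)]
    refine le_trans ?_ (norm_sq_mul_pker_le s x hz)
    gcongr ?_ * _
    rw [← sq_abs (x i)]
    gcongr
    exact abs_coord_le x i

lemma pker_hasDerivAt (s : ℝ) (x : Plane) {z : ℝ} (hz : 0 < z) :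
    HasDerivAt (pker s x) (-2 * s * (z * pker (s + 1) x z)) z := by
  have h1 : HasDerivAt (fun z : ℝ => ‖x‖ ^ 2 + z ^ 2) (2 * z) z := by
    simpa using (hasDerivAt_pow 2 z).const_add (‖x‖ ^ 2)
  have h2 := h1.rpow_const (p := -s) (Or.inl (base_pos x hz).ne')
  have h3 : (-s - 1) = -(s + 1) := by ring
  rw [h3] at h2
  refine h2.congr_deriv ?_
  simp only [pker]
  ring

lemma pker_hasFDerivAt (s : ℝ) (x : Plane) {z : ℝ} (hz : 0 < z) :
    HasFDerivAt (fun x => pker s x z) ((-2 * s * pker (s + 1) x z) • innerSL ℝ x) x := by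
  have h1 : HasFDerivAt (fun x : Plane => ‖x‖ ^ 2 + z ^ 2) (2 • innerSL ℝ x) x :=
    (hasStrictFDerivAt_norm_sq x).hasFDerivAt.add_const _
  have h2 := h1.rpow_const (p := -s) (Or.inl (base_pos x hz).ne')
  have h3 : (-s - 1) = -(s + 1) := by ring
  rw [h3] at h2
  refine h2.congr_fderiv ?_
  ext v
  simp [pker]
  ring

lemma inner_e (x : Plane) (i : Fin 2) : inner ℝ x (e i) = x i := by
  simp [e, EuclideanSpace.inner_single_right]

lemma pker_fderiv_continuous (s : ℝ) {z : ℝ} (hz : 0 < z) :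
    Continuous fun x : Plane => (-2 * s * pker (s + 1) x z) • innerSL ℝ x := by
  have h : Continuous fun x : Plane => pker (s + 1) x z := by
    unfold pker
    exact Continuous.rpow_const (by fun_prop) fun x => Or.inl (base_pos x hz).ne'
  exact (continuous_const.mul h).smul (innerSL ℝ).continuous

lemma norm_pker_fderiv_le {s : ℝ} (hs : 1 ≤ s) {z : ℝ} (hz : 0 < z) :
    ∃ C, 0 ≤ C ∧ ∀ x : Plane, ‖(-2 * s * pker (s + 1) x z) • innerSL ℝ x‖ ≤ C * decay x := by
  refine ⟨2 * s * (min 1 (z ^ 2)) ^ (-(s + 1 / 2)), ?_, fun x => ?_⟩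
  · have : 0 < min 1 (z ^ 2) := lt_min one_pos (by positivity)
    positivity
  · rw [norm_smul, innerSL_apply_norm, Real.norm_eq_abs, abs_mul,
      abs_of_pos (pker_pos (s + 1) x hz)]
    have h1 : |-2 * s| = 2 * s := by rw [abs_of_nonpos (by linarith)]; ring
    rw [h1]
    have h2 := norm_mul_pker_le s x hz
    have h3 := pker_le_decay (s := s + 1 / 2) (by linarith) hz x (le_refl z)
    calc 2 * s * pker (s + 1) x z * ‖x‖ = 2 * s * (‖x‖ * pker (s + 1) x z) := by ring
      _ ≤ 2 * s * ((min 1 (z ^ 2)) ^ (-(s + 1 / 2)) * decay x) := by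
          exact mul_le_mul_of_nonneg_left (h2.trans h3) (by linarith)
      _ = _ := by ring

/-- The `x`-gradient of the convolution with a power of the distance. -/
lemma hconv_pker_hasFDerivAt {s : ℝ} (hs : 1 ≤ s) {f : Plane → ℝ} (hf : MemLp f 2 volume)
    (x : Plane) {z : ℝ} (hz : 0 < z) :
    ∃ L : Plane →L[ℝ] ℝ, HasFDerivAt (fun x => hconv (pker s) f x z) L x ∧
      ∀ i, L (e i) = -2 * s * hconv (fun x z => x i * pker (s + 1) x z) f x z := by
  obtain ⟨C, hC0, hC⟩ := norm_pker_fderiv_le hs hz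
  obtain ⟨L, hL, hLv⟩ := hconv_hasFDerivAt
    (isDecaying_pker hs) hz (pker_fderiv_continuous s hz) hC0 hC
    (fun x => pker_hasFDerivAt s x hz) hf x
  refine ⟨L, hL, fun i => ?_⟩
  rw [hLv, hconv, ← integral_const_mul]
  refine integral_congr_ae (Eventually.of_forall fun y => ?_)
  simp only [smul_apply, innerSL_apply_apply, inner_e, smul_eq_mul]
  ring

/-- The `x`-gradient of the convolution with a component of the gradient kernel. -/
lemma hconv_coord_pker_hasFDerivAt {s : ℝ} (hs : 1 ≤ s) {f : Plane → ℝ} (hf : MemLp f 2 volume)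
    (i : Fin 2) (x : Plane) {z : ℝ} (hz : 0 < z) :
    ∃ L : Plane →L[ℝ] ℝ,
      HasFDerivAt (fun x => hconv (fun x z => x i * pker (s + 1) x z) f x z) L x ∧
      L (e i) = hconv (pker (s + 1)) f x z -
        2 * (s + 1) * hconv (fun x z => x i ^ 2 * pker (s + 1 + 1) x z) f x z := by
  have hd : ∀ x : Plane, HasFDerivAt (fun x : Plane => x i * pker (s + 1) x z)
      (x i • ((-2 * (s + 1) * pker (s + 1 + 1) x z) • innerSL ℝ x) +
        pker (s + 1) x z • (EuclideanSpace.proj i : Plane →L[ℝ] ℝ)) x := fun x =>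
    HasFDerivAt.mul (EuclideanSpace.proj i : Plane →L[ℝ] ℝ).hasFDerivAt
      (pker_hasFDerivAt (s + 1) x hz)
  have hcont : Continuous fun x : Plane =>
      (x i • ((-2 * (s + 1) * pker (s + 1 + 1) x z) • innerSL ℝ x) +
        pker (s + 1) x z • (EuclideanSpace.proj i : Plane →L[ℝ] ℝ)) := by
    refine Continuous.add (Continuous.smul (f := fun x : Plane => x i) (by fun_prop)
      (pker_fderiv_continuous (s + 1) hz)) ?_
    exact ((isDecaying_pker (s := s + 1) (by linarith)).continuous_left hz).smul continuous_const
  have hproj : ‖(EuclideanSpace.proj i : Plane →L[ℝ] ℝ)‖ ≤ 1 :=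
    ContinuousLinearMap.opNorm_le_bound _ zero_le_one fun x => by
      simpa using PiLp.norm_apply_le x i
  have hm : 0 < min 1 (z ^ 2) := lt_min one_pos (by positivity)
  have hb : ∀ x : Plane, ‖x i • ((-2 * (s + 1) * pker (s + 1 + 1) x z) • innerSL ℝ x) +
      pker (s + 1) x z • (EuclideanSpace.proj i : Plane →L[ℝ] ℝ)‖ ≤
      (2 * (s + 1) + 1) * (min 1 (z ^ 2)) ^ (-(s + 1)) * decay x := by
    intro x
    have h1 := norm_sq_mul_pker_le (s + 1) x hz
    have h2 := pker_le_decay (s := s + 1) (by linarith) hz x (le_refl z)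
    have h3 := pker_pos (s + 1) x hz
    have h4 := pker_pos (s + 1 + 1) x hz
    have h5 := abs_coord_le x i
    calc _ ≤ ‖x i • ((-2 * (s + 1) * pker (s + 1 + 1) x z) • innerSL ℝ x)‖ +
          ‖pker (s + 1) x z • (EuclideanSpace.proj i : Plane →L[ℝ] ℝ)‖ := norm_add_le _ _
      _ ≤ ‖x‖ * (2 * (s + 1) * pker (s + 1 + 1) x z * ‖x‖) + pker (s + 1) x z * 1 := by
          rw [norm_smul, norm_smul, norm_smul, innerSL_apply_norm, Real.norm_eq_abs,
            Real.norm_eq_abs, Real.norm_eq_abs, abs_mul, abs_of_pos h3, abs_of_pos h4]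
          have h6 : |-2 * (s + 1)| = 2 * (s + 1) := by rw [abs_of_nonpos (by linarith)]; ring
          rw [h6]
          gcongr
      _ = 2 * (s + 1) * (‖x‖ ^ 2 * pker (s + 1 + 1) x z) + pker (s + 1) x z := by ring
      _ ≤ 2 * (s + 1) * pker (s + 1) x z + pker (s + 1) x z := by gcongr
      _ = (2 * (s + 1) + 1) * pker (s + 1) x z := by ring
      _ ≤ (2 * (s + 1) + 1) * (min 1 (z ^ 2) ^ (-(s + 1)) * decay x) := by gcongr
      _ = _ := by ring
  obtain ⟨L, hL, hLv⟩ := hconv_hasFDerivAt  (isDecaying_coord_mul_pker hs i) hz hcont (by positivity) hb hd hf x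
  refine ⟨L, hL, ?_⟩
  have hi1 := (isDecaying_pker (s := s + 1) (by linarith)).integrable hf x hz
  have hi2 := (isDecaying_coord_sq_mul_pker (s := s + 1) (by linarith) i).integrable hf x hz
  rw [hLv, hconv, hconv, ← integral_const_mul, ← integral_sub hi1 (hi2.const_mul _)]
  refine integral_congr_ae (Eventually.of_forall fun y => ?_)
  have he : (EuclideanSpace.proj i : Plane →L[ℝ] ℝ) (e i) = 1 := by simp [e]
  simp only [add_apply, smul_apply, innerSL_apply_apply, inner_e, smul_eq_mul, he]
  ring

lemma hconv_pker_hasDerivAt {s : ℝ} (hs : 1 ≤ s) {f : Plane → ℝ} (hf : MemLp f 2 volume)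
    (x : Plane) {z : ℝ} (hz : 0 < z) :
    HasDerivAt (hconv (pker s) f x) (-2 * s * (z * hconv (pker (s + 1)) f x z)) z := by
  have h := hconv_hasDerivAt (isDecaying_pker hs) (isDecaying_height_mul_pker hs (-2 * s))
    (fun x z hz => pker_hasDerivAt s x hz) hf x hz
  refine h.congr_deriv ?_
  rw [hconv, hconv, ← integral_const_mul, ← integral_const_mul]
  refine integral_congr_ae (Eventually.of_forall fun y => ?_)
  ring

/-- `Σ_i x_i² |(x,z)|^(-2(s+1)) = |(x,z)|^(-2s) - z² |(x,z)|^(-2(s+1))`, after convolution. -/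
lemma sum_hconv_coord_sq {s : ℝ} (hs : 1 ≤ s) {f : Plane → ℝ} (hf : MemLp f 2 volume)
    (x : Plane) {z : ℝ} (hz : 0 < z) :
    ∑ i, hconv (fun x z => x i ^ 2 * pker (s + 1) x z) f x z =
      hconv (pker s) f x z - z ^ 2 * hconv (pker (s + 1)) f x z := by
  have hi := fun i => (isDecaying_coord_sq_mul_pker hs i).integrable hf x hz
  have h1 := (isDecaying_pker hs).integrable hf x hz
  have h2 := (isDecaying_pker (s := s + 1) (by linarith)).integrable hf x hz
  unfold hconv
  rw [← integral_finsetSum _ (fun i _ => hi i), ← integral_const_mul,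
    ← integral_sub h1 (h2.const_mul _)]
  refine integral_congr_ae (Eventually.of_forall fun y => ?_)
  simp only [Fin.sum_univ_two]
  rw [← base_mul_pker s (x - y) hz, EuclideanSpace.real_norm_sq_eq, Fin.sum_univ_two]
  ring

/-! ### Integration by parts on the plane -/

/-- The Laplacian on the plane. -/
def lap (ψ : Plane → ℝ) (x : Plane) : ℝ :=
  ∑ i, fderiv ℝ (fun y => fderiv ℝ ψ y (e i)) x (e i)

/-- Only `B` has compact support; `A` may be an extension or a kernel. Derivatives enter through
their value in the single direction `v`, the form in which the kernel computations supply them. -/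
lemma integral_fderiv_mul_eq_neg {A B a b : Plane → ℝ} {v : Plane}
    (hA : ∀ x, ∃ L : Plane →L[ℝ] ℝ, HasFDerivAt A L x ∧ L v = a x)
    (hB : ∀ x, ∃ L : Plane →L[ℝ] ℝ, HasFDerivAt B L x ∧ L v = b x)
    (ha : Continuous a) (hb : Continuous b) (hBc : HasCompactSupport B) :
    ∫ x, a x * B x = -∫ x, A x * b x := by
  have hAd : Differentiable ℝ A := fun x => by
    obtain ⟨L, hL, -⟩ := hA x; exact hL.differentiableAt
  have hBd : Differentiable ℝ B := fun x => by
    obtain ⟨L, hL, -⟩ := hB x; exact hL.differentiableAt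
  have hAa : ∀ x, fderiv ℝ A x v = a x := fun x => by
    obtain ⟨L, hL, h⟩ := hA x; rw [hL.fderiv, h]
  have hBb : ∀ x, fderiv ℝ B x v = b x := fun x => by
    obtain ⟨L, hL, h⟩ := hB x; rw [hL.fderiv, h]
  have hbc : HasCompactSupport b := by
    have := hBc.fderiv_apply ℝ v
    rwa [show (fun x => fderiv ℝ B x v) = b from funext hBb] at this
  have h := integral_mul_fderiv_eq_neg_fderiv_mul_of_integrable (μ := volume) (f := A) (g := B)
    (v := v) ?_ ?_ ?_ (fun x _ => hAd x) (fun x _ => hBd x)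
  · simp only [hAa, hBb] at h
    linarith
  · simp only [hAa]
    exact (ha.mul hBd.continuous).integrable_of_hasCompactSupport hBc.mul_left
  · simp only [hBb]
    exact (hAd.continuous.mul hb).integrable_of_hasCompactSupport hbc.mul_left
  · exact (hAd.continuous.mul hBd.continuous).integrable_of_hasCompactSupport hBc.mul_left

/-! ### Horizontal averages against a cut-off function -/

lemma exists_bound_on_slab {F : Plane → ℝ → ℝ}
    (hF : ContinuousOn (fun p : Plane × ℝ => F p.1 p.2) (univ ×ˢ Ioi 0)) {K : Set Plane}
    (hK : IsCompact K) {a b : ℝ} (ha : 0 < a) :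
    ∃ C, 0 ≤ C ∧ ∀ x ∈ K, ∀ z ∈ Icc a b, |F x z| ≤ C := by
  obtain ⟨C, hC⟩ := (hK.prod (isCompact_Icc (a := a) (b := b))).exists_bound_of_continuousOn
    (hF.mono fun p hp => ⟨mem_univ _, ha.trans_le hp.2.1⟩)
  refine ⟨|C|, abs_nonneg C, fun x hx z hz => (hC (x, z) ⟨hx, hz⟩).trans (le_abs_self C)⟩

lemma continuous_slice {F : Plane → ℝ → ℝ}
    (hF : ContinuousOn (fun p : Plane × ℝ => F p.1 p.2) (univ ×ˢ Ioi 0)) {z : ℝ} (hz : 0 < z) :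
    Continuous fun x => F x z := by
  have h : ContinuousOn (fun x : Plane => F x z) univ :=
    hF.comp (f := fun x : Plane => (x, z)) (by fun_prop) (fun x _ => ⟨mem_univ _, hz⟩)
  exact continuousOn_univ.1 h

lemma continuousOn_vertical {F : Plane → ℝ → ℝ}
    (hF : ContinuousOn (fun p : Plane × ℝ => F p.1 p.2) (univ ×ˢ Ioi 0)) (x : Plane) :
    ContinuousOn (F x) (Ioi 0) :=
  hF.comp (f := fun z : ℝ => (x, z)) (by fun_prop) (fun z hz => ⟨mem_univ _, hz⟩)

lemma norm_mul_le_on_slab {F : Plane → ℝ → ℝ} {ψ : Plane → ℝ} {a b C : ℝ}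
    (hC : ∀ x ∈ tsupport ψ, ∀ z ∈ Icc a b, |F x z| ≤ C) (x : Plane) {z : ℝ} (hz : z ∈ Icc a b) :
    ‖F x z * ψ x‖ ≤ C * |ψ x| := by
  rw [norm_mul, Real.norm_eq_abs, Real.norm_eq_abs]
  by_cases hx : x ∈ tsupport ψ
  · exact mul_le_mul_of_nonneg_right (hC x hx z hz) (abs_nonneg _)
  · simp [image_eq_zero_of_notMem_tsupport hx]

lemma continuousOn_integral_mul {F : Plane → ℝ → ℝ}
    (hF : ContinuousOn (fun p : Plane × ℝ => F p.1 p.2) (univ ×ˢ Ioi 0)) {ψ : Plane → ℝ}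
    (hψ : Continuous ψ) (hψc : HasCompactSupport ψ) :
    ContinuousOn (fun z => ∫ x, F x z * ψ x) (Ioi 0) := by
  intro z hz
  have hz : 0 < z := hz
  refine ContinuousAt.continuousWithinAt ?_
  obtain ⟨C, hC0, hC⟩ := exists_bound_on_slab hF (K := tsupport ψ) hψc (b := 2 * z) (half_pos hz)
  have hev : ∀ᶠ w in 𝓝 z, w ∈ Icc (z / 2) (2 * z) :=
    Icc_mem_nhds (by linarith) (by linarith)
  refine continuousAt_of_dominated (bound := fun x => C * |ψ x|) ?_ ?_ ?_ ?_
  · filter_upwards [hev] with w hw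
    exact ((continuous_slice hF ((half_pos hz).trans_le hw.1)).mul hψ).aestronglyMeasurable
  · filter_upwards [hev] with w hw
    exact Eventually.of_forall fun x => norm_mul_le_on_slab hC x hw
  · exact ((hψ.integrable_of_hasCompactSupport hψc).abs).const_mul C
  · refine Eventually.of_forall fun x => ContinuousAt.mul ?_ continuousAt_const
    exact (continuousOn_vertical hF x).continuousAt (Ioi_mem_nhds hz)

/-- On the compact support of `ψ`, with heights between `z/2` and `2z`, the vertical derivative is
bounded by continuity. No decay at infinity is needed. -/
lemma hasDerivAt_integral_mul {F F' : Plane → ℝ → ℝ}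
    (hF : ContinuousOn (fun p : Plane × ℝ => F p.1 p.2) (univ ×ˢ Ioi 0))
    (hF' : ContinuousOn (fun p : Plane × ℝ => F' p.1 p.2) (univ ×ˢ Ioi 0))
    (hd : ∀ x z, 0 < z → HasDerivAt (F x) (F' x z) z) {ψ : Plane → ℝ}
    (hψ : Continuous ψ) (hψc : HasCompactSupport ψ) {z : ℝ} (hz : 0 < z) :
    HasDerivAt (fun z => ∫ x, F x z * ψ x) (∫ x, F' x z * ψ x) z := by
  obtain ⟨C, hC0, hC⟩ := exists_bound_on_slab hF' (K := tsupport ψ) hψc (b := 2 * z) (half_pos hz)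
  have hev : Icc (z / 2) (2 * z) ∈ 𝓝 z := Icc_mem_nhds (by linarith) (by linarith)
  refine (hasDerivAt_integral_of_dominated_loc_of_deriv_le
    (bound := fun x => C * |ψ x|) (F := fun z x => F x z * ψ x)
    (F' := fun z x => F' x z * ψ x) hev ?_ ?_ ?_ ?_ ?_ ?_).2
  · filter_upwards [hev] with w hw
    exact ((continuous_slice hF ((half_pos hz).trans_le hw.1)).mul hψ).aestronglyMeasurable
  · exact ((continuous_slice hF hz).mul hψ).integrable_of_hasCompactSupport hψc.mul_left
  · exact ((continuous_slice hF' hz).mul hψ).aestronglyMeasurable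
  · exact Eventually.of_forall fun x w hw => norm_mul_le_on_slab hC x hw
  · exact ((hψ.integrable_of_hasCompactSupport hψc).abs).const_mul C
  · exact Eventually.of_forall fun x w hw =>
      (hd x w ((half_pos hz).trans_le hw.1)).mul_const (ψ x)

/-! ### The extension and its derivatives -/

/-- The normalizing constant of the weight. -/
def wconst (α : ℝ) : ℝ := 2 ^ (α - 1) * Real.Gamma (α / 2) / Real.Gamma (1 - α / 2)

lemma wconst_pos {α : ℝ} (hα₀ : 0 < α) (hα₂ : α < 2) : 0 < wconst α := by
  have h1 := Real.Gamma_pos_of_pos (show 0 < α / 2 by linarith)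
  have h2 := Real.Gamma_pos_of_pos (show 0 < 1 - α / 2 by linarith)
  unfold wconst; positivity

lemma weight_eq (α z : ℝ) : weight α z = wconst α * z ^ (1 - α) := rfl

lemma weight_pos {α : ℝ} (hα₀ : 0 < α) (hα₂ : α < 2) {z : ℝ} (hz : 0 < z) : 0 < weight α z := by
  have := wconst_pos hα₀ hα₂
  rw [weight_eq]; positivity

lemma weight_continuousOn (α : ℝ) : ContinuousOn (weight α) (Ioi 0) := by
  unfold weight
  exact continuousOn_const.mul
    (continuousOn_id.rpow_const fun z hz => Or.inl (ne_of_gt hz))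

lemma weight_hasDerivAt (α : ℝ) {z : ℝ} (hz : 0 < z) :
    HasDerivAt (weight α) ((1 - α) / z * weight α z) z := by
  have h := (Real.hasDerivAt_rpow_const (p := 1 - α) (Or.inl hz.ne')).const_mul (wconst α)
  refine h.congr_deriv ?_
  rw [weight_eq, Real.rpow_sub_one hz.ne']
  ring

/-- The power `z^α` in the Poisson kernel turns the weight into a linear factor. For this reason
`vflux` contains no fractional power of `z`. -/
lemma weight_mul_rpow (α : ℝ) {z : ℝ} (hz : 0 < z) : weight α z * z ^ α = wconst α * z := by
  rw [weight_eq, mul_assoc, ← Real.rpow_add hz]; simp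

lemma poissonKernel_eq (α : ℝ) (x : Plane) (z : ℝ) :
    poissonKernel α x z = α / (2 * Real.pi) * z ^ α * pker (1 + α / 2) x z := by
  unfold poissonKernel pker
  rw [Real.rpow_neg (by positivity), show (2 + α) / 2 = 1 + α / 2 by ring]
  ring

lemma ext_eq (α : ℝ) (f : Plane → ℝ) (x : Plane) {z : ℝ} (hz : 0 < z) :
    ext α f x z = α / (2 * Real.pi) * z ^ α * hconv (pker (1 + α / 2)) f x z := by
  rw [ext, if_neg hz.ne', hconv, ← integral_const_mul]
  refine integral_congr_ae (Eventually.of_forall fun y => ?_)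
  simp only [poissonKernel_eq]
  ring

/-- The vertical flux `w ∂_z (ext α f)`. -/
def vflux (α : ℝ) (f : Plane → ℝ) (x : Plane) (z : ℝ) : ℝ :=
  wconst α * (α / (2 * Real.pi)) * (α * hconv (pker (1 + α / 2)) f x z -
    (2 + α) * (z ^ 2 * hconv (pker (1 + α / 2 + 1)) f x z))

/-- The components of the horizontal gradient of `ext α f`. -/
def hgrad (α : ℝ) (f : Plane → ℝ) (i : Fin 2) (x : Plane) (z : ℝ) : ℝ :=
  α / (2 * Real.pi) * z ^ α *
    (-2 * (1 + α / 2) * hconv (fun x z => x i * pker (1 + α / 2 + 1) x z) f x z)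

/-- The horizontal Laplacian of `ext α f`. -/
def hlap (α : ℝ) (f : Plane → ℝ) (x : Plane) (z : ℝ) : ℝ :=
  α / (2 * Real.pi) * z ^ α * ((2 + α) ^ 2 * hconv (pker (1 + α / 2 + 1)) f x z -
    (2 + α) * (4 + α) * (z ^ 2 * hconv (pker (1 + α / 2 + 1 + 1)) f x z))

lemma hconv_pker_continuousOn {f : Plane → ℝ} (hf : MemLp f 2 volume) {s : ℝ} (hs : 1 ≤ s) :
    ContinuousOn (fun p : Plane × ℝ => hconv (pker s) f p.1 p.2) (univ ×ˢ Ioi 0) :=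
  hconv_continuousOn (isDecaying_pker hs) hf

lemma rpow_snd_continuousOn (α : ℝ) :
    ContinuousOn (fun p : Plane × ℝ => p.2 ^ α) (univ ×ˢ Ioi 0) :=
  continuousOn_snd.rpow_const fun _ hp => Or.inl (ne_of_gt hp.2)

lemma ext_continuousOn {α : ℝ} (hα₀ : 0 < α) {f : Plane → ℝ} (hf : MemLp f 2 volume) :
    ContinuousOn (fun p : Plane × ℝ => ext α f p.1 p.2) (univ ×ˢ Ioi 0) := by
  have h : ContinuousOn (fun p : Plane × ℝ =>
      α / (2 * Real.pi) * p.2 ^ α * hconv (pker (1 + α / 2)) f p.1 p.2) (univ ×ˢ Ioi 0) :=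
    (continuousOn_const.mul (rpow_snd_continuousOn α)).mul
      (hconv_pker_continuousOn hf (by linarith))
  exact h.congr fun p hp => ext_eq α f p.1 hp.2

lemma vflux_continuousOn {α : ℝ} (hα₀ : 0 < α) {f : Plane → ℝ} (hf : MemLp f 2 volume) :
    ContinuousOn (fun p : Plane × ℝ => vflux α f p.1 p.2) (univ ×ˢ Ioi 0) := by
  unfold vflux
  refine continuousOn_const.mul (ContinuousOn.sub ?_ ?_)
  · exact continuousOn_const.mul (hconv_pker_continuousOn hf (by linarith))
  · exact continuousOn_const.mul ((continuousOn_snd.pow 2).mul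
      (hconv_pker_continuousOn hf (by linarith)))

lemma hgrad_continuousOn {α : ℝ} (hα₀ : 0 < α) {f : Plane → ℝ} (hf : MemLp f 2 volume)
    (i : Fin 2) :
    ContinuousOn (fun p : Plane × ℝ => hgrad α f i p.1 p.2) (univ ×ˢ Ioi 0) := by
  unfold hgrad
  refine (continuousOn_const.mul (rpow_snd_continuousOn α)).mul (continuousOn_const.mul ?_)
  exact hconv_continuousOn (isDecaying_coord_mul_pker (s := 1 + α / 2) (by linarith) i) hf

lemma hlap_continuousOn {α : ℝ} (hα₀ : 0 < α) {f : Plane → ℝ} (hf : MemLp f 2 volume) :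
    ContinuousOn (fun p : Plane × ℝ => hlap α f p.1 p.2) (univ ×ˢ Ioi 0) := by
  unfold hlap
  refine (continuousOn_const.mul (rpow_snd_continuousOn α)).mul (ContinuousOn.sub ?_ ?_)
  · exact continuousOn_const.mul (hconv_pker_continuousOn hf (by linarith))
  · exact continuousOn_const.mul ((continuousOn_snd.pow 2).mul
      (hconv_pker_continuousOn hf (by linarith)))

lemma ext_hasDerivAt {α : ℝ} (hα₀ : 0 < α) (hα₂ : α < 2) {f : Plane → ℝ}
    (hf : MemLp f 2 volume) (x : Plane) {z : ℝ} (hz : 0 < z) :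
    HasDerivAt (ext α f x) (vflux α f x z / weight α z) z := by
  have h1 := ((Real.hasDerivAt_rpow_const (p := α) (Or.inl hz.ne')).const_mul
    (α / (2 * Real.pi))).mul (hconv_pker_hasDerivAt (s := 1 + α / 2) (by linarith) hf x hz)
  have h2 : HasDerivAt (ext α f x) _ z := h1.congr_of_eventuallyEq (by
    filter_upwards [Ioi_mem_nhds hz] with w hw using ext_eq α f x hw)
  refine h2.congr_deriv ?_
  have hw := weight_pos hα₀ hα₂ hz
  have hc := wconst_pos hα₀ hα₂
  have hzα : 0 < z ^ α := by positivity
  have hwc : wconst α = weight α z * z ^ α / z := by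
    rw [weight_mul_rpow α hz]; field_simp
  rw [vflux, hwc, Real.rpow_sub_one hz.ne']
  field_simp
  ring

/-- This is the extension equation `∇·(w∇f*) = 0`, read as an evolution of the vertical flux in `z`.
It follows by comparing the vertical derivative of the kernel with its horizontal Laplacian. -/
lemma vflux_hasDerivAt {α : ℝ} (hα₀ : 0 < α) {f : Plane → ℝ}
    (hf : MemLp f 2 volume) (x : Plane) {z : ℝ} (hz : 0 < z) :
    HasDerivAt (vflux α f x) (-(weight α z * hlap α f x z)) z := by
  have h0 := hconv_pker_hasDerivAt (s := 1 + α / 2) (by linarith) hf x hz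
  have h1 := hconv_pker_hasDerivAt (s := 1 + α / 2 + 1) (by linarith) hf x hz
  have h2 := ((h0.const_mul α).sub (((hasDerivAt_pow 2 z).mul h1).const_mul (2 + α))).const_mul
    (wconst α * (α / (2 * Real.pi)))
  refine h2.congr_deriv ?_
  have hw := weight_mul_rpow α hz
  calc _ = -(wconst α * z * (α / (2 * Real.pi) * ((2 + α) ^ 2 *
        hconv (pker (1 + α / 2 + 1)) f x z -
      (2 + α) * (4 + α) * (z ^ 2 * hconv (pker (1 + α / 2 + 1 + 1)) f x z)))) := by
        simp; ring
    _ = _ := by rw [← hw, hlap]; ring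

lemma ext_hasFDerivAt {α : ℝ} (hα₀ : 0 < α) {f : Plane → ℝ}
    (hf : MemLp f 2 volume) (x : Plane) {z : ℝ} (hz : 0 < z) :
    ∃ L : Plane →L[ℝ] ℝ, HasFDerivAt (fun x => ext α f x z) L x ∧
      ∀ i, L (e i) = hgrad α f i x z := by
  obtain ⟨L, hL, hLe⟩ := hconv_pker_hasFDerivAt (s := 1 + α / 2) (by linarith) hf x hz
  refine ⟨(α / (2 * Real.pi) * z ^ α) • L, ?_, fun i => ?_⟩
  · have h := hL.const_mul (α / (2 * Real.pi) * z ^ α)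
    rwa [show (fun x => ext α f x z) = _ from funext fun x => ext_eq α f x hz]
  · simp [hLe, hgrad]

lemma hgrad_hasFDerivAt {α : ℝ} (hα₀ : 0 < α) {f : Plane → ℝ}
    (hf : MemLp f 2 volume) (i : Fin 2) (x : Plane) {z : ℝ} (hz : 0 < z) :
    ∃ L : Plane →L[ℝ] ℝ, HasFDerivAt (fun x => hgrad α f i x z) L x ∧
      L (e i) = α / (2 * Real.pi) * z ^ α * (-2 * (1 + α / 2) *
        (hconv (pker (1 + α / 2 + 1)) f x z - 2 * (1 + α / 2 + 1) *
          hconv (fun x z => x i ^ 2 * pker (1 + α / 2 + 1 + 1) x z) f x z)) := by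
  obtain ⟨L, hL, hLe⟩ := hconv_coord_pker_hasFDerivAt (s := 1 + α / 2) (by linarith) hf i x hz
  refine ⟨(α / (2 * Real.pi) * z ^ α) • ((-2 * (1 + α / 2)) • L), ?_, ?_⟩
  · exact (hL.const_mul _).const_mul _
  · simp [hLe]

/-- The diagonal second derivatives contain `x_i²` times a kernel. Their sum reduces to pure powers
of the distance by `sum_hconv_coord_sq`. -/
lemma sum_hgrad_fderiv {α : ℝ} (hα₀ : 0 < α) {f : Plane → ℝ}
    (hf : MemLp f 2 volume) (x : Plane) {z : ℝ} (hz : 0 < z) :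
    ∑ i, α / (2 * Real.pi) * z ^ α * (-2 * (1 + α / 2) *
        (hconv (pker (1 + α / 2 + 1)) f x z - 2 * (1 + α / 2 + 1) *
          hconv (fun x z => x i ^ 2 * pker (1 + α / 2 + 1 + 1) x z) f x z)) = hlap α f x z := by
  have h := sum_hconv_coord_sq (s := 1 + α / 2 + 1) (by linarith) hf x hz
  rw [Fin.sum_univ_two] at h ⊢
  rw [hlap]
  linear_combination (α / (2 * Real.pi) * z ^ α * (2 * (1 + α / 2)) * (2 * (1 + α / 2 + 1))) * h

/-- By the Riesz representation the operator norm is the Euclidean norm of the representing vector.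
This splits `gradSq` into coordinate derivatives. -/
lemma norm_sq_dual (L : Plane →L[ℝ] ℝ) : ‖L‖ ^ 2 = ∑ i, L (e i) ^ 2 := by
  obtain ⟨v, rfl⟩ := (InnerProductSpace.toDual ℝ Plane).surjective L
  rw [LinearIsometryEquiv.norm_map, EuclideanSpace.real_norm_sq_eq]
  refine Finset.sum_congr rfl fun i _ => ?_
  rw [InnerProductSpace.toDual_apply_apply, inner_e]

lemma gradSq_ext {α : ℝ} (hα₀ : 0 < α) (hα₂ : α < 2) {f : Plane → ℝ}
    (hf : MemLp f 2 volume) (x : Plane) {z : ℝ} (hz : 0 < z) :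
    gradSq (ext α f) x z = ∑ i, hgrad α f i x z ^ 2 + (vflux α f x z / weight α z) ^ 2 := by
  obtain ⟨L, hL, hLe⟩ := ext_hasFDerivAt hα₀ hf x hz
  rw [gradSq, hL.fderiv, norm_sq_dual, (ext_hasDerivAt hα₀ hα₂ hf x hz).deriv]
  simp only [hLe]

lemma gradSq_ext_continuousOn {α : ℝ} (hα₀ : 0 < α) (hα₂ : α < 2) {f : Plane → ℝ}
    (hf : MemLp f 2 volume) :
    ContinuousOn (fun p : Plane × ℝ => gradSq (ext α f) p.1 p.2) (univ ×ˢ Ioi 0) := by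
  have h : ContinuousOn (fun p : Plane × ℝ => ∑ i, hgrad α f i p.1 p.2 ^ 2 +
      (vflux α f p.1 p.2 / weight α p.2) ^ 2) (univ ×ˢ Ioi 0) := by
    refine ContinuousOn.add (continuousOn_finsetSum _ fun i _ =>
      (hgrad_continuousOn hα₀ hf i).pow 2) (ContinuousOn.pow ?_ 2)
    refine (vflux_continuousOn hα₀ hf).div
      ((weight_continuousOn α).comp continuousOn_snd fun p hp => hp.2) fun p hp => ?_
    exact (weight_pos hα₀ hα₂ hp.2).ne'
  exact h.congr fun p hp => gradSq_ext hα₀ hα₂ hf p.1 hp.2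

lemma lap_continuous {ψ : Plane → ℝ} (hψ : ContDiff ℝ ∞ ψ) : Continuous (lap ψ) := by
  unfold lap
  refine continuous_finsetSum _ fun i _ => ?_
  have h1 : ContDiff ℝ ∞ fun y => fderiv ℝ ψ y (e i) :=
    (hψ.fderiv_right (m := ∞) (by simp)).clm_apply contDiff_const
  exact (h1.continuous_fderiv (by simp)).clm_apply continuous_const

/-- Horizontal integration by parts: the Laplacian of half the square. -/
lemma integral_hlap {α : ℝ} (hα₀ : 0 < α) {f : Plane → ℝ}
    (hf : MemLp f 2 volume) {ψ : Plane → ℝ} (hψ : ContDiff ℝ ∞ ψ) (hψc : HasCompactSupport ψ)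
    {z : ℝ} (hz : 0 < z) :
    ∫ x, ext α f x z * hlap α f x z * ψ x =
      -(∫ x, (∑ i, hgrad α f i x z ^ 2) * ψ x) + 1 / 2 * ∫ x, ext α f x z ^ 2 * lap ψ x := by
  have hdψ : ∀ i, ContDiff ℝ ∞ fun y => fderiv ℝ ψ y (e i) := fun i =>
    (hψ.fderiv_right (m := ∞) (by simp)).clm_apply contDiff_const
  have hddψ : ∀ i, Continuous fun x => fderiv ℝ (fun y => fderiv ℝ ψ y (e i)) x (e i) := fun i =>
    ((hdψ i).continuous_fderiv (by simp)).clm_apply continuous_const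
  have hU := continuous_slice (ext_continuousOn hα₀ hf) hz
  have hG := fun i => continuous_slice (hgrad_continuousOn hα₀ hf i) hz
  have hUd := fun x => ext_hasFDerivAt hα₀ hf x hz
  set D : Fin 2 → Plane → ℝ := fun i x => α / (2 * Real.pi) * z ^ α * (-2 * (1 + α / 2) *
        (hconv (pker (1 + α / 2 + 1)) f x z - 2 * (1 + α / 2 + 1) *
          hconv (fun x z => x i ^ 2 * pker (1 + α / 2 + 1 + 1) x z) f x z)) with hD
  have hDc : ∀ i, Continuous (D i) := fun i => by
    have h1 := continuous_slice (hconv_pker_continuousOn hf (s := 1 + α / 2 + 1)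
      (by linarith)) hz
    have h2 := continuous_slice (hconv_continuousOn
      (isDecaying_coord_sq_mul_pker (s := 1 + α / 2 + 1) (by linarith) i) hf) hz
    fun_prop
  have hprod : ∀ i x, ∃ L : Plane →L[ℝ] ℝ, HasFDerivAt (fun x => ext α f x z * ψ x) L x ∧
      L (e i) = hgrad α f i x z * ψ x + ext α f x z * fderiv ℝ ψ x (e i) := by
    intro i x
    obtain ⟨L, hL, hLe⟩ := hUd x
    refine ⟨_, hL.mul (hψ.differentiable (by simp) x).hasFDerivAt, ?_⟩
    simp [hLe]; ring
  have hsq : ∀ i x, ∃ L : Plane →L[ℝ] ℝ, HasFDerivAt (fun x => ext α f x z ^ 2) L x ∧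
      L (e i) = 2 * ext α f x z * hgrad α f i x z := by
    intro i x
    obtain ⟨L, hL, hLe⟩ := hUd x
    refine ⟨_, hL.pow 2, ?_⟩
    simp [hLe]
  -- First integration by parts: one derivative moves from the gradient of the extension onto the
  -- product of the extension and `ψ`.
  have h1 : ∀ i, ∫ x, D i x * (ext α f x z * ψ x) =
      -∫ x, hgrad α f i x z * (hgrad α f i x z * ψ x + ext α f x z * fderiv ℝ ψ x (e i)) :=
    fun i => integral_fderiv_mul_eq_neg (fun x => hgrad_hasFDerivAt hα₀ hf i x hz) (hprod i)
      (hDc i) (((hG i).mul hψ.continuous).add (hU.mul (hdψ i).continuous)) hψc.mul_left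
  -- The cross term contains half the gradient of the squared extension, so a second integration by
  -- parts puts both derivatives on `ψ`.
  have h2 : ∀ i, ∫ x, 2 * ext α f x z * hgrad α f i x z * fderiv ℝ ψ x (e i) =
      -∫ x, ext α f x z ^ 2 * fderiv ℝ (fun y => fderiv ℝ ψ y (e i)) x (e i) := fun i =>
    integral_fderiv_mul_eq_neg (hsq i)
      (fun x => ⟨_, ((hdψ i).differentiable (by simp) x).hasFDerivAt, rfl⟩)
      ((continuous_const.mul hU).mul (hG i)) (hddψ i) (hψc.fderiv_apply ℝ _)
  have hi1 : ∀ i, Integrable fun x => hgrad α f i x z ^ 2 * ψ x := fun i =>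
    (((hG i).pow 2).mul hψ.continuous).integrable_of_hasCompactSupport hψc.mul_left
  have hi2 : ∀ i, Integrable fun x => 2 * ext α f x z * hgrad α f i x z * fderiv ℝ ψ x (e i) :=
    fun i => (((continuous_const.mul hU).mul (hG i)).mul
      (hdψ i).continuous).integrable_of_hasCompactSupport (hψc.fderiv_apply ℝ _).mul_left
  have hi3 : ∀ i, Integrable fun x => D i x * (ext α f x z * ψ x) := fun i =>
    ((hDc i).mul (hU.mul hψ.continuous)).integrable_of_hasCompactSupport
      hψc.mul_left.mul_left
  have hi4 : ∀ i, Integrable fun x =>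
      ext α f x z ^ 2 * fderiv ℝ (fun y => fderiv ℝ ψ y (e i)) x (e i) := fun i =>
    ((hU.pow 2).mul (hddψ i)).integrable_of_hasCompactSupport
      ((hψc.fderiv_apply ℝ _).fderiv_apply ℝ _).mul_left
  have h3 : ∀ i, ∫ x, D i x * (ext α f x z * ψ x) = -(∫ x, hgrad α f i x z ^ 2 * ψ x) +
      1 / 2 * ∫ x, ext α f x z ^ 2 * fderiv ℝ (fun y => fderiv ℝ ψ y (e i)) x (e i) := by
    intro i
    have h4 : ∫ x, hgrad α f i x z *
        (hgrad α f i x z * ψ x + ext α f x z * fderiv ℝ ψ x (e i)) =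
        (∫ x, hgrad α f i x z ^ 2 * ψ x) +
          1 / 2 * ∫ x, 2 * ext α f x z * hgrad α f i x z * fderiv ℝ ψ x (e i) := by
      rw [← integral_const_mul, ← integral_add (hi1 i) ((hi2 i).const_mul _)]
      refine integral_congr_ae (Eventually.of_forall fun x => ?_)
      ring
    rw [h1, h4, h2]; ring
  calc ∫ x, ext α f x z * hlap α f x z * ψ x = ∫ x, ∑ i, D i x * (ext α f x z * ψ x) := by
        refine integral_congr_ae (Eventually.of_forall fun x => ?_)
        simp only
        rw [← Finset.sum_mul, sum_hgrad_fderiv hα₀ hf x hz]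
        ring
    _ = ∑ i, (-(∫ x, hgrad α f i x z ^ 2 * ψ x) +
      1 / 2 * ∫ x, ext α f x z ^ 2 * fderiv ℝ (fun y => fderiv ℝ ψ y (e i)) x (e i)) := by
        rw [integral_finsetSum _ fun i _ => hi3 i]
        exact Finset.sum_congr rfl fun i _ => h3 i
    _ = _ := by
        rw [Finset.sum_add_distrib, Finset.sum_neg_distrib, ← Finset.mul_sum,
          ← integral_finsetSum _ fun i _ => hi1 i, ← integral_finsetSum _ fun i _ => hi4 i]
        simp only [lap, Finset.sum_mul, Finset.mul_sum]

/-! ### The energy balance above a positive height -/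

/-- The weighted Bessel operator `z^(-b) ∂_z (z^b ∂_z)`, `b = 1 - α`. -/
def vlap (α : ℝ) (ψs : ℝ → ℝ) (z : ℝ) : ℝ := deriv (deriv ψs) z + (1 - α) / z * deriv ψs z

section VerticalCutoff

variable {α Rs R₀ C₀ δ : ℝ} {ψs : ℝ → ℝ}

lemma IsVerticalCutoff.contDiffAt (h : IsVerticalCutoff α Rs R₀ C₀ δ ψs) {z : ℝ} (hz : 0 < z) :
    ContDiffAt ℝ ∞ ψs z := h.smooth.contDiffAt (Ici_mem_nhds hz)

lemma IsVerticalCutoff.contDiffOn_deriv (h : IsVerticalCutoff α Rs R₀ C₀ δ ψs) :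
    ContDiffOn ℝ ∞ (deriv ψs) (Ioi 0) :=
  (h.smooth.mono Ioi_subset_Ici_self).deriv_of_isOpen isOpen_Ioi (by simp)

lemma IsVerticalCutoff.hasDerivAt (h : IsVerticalCutoff α Rs R₀ C₀ δ ψs) {z : ℝ} (hz : 0 < z) :
    HasDerivAt ψs (deriv ψs z) z :=
  ((h.contDiffAt hz).differentiableAt (by simp)).hasDerivAt

lemma IsVerticalCutoff.hasDerivAt_deriv (h : IsVerticalCutoff α Rs R₀ C₀ δ ψs) {z : ℝ}
    (hz : 0 < z) : HasDerivAt (deriv ψs) (deriv (deriv ψs) z) z :=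
  ((h.contDiffOn_deriv.contDiffAt (Ioi_mem_nhds hz)).differentiableAt (by simp)).hasDerivAt

lemma IsVerticalCutoff.vlap_continuousOn (h : IsVerticalCutoff α Rs R₀ C₀ δ ψs) :
    ContinuousOn (vlap α ψs) (Ioi 0) := by
  have h2 : ContDiffOn ℝ ∞ (deriv (deriv ψs)) (Ioi 0) :=
    h.contDiffOn_deriv.deriv_of_isOpen isOpen_Ioi (by simp)
  exact h2.continuousOn.add ((continuousOn_const.div continuousOn_id
    fun z hz => ne_of_gt hz).mul h.contDiffOn_deriv.continuousOn)

lemma IsVerticalCutoff.deriv_eq_zero_low (h : IsVerticalCutoff α Rs R₀ C₀ δ ψs) {z : ℝ}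
    (hz : 0 < z) (hz' : z < Rs) : deriv ψs z = 0 := by
  have : ψs =ᶠ[𝓝 z] fun _ => 1 := by
    filter_upwards [Ioo_mem_nhds hz hz'] with w hw using h.eq_one w ⟨hw.1.le, hw.2.le⟩
  rw [this.deriv_eq]; simp

lemma IsVerticalCutoff.deriv_eq_zero_high (h : IsVerticalCutoff α Rs R₀ C₀ δ ψs) {z : ℝ}
    (hz : Rs + R₀ < z) : deriv ψs z = 0 := by
  have : ψs =ᶠ[𝓝 z] fun _ => 0 := by
    filter_upwards [Ioi_mem_nhds hz] with w hw using h.eq_zero w (le_of_lt hw)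
  rw [this.deriv_eq]; simp

lemma IsVerticalCutoff.vlap_eq_zero_low (h : IsVerticalCutoff α Rs R₀ C₀ δ ψs) {z : ℝ}
    (hz : 0 < z) (hz' : z < Rs) : vlap α ψs z = 0 := by
  have : deriv ψs =ᶠ[𝓝 z] fun _ => 0 := by
    filter_upwards [Ioo_mem_nhds hz hz'] with w hw using h.deriv_eq_zero_low hw.1 hw.2
  rw [vlap, this.deriv_eq, h.deriv_eq_zero_low hz hz']; simp

lemma IsVerticalCutoff.vlap_eq_zero_high (h : IsVerticalCutoff α Rs R₀ C₀ δ ψs) {z : ℝ}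
    (hz : Rs + R₀ < z) : vlap α ψs z = 0 := by
  have : deriv ψs =ᶠ[𝓝 z] fun _ => 0 := by
    filter_upwards [Ioi_mem_nhds hz] with w hw using h.deriv_eq_zero_high hw
  rw [vlap, this.deriv_eq, h.deriv_eq_zero_high hz]; simp

lemma IsVerticalCutoff.nonneg (h : IsVerticalCutoff α Rs R₀ C₀ δ ψs) {z : ℝ} (hz : 0 ≤ z) :
    0 ≤ ψs z := by
  rcases le_total (Rs + R₀) z with h1 | h1
  · rw [h.eq_zero z h1]
  · rw [← h.eq_zero (Rs + R₀) le_rfl]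
    exact h.anti hz (hz.trans h1) h1

lemma IsVerticalCutoff.le_one (h : IsVerticalCutoff α Rs R₀ C₀ δ ψs) (hRs : 0 < Rs) {z : ℝ}
    (hz : 0 ≤ z) : ψs z ≤ 1 := by
  rw [← h.eq_one 0 ⟨le_rfl, hRs.le⟩]
  exact h.anti (mem_Ici.2 le_rfl) hz hz

/-- The energy balance of the extension above the height `a`. -/
lemma energy_balance_above (hα₀ : 0 < α) (hα₂ : α < 2) (hR₀ : 0 < R₀)
    (h : IsVerticalCutoff α Rs R₀ C₀ δ ψs) {f : Plane → ℝ}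
    (hf : MemLp f 2 volume) {ψ : Plane → ℝ} (hψ : ContDiff ℝ ∞ ψ) (hψc : HasCompactSupport ψ)
    {a : ℝ} (ha : 0 < a) (haR : a < Rs) :
    -(∫ x, ext α f x a * vflux α f x a * ψ x) =
      ∫ z in a..(Rs + R₀ + 1),
        (weight α z * (∫ x, gradSq (ext α f) x z * ψ x) * ψs z -
          1 / 2 * weight α z * ((∫ x, ext α f x z ^ 2 * lap ψ x) * ψs z +
            (∫ x, ext α f x z ^ 2 * ψ x) * vlap α ψs z)) := by
  have hU := ext_continuousOn hα₀ hf
  have hq := vflux_continuousOn hα₀ hf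
  have hl := hlap_continuousOn hα₀ hf
  have hgr := gradSq_ext_continuousOn hα₀ hα₂ hf
  have hwc : ContinuousOn (fun p : Plane × ℝ => weight α p.2) (univ ×ˢ Ioi 0) :=
    (weight_continuousOn α).comp continuousOn_snd fun p hp => hp.2
  have hlapc : HasCompactSupport (lap ψ) := by
    have h0 : HasCompactSupport (fun x => fderiv ℝ (fun y => fderiv ℝ ψ y (e 0)) x (e 0) +
        fderiv ℝ (fun y => fderiv ℝ ψ y (e 1)) x (e 1)) :=
      ((hψc.fderiv_apply ℝ _).fderiv_apply ℝ _).add ((hψc.fderiv_apply ℝ _).fderiv_apply ℝ _)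
    convert h0 using 2
    simp [lap, Fin.sum_univ_two]
  set J : ℝ → ℝ := fun z => ∫ x, ext α f x z ^ 2 * ψ x
  set Q : ℝ → ℝ := fun z => ∫ x, ext α f x z * vflux α f x z * ψ x
  set D : ℝ → ℝ := fun z => ∫ x, gradSq (ext α f) x z * ψ x
  set Lz : ℝ → ℝ := fun z => ∫ x, ext α f x z ^ 2 * lap ψ x
  -- `J' = 2Q/w` because the vertical flux is `w` times the vertical derivative.
  have hJ : ∀ z, 0 < z → HasDerivAt J (2 * Q z / weight α z) z := by
    intro z hz
    have h1 := hasDerivAt_integral_mul (F := fun x z => ext α f x z ^ 2)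
      (F' := fun x z => 2 * ext α f x z * (vflux α f x z / weight α z)) (hU.pow 2)
      ((continuousOn_const.mul hU).mul (hq.div hwc fun p hp => (weight_pos hα₀ hα₂ hp.2).ne'))
      (fun x z hz => ((ext_hasDerivAt hα₀ hα₂ hf x hz).pow 2).congr_deriv (by simp)) hψ.continuous hψc hz
    refine h1.congr_deriv ?_
    rw [mul_div_right_comm, ← integral_const_mul]
    refine integral_congr_ae (Eventually.of_forall fun x => ?_)
    simp only
    ring
  have hQ : ∀ z, 0 < z → HasDerivAt Q (weight α z * D z - 1 / 2 * weight α z * Lz z) z := by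
    intro z hz
    have hw := weight_pos hα₀ hα₂ hz
    have h1 := hasDerivAt_integral_mul (F := fun x z => ext α f x z * vflux α f x z)
      (F' := fun x z => vflux α f x z / weight α z * vflux α f x z +
        ext α f x z * (-(weight α z * hlap α f x z))) (hU.mul hq)
      (((hq.div hwc fun p hp => (weight_pos hα₀ hα₂ hp.2).ne').mul hq).add
        (hU.mul (hwc.mul hl).neg))
      (fun x z hz => (ext_hasDerivAt hα₀ hα₂ hf x hz).mul (vflux_hasDerivAt hα₀ hf x hz))
      hψ.continuous hψc hz
    refine h1.congr_deriv ?_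
    have h2 := integral_hlap hα₀ hf hψ hψc hz
    have hi1 : Integrable fun x => ext α f x z * hlap α f x z * ψ x :=
      (((continuous_slice hU hz).mul (continuous_slice hl hz)).mul
        hψ.continuous).integrable_of_hasCompactSupport hψc.mul_left
    have hi2 : Integrable fun x => (∑ i, hgrad α f i x z ^ 2) * ψ x :=
      ((continuous_finsetSum _ fun i _ =>
        (continuous_slice (hgrad_continuousOn hα₀ hf i) hz).pow 2).mul
        hψ.continuous).integrable_of_hasCompactSupport hψc.mul_left
    have hi3 : Integrable fun x => gradSq (ext α f) x z * ψ x :=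
      ((continuous_slice hgr hz).mul hψ.continuous).integrable_of_hasCompactSupport hψc.mul_left
    have h3 : ∫ x, (vflux α f x z / weight α z * vflux α f x z +
        ext α f x z * (-(weight α z * hlap α f x z))) * ψ x =
        weight α z * (D z - (∫ x, (∑ i, hgrad α f i x z ^ 2) * ψ x) -
          ∫ x, ext α f x z * hlap α f x z * ψ x) := by
      simp only [D]
      rw [← integral_sub hi3 hi2, ← integral_sub (f := fun x => gradSq (ext α f) x z * ψ x -
        (∑ i, hgrad α f i x z ^ 2) * ψ x) (hi3.sub hi2) hi1, ← integral_const_mul]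
      refine integral_congr_ae (Eventually.of_forall fun x => ?_)
      simp only [gradSq_ext hα₀ hα₂ hf x hz]
      field_simp
      ring
    rw [h3, h2]
    ring
  -- An exact primitive of the integrand. The terms with `ψs'` cancel: differentiating `Q ψs` gives
  -- `Q ψs'`, and differentiating `J` in the second part gives `½ (2Q/w) w ψs'` with the opposite
  -- sign. What remains of the second part is `½ J (w ψs')' = ½ w J vlap`.
  have hderiv : ∀ z ∈ uIcc a (Rs + R₀ + 1), HasDerivAt
      (fun z => Q z * ψs z - 1 / 2 * (J z * (weight α z * deriv ψs z)))
      (weight α z * D z * ψs z - 1 / 2 * weight α z * (Lz z * ψs z + J z * vlap α ψs z)) z := by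
    intro z hz
    rw [uIcc_of_le (by linarith)] at hz
    have hz0 : 0 < z := ha.trans_le hz.1
    have hw := weight_pos hα₀ hα₂ hz0
    have h1 := ((hQ z hz0).mul (h.hasDerivAt hz0)).sub
      (((hJ z hz0).mul ((weight_hasDerivAt α hz0).mul (h.hasDerivAt_deriv hz0))).const_mul (1 / 2))
    refine h1.congr_deriv ?_
    simp only [vlap, Pi.mul_apply]
    field_simp
    ring
  have hψsc : ContinuousOn ψs (Ioi 0) := h.smooth.continuousOn.mono Ioi_subset_Ici_self
  have hcont : ContinuousOn (fun z => weight α z * D z * ψs z -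
      1 / 2 * weight α z * (Lz z * ψs z + J z * vlap α ψs z)) (Ioi 0) := by
    have hDc : ContinuousOn D (Ioi 0) := continuousOn_integral_mul hgr hψ.continuous hψc
    have hLc : ContinuousOn Lz (Ioi 0) :=
      continuousOn_integral_mul (F := fun x z => ext α f x z ^ 2) (hU.pow 2)
        (lap_continuous hψ) hlapc
    have hJc : ContinuousOn J (Ioi 0) :=
      continuousOn_integral_mul (F := fun x z => ext α f x z ^ 2) (hU.pow 2) hψ.continuous hψc
    exact (((weight_continuousOn α).mul hDc).mul hψsc).sub
      ((continuousOn_const.mul (weight_continuousOn α)).mul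
        ((hLc.mul hψsc).add (hJc.mul h.vlap_continuousOn)))
  -- The upper limit exceeds `Rs + R₀`, so `ψs` and `ψs'` both vanish there. At `a < Rs` one has `ψs
  -- = 1` and `ψs' = 0`, and only the boundary flux survives.
  rw [intervalIntegral.integral_eq_sub_of_hasDerivAt hderiv]
  · rw [h.eq_zero _ (by linarith), h.deriv_eq_zero_high (by linarith),
      h.eq_one a ⟨ha.le, haR.le⟩, h.deriv_eq_zero_low ha haR]
    simp [Q]
  · refine (hcont.mono fun z hz => ?_).intervalIntegrable
    rw [uIcc_of_le (by linarith)] at hz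
    exact ha.trans_le hz.1

end VerticalCutoff

/-! ### The vertical flux of a test function as a potential of its Laplacian -/

lemma memLp_of_contDiff {h : Plane → ℝ} (hh : ContDiff ℝ ∞ h) (hc : HasCompactSupport h) :
    MemLp h 2 volume :=
  hh.continuous.memLp_of_hasCompactSupport hc

lemma contDiff_fderiv_apply {h : Plane → ℝ} (hh : ContDiff ℝ ∞ h) (v : Plane) :
    ContDiff ℝ ∞ fun y => fderiv ℝ h y v :=
  (hh.fderiv_right (m := ∞) (by simp)).clm_apply contDiff_const

lemma lap_hasCompactSupport {h : Plane → ℝ} (hc : HasCompactSupport h) :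
    HasCompactSupport (lap h) := by
  have h0 : HasCompactSupport (fun x => fderiv ℝ (fun y => fderiv ℝ h y (e 0)) x (e 0) +
      fderiv ℝ (fun y => fderiv ℝ h y (e 1)) x (e 1)) :=
    ((hc.fderiv_apply ℝ _).fderiv_apply ℝ _).add ((hc.fderiv_apply ℝ _).fderiv_apply ℝ _)
  convert h0 using 2
  simp [lap, Fin.sum_univ_two]

lemma pker_sub_hasFDerivAt (s : ℝ) (x y : Plane) {z : ℝ} (hz : 0 < z) :
    ∃ L : Plane →L[ℝ] ℝ, HasFDerivAt (fun y => pker s (y - x) z) L y ∧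
      ∀ i, L (e i) = -2 * s * ((y - x) i * pker (s + 1) (y - x) z) := by
  have h1 : HasFDerivAt (fun y : Plane => y - x) (ContinuousLinearMap.id ℝ Plane) y :=
    (hasFDerivAt_id y).sub_const x
  have h2 := (pker_hasFDerivAt s (y - x) hz).comp y h1
  refine ⟨_, h2, fun i => ?_⟩
  simp only [ContinuousLinearMap.comp_id, smul_apply, innerSL_apply_apply, inner_e, smul_eq_mul]
  ring

lemma coord_pker_sub_hasFDerivAt (s : ℝ) (i : Fin 2) (x y : Plane) {z : ℝ} (hz : 0 < z) :
    ∃ L : Plane →L[ℝ] ℝ,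
      HasFDerivAt (fun y : Plane => (y - x) i * pker s (y - x) z) L y ∧
      L (e i) = pker s (y - x) z - 2 * s * ((y - x) i ^ 2 * pker (s + 1) (y - x) z) := by
  have h1 : HasFDerivAt (fun y : Plane => (y - x) i)
      (EuclideanSpace.proj i : Plane →L[ℝ] ℝ) y := by
    have h := ((EuclideanSpace.proj i : Plane →L[ℝ] ℝ).hasFDerivAt (x := y - x)).comp y
      ((hasFDerivAt_id y).sub_const x)
    rwa [ContinuousLinearMap.comp_id] at h
  obtain ⟨L, hL, hLe⟩ := pker_sub_hasFDerivAt s x y hz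
  refine ⟨_, h1.mul hL, ?_⟩
  have he : (EuclideanSpace.proj i : Plane →L[ℝ] ℝ) (e i) = 1 := by simp [e]
  simp only [add_apply, smul_apply, smul_eq_mul, he, hLe]
  ring

lemma pker_sub_continuous (s : ℝ) (x : Plane) {z : ℝ} (hz : 0 < z) :
    Continuous fun y : Plane => pker s (y - x) z := by
  unfold pker
  exact Continuous.rpow_const (by fun_prop) fun y => Or.inl (base_pos (y - x) hz).ne'

/-- Two integrations by parts transfer the Laplacian to the kernel. In dimension two the sum over
coordinates of the second derivatives simplifies by `base_mul_pker` to the combination on the right.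
-/
lemma integral_pker_mul_lap (s : ℝ) {h : Plane → ℝ} (hh : ContDiff ℝ ∞ h)
    (hc : HasCompactSupport h) (x : Plane) {z : ℝ} (hz : 0 < z) :
    ∫ y, pker s (y - x) z * lap h y =
      2 * s * ∫ y, (2 * s * pker (s + 1) (y - x) z -
        2 * (s + 1) * (z ^ 2 * pker (s + 1 + 1) (y - x) z)) * h y := by
  have hp := fun s => pker_sub_continuous s x hz
  have hd := fun i => contDiff_fderiv_apply hh (e i)
  have hdd : ∀ i, Continuous fun x => fderiv ℝ (fun y => fderiv ℝ h y (e i)) x (e i) := fun i =>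
    (contDiff_fderiv_apply (hd i) (e i)).continuous
  have hco : ∀ i, Continuous fun y : Plane => (y - x) i := fun i => by fun_prop
  have h1 : ∀ i, ∫ y, -2 * s * ((y - x) i * pker (s + 1) (y - x) z) * fderiv ℝ h y (e i) =
      -∫ y, pker s (y - x) z * fderiv ℝ (fun y => fderiv ℝ h y (e i)) y (e i) := fun i =>
    integral_fderiv_mul_eq_neg (v := e i)
      (fun y => by
        obtain ⟨L, hL, hLe⟩ := pker_sub_hasFDerivAt s x y hz; exact ⟨L, hL, hLe i⟩)
      (fun y => ⟨_, ((hd i).differentiable (by simp) y).hasFDerivAt, rfl⟩)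
      (continuous_const.mul ((hco i).mul (hp _))) (hdd i) (hc.fderiv_apply ℝ _)
  have h2 : ∀ i, ∫ y, (pker (s + 1) (y - x) z - 2 * (s + 1) * ((y - x) i ^ 2 *
      pker (s + 1 + 1) (y - x) z)) * h y =
      -∫ y, (y - x) i * pker (s + 1) (y - x) z * fderiv ℝ h y (e i) := fun i =>
    integral_fderiv_mul_eq_neg (v := e i)
      (fun y => coord_pker_sub_hasFDerivAt (s + 1) i x y hz)
      (fun y => ⟨_, (hh.differentiable (by simp) y).hasFDerivAt, rfl⟩)
      ((hp _).sub (continuous_const.mul (((hco i).pow 2).mul (hp _)))) (hd i).continuous hc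
  have h3 : ∀ i, ∫ y, pker s (y - x) z * fderiv ℝ (fun y => fderiv ℝ h y (e i)) y (e i) =
      -2 * s * ∫ y, (pker (s + 1) (y - x) z - 2 * (s + 1) * ((y - x) i ^ 2 *
      pker (s + 1 + 1) (y - x) z)) * h y := by
    intro i
    have h4 : ∫ y, -2 * s * ((y - x) i * pker (s + 1) (y - x) z) * fderiv ℝ h y (e i) =
        -2 * s * ∫ y, (y - x) i * pker (s + 1) (y - x) z * fderiv ℝ h y (e i) := by
      rw [← integral_const_mul]
      refine integral_congr_ae (Eventually.of_forall fun y => ?_)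
      ring
    rw [h2 i]
    linear_combination h1 i - h4
  have hi1 : ∀ i, Integrable fun y =>
      pker s (y - x) z * fderiv ℝ (fun y => fderiv ℝ h y (e i)) y (e i) := fun i =>
    ((hp s).mul (hdd i)).integrable_of_hasCompactSupport
      ((hc.fderiv_apply ℝ _).fderiv_apply ℝ _).mul_left
  have hi2 : ∀ i, Integrable fun y => (pker (s + 1) (y - x) z - 2 * (s + 1) * ((y - x) i ^ 2 *
      pker (s + 1 + 1) (y - x) z)) * h y := fun i =>
    (((hp _).sub (continuous_const.mul (((hco i).pow 2).mul (hp _)))).mul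
      hh.continuous).integrable_of_hasCompactSupport hc.mul_left
  calc ∫ y, pker s (y - x) z * lap h y
      = ∑ i, ∫ y, pker s (y - x) z * fderiv ℝ (fun y => fderiv ℝ h y (e i)) y (e i) := by
        rw [← integral_finsetSum _ fun i _ => hi1 i]
        simp only [lap, Finset.mul_sum]
    _ = -2 * s * ∫ y, ∑ i, (pker (s + 1) (y - x) z - 2 * (s + 1) * ((y - x) i ^ 2 *
      pker (s + 1 + 1) (y - x) z)) * h y := by
        rw [integral_finsetSum _ fun i _ => hi2 i, Finset.mul_sum]
        exact Finset.sum_congr rfl fun i _ => h3 i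
    _ = _ := by
        rw [← integral_const_mul, ← integral_const_mul]
        refine integral_congr_ae (Eventually.of_forall fun y => ?_)
        have h5 := base_mul_pker (s + 1) (y - x) hz
        rw [EuclideanSpace.real_norm_sq_eq] at h5
        simp only [Fin.sum_univ_two] at h5 ⊢
        linear_combination (4 * s * (s + 1) * h y) * h5

/-- For `s = α/2` the Laplacian of `pker s` is, up to a constant, the kernel of the vertical flux.
On a test function the derivatives can stay on `h`, and the remaining exponent `α/2 < 1` is locally
integrable even at `z = 0`. This makes the limit at the boundary accessible. -/
lemma vflux_eq_potential {α : ℝ} (hα₀ : 0 < α) {h : Plane → ℝ} (hh : ContDiff ℝ ∞ h)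
    (hc : HasCompactSupport h) (x : Plane) {z : ℝ} (hz : 0 < z) :
    vflux α h x z = wconst α / (2 * Real.pi) * ∫ y, pker (α / 2) (y - x) z * lap h y := by
  have hf := memLp_of_contDiff hh hc
  have h1 := (isDecaying_pker (s := 1 + α / 2) (by linarith)).integrable hf x hz
  have h2 := (isDecaying_pker (s := 1 + α / 2 + 1) (by linarith)).integrable hf x hz
  rw [integral_pker_mul_lap _ hh hc x hz, vflux, hconv, hconv]
  have h3 : α * (∫ y, pker (1 + α / 2) (x - y) z * h y) -
      (2 + α) * (z ^ 2 * ∫ y, pker (1 + α / 2 + 1) (x - y) z * h y) =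
      ∫ y, (2 * (α / 2) * pker (α / 2 + 1) (y - x) z -
        2 * (α / 2 + 1) * (z ^ 2 * pker (α / 2 + 1 + 1) (y - x) z)) * h y := by
    rw [← integral_const_mul, ← integral_const_mul, ← integral_const_mul,
      ← integral_sub (h1.const_mul _) ((h2.const_mul _).const_mul _)]
    refine integral_congr_ae (Eventually.of_forall fun y => ?_)
    simp only [pker_sub_comm _ x y, add_comm 1 (α / 2)]
    ring
  rw [h3]
  ring

/-! ### Fourier transforms of test functions -/

lemma contDiff_ofReal_comp {h : Plane → ℝ} (hh : ContDiff ℝ ∞ h) :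
    ContDiff ℝ ∞ fun y => (h y : ℂ) := Complex.ofRealCLM.contDiff.comp hh

lemma hasCompactSupport_ofReal_comp {h : Plane → ℝ} (hc : HasCompactSupport h) :
    HasCompactSupport fun y => (h y : ℂ) := hc.comp_left (g := ((↑) : ℝ → ℂ)) (by simp)

/-- A test function as a complex valued Schwartz function. -/
def toSchwartz {h : Plane → ℝ} (hh : ContDiff ℝ ∞ h) (hc : HasCompactSupport h) :
    SchwartzMap Plane ℂ :=
  (hasCompactSupport_ofReal_comp hc).toSchwartzMap (contDiff_ofReal_comp hh)

lemma toSchwartz_apply {h : Plane → ℝ} (hh : ContDiff ℝ ∞ h) (hc : HasCompactSupport h)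
    (x : Plane) : toSchwartz hh hc x = (h x : ℂ) := rfl

lemma fourier_toSchwartz {h : Plane → ℝ} (hh : ContDiff ℝ ∞ h) (hc : HasCompactSupport h) :
    ⇑(𝓕 (toSchwartz hh hc) : SchwartzMap Plane ℂ) = 𝓕 (fun y => (h y : ℂ)) := rfl

lemma fourier_fderiv_apply {h : Plane → ℝ} (hh : ContDiff ℝ ∞ h) (hc : HasCompactSupport h)
    (v ξ : Plane) :
    𝓕 (fun y => ((fderiv ℝ h y v : ℝ) : ℂ)) ξ =
      2 * Real.pi * Complex.I * (inner ℝ ξ v : ℝ) * 𝓕 (fun y => (h y : ℂ)) ξ := by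
  have h1 := congrArg (fun g : SchwartzMap Plane ℂ => g ξ)
    (SchwartzMap.fourier_lineDerivOp_eq (toSchwartz hh hc) v)
  have h2 : (fun y => ((fderiv ℝ h y v : ℝ) : ℂ)) =
      ⇑(LineDeriv.lineDerivOp v (toSchwartz hh hc)) := by
    funext y
    rw [SchwartzMap.lineDerivOp_apply_eq_fderiv]
    have h3 : HasFDerivAt (fun y => (h y : ℂ)) (Complex.ofRealCLM.comp (fderiv ℝ h y)) y :=
      Complex.ofRealCLM.hasFDerivAt.comp y (hh.differentiable (by simp) y).hasFDerivAt
    change _ = fderiv ℝ (fun y => (h y : ℂ)) y v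
    rw [h3.fderiv]
    simp
  have hg : (inner ℝ · v : Plane → ℝ).HasTemperateGrowth :=
    ((innerSL ℝ).flip v).hasTemperateGrowth
  rw [h2, ← SchwartzMap.fourier_coe]
  rw [h1]
  simp [hg, fourier_toSchwartz, mul_assoc]

/-- The factor `-4π²|ξ|²` is the sum of the two squared symbols `2πi ξ_i`. -/
lemma fourier_lap {h : Plane → ℝ} (hh : ContDiff ℝ ∞ h) (hc : HasCompactSupport h) (ξ : Plane) :
    𝓕 (fun y => (lap h y : ℂ)) ξ =
      ((-(4 * Real.pi ^ 2 * ‖ξ‖ ^ 2) : ℝ) : ℂ) * 𝓕 (fun y => (h y : ℂ)) ξ := by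
  have hd := fun i => contDiff_fderiv_apply hh (e i)
  have hdc : ∀ i, HasCompactSupport fun y => fderiv ℝ h y (e i) := fun i => hc.fderiv_apply ℝ _
  have h1 : ∀ i, 𝓕 (fun y => ((fderiv ℝ (fun y => fderiv ℝ h y (e i)) y (e i) : ℝ) : ℂ)) ξ =
      (2 * Real.pi * Complex.I * (ξ i : ℝ)) ^ 2 * 𝓕 (fun y => (h y : ℂ)) ξ := by
    intro i
    rw [fourier_fderiv_apply (hd i) (hdc i), fourier_fderiv_apply hh hc, inner_e]
    ring
  have h2 : (fun y => (lap h y : ℂ)) =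
      ⇑(toSchwartz (contDiff_fderiv_apply (hd 0) (e 0)) ((hdc 0).fderiv_apply ℝ _) +
        toSchwartz (contDiff_fderiv_apply (hd 1) (e 1)) ((hdc 1).fderiv_apply ℝ _)) := by
    funext y
    simp [lap, Fin.sum_univ_two, toSchwartz_apply]
  rw [h2, ← SchwartzMap.fourier_coe, FourierAdd.fourier_add, add_apply,
    fourier_toSchwartz, fourier_toSchwartz, h1, h1, EuclideanSpace.real_norm_sq_eq,
    Fin.sum_univ_two]
  push_cast
  linear_combination (4 * Real.pi ^ 2 * ((ξ 0 : ℂ) ^ 2 + (ξ 1 : ℂ) ^ 2) *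
    𝓕 (fun y => (h y : ℂ)) ξ) * Complex.I_sq

/-- For `0 < α < 2` one has `|ξ|^α ≤ 1 + |ξ|²`, and the Fourier transform of a test function is a
Schwartz function. -/
lemma fourier_integrable_rpow_mul {h : Plane → ℝ} (hh : ContDiff ℝ ∞ h)
    (hc : HasCompactSupport h) {α : ℝ} (hα₀ : 0 < α) (hα₂ : α < 2) :
    Integrable fun ξ : Plane => ‖ξ‖ ^ α * ‖𝓕 (fun y => (h y : ℂ)) ξ‖ := by
  have h0 := (𝓕 (toSchwartz hh hc) : SchwartzMap Plane ℂ).integrable_pow_mul volume 0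
  have h2 := (𝓕 (toSchwartz hh hc) : SchwartzMap Plane ℂ).integrable_pow_mul volume 2
  rw [fourier_toSchwartz] at h0 h2
  refine (h0.add h2).mono' ?_ (Eventually.of_forall fun ξ => ?_)
  · refine AEStronglyMeasurable.mul ?_ ?_
    · exact (continuous_norm.rpow_const fun _ => Or.inr hα₀.le).aestronglyMeasurable
    · rw [← fourier_toSchwartz hh hc]
      exact (SchwartzMap.continuous _).norm.aestronglyMeasurable
  · rw [Real.norm_of_nonneg (by positivity)]
    simp only [Pi.add_apply, ← add_mul, pow_zero]
    gcongr
    rcases le_total ‖ξ‖ 1 with h | h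
    · have := Real.rpow_le_one (norm_nonneg ξ) h hα₀.le
      nlinarith [sq_nonneg ‖ξ‖]
    · have := Real.rpow_le_rpow_of_exponent_le h hα₂.le
      rw [Real.rpow_two] at this
      linarith

/-! ### Gamma integrals -/

lemma gamma_integrableOn {a R : ℝ} (ha : 0 < a) (hR : 0 < R) :
    IntegrableOn (fun ρ : ℝ => ρ ^ (a - 1) * Real.exp (-(R * ρ))) (Ioi 0) := by
  have := integrableOn_rpow_mul_exp_neg_mul_rpow (p := 1) (s := a - 1) (by linarith) one_pos hR
  simpa using this

lemma gamma_integral {a R : ℝ} (ha : 0 < a) (hR : 0 < R) :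
    ∫ ρ in Ioi (0 : ℝ), ρ ^ (a - 1) * Real.exp (-(R * ρ)) = R ^ (-a) * Real.Gamma a := by
  rw [Real.integral_rpow_mul_exp_neg_mul_Ioi ha hR, one_div, Real.inv_rpow hR.le,
    Real.rpow_neg hR.le]

lemma gamma_inv_aux {a R ρ : ℝ} (hρ : 0 < ρ) :
    (|(-1 : ℝ)| * ρ ^ ((-1 : ℝ) - 1)) •
      ((ρ ^ (-1 : ℝ)) ^ (a - 1) * Real.exp (-(R * ρ ^ (-1 : ℝ)))) =
    ρ ^ (-a - 1) * Real.exp (-(R / ρ)) := by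
  rw [← Real.rpow_mul hρ.le, smul_eq_mul, abs_neg, abs_one, one_mul, ← mul_assoc,
    ← Real.rpow_add hρ, Real.rpow_neg_one, div_eq_mul_inv]
  congr 2; ring

lemma gamma_inv_integrableOn {a R : ℝ} (ha : 0 < a) (hR : 0 < R) :
    IntegrableOn (fun ρ : ℝ => ρ ^ (-a - 1) * Real.exp (-(R / ρ))) (Ioi 0) := by
  have h := (integrableOn_Ioi_comp_rpow_iff
    (fun ρ : ℝ => ρ ^ (a - 1) * Real.exp (-(R * ρ))) (p := -1) (by norm_num)).2
    (gamma_integrableOn ha hR)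
  exact h.congr_fun (fun ρ hρ => gamma_inv_aux hρ) measurableSet_Ioi

/-- The substitution `ρ ↦ 1/ρ` in the Gamma integral. It represents a negative power of `R` as a
superposition of Gaussians whose width grows with `ρ`. -/
lemma gamma_inv_integral {a R : ℝ} (ha : 0 < a) (hR : 0 < R) :
    ∫ ρ in Ioi (0 : ℝ), ρ ^ (-a - 1) * Real.exp (-(R / ρ)) = R ^ (-a) * Real.Gamma a := by
  rw [← gamma_integral ha hR, ← integral_comp_rpow_Ioi
    (fun ρ : ℝ => ρ ^ (a - 1) * Real.exp (-(R * ρ))) (p := -1) (by norm_num)]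
  exact setIntegral_congr_fun measurableSet_Ioi fun ρ hρ => (gamma_inv_aux hρ).symm

/-- Exchange of integrals for a nonnegative kernel with known integral in the parameter. -/
lemma integral_swap_of_kernel {g : ℝ → Plane → ℝ} {G : Plane → ℝ} {c : Plane → ℂ}
    (hg : Measurable fun p : ℝ × Plane => g p.1 p.2) (hg0 : ∀ ρ, 0 < ρ → ∀ y, 0 ≤ g ρ y)
    (hgi : ∀ᵐ y, IntegrableOn (fun ρ => g ρ y) (Ioi 0))
    (hG : ∀ᵐ y, ∫ ρ in Ioi (0 : ℝ), g ρ y = G y)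
    (hc : AEStronglyMeasurable c volume) (hGc : Integrable fun y => G y * ‖c y‖) :
    ∫ ρ in Ioi (0 : ℝ), ∫ y, (g ρ y : ℂ) * c y = ∫ y, (G y : ℂ) * c y := by
  have hm : AEStronglyMeasurable (Function.uncurry fun ρ y => (g ρ y : ℂ) * c y)
      ((volume.restrict (Ioi (0 : ℝ))).prod (volume : Measure Plane)) :=
    (Complex.measurable_ofReal.comp hg).aestronglyMeasurable.mul
      (hc.comp_quasiMeasurePreserving Measure.quasiMeasurePreserving_snd)
  rw [integral_integral_swap]
  · refine integral_congr_ae ?_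
    filter_upwards [hG] with y hy
    rw [integral_mul_const, integral_complex_ofReal, hy]
  · rw [integrable_prod_iff' hm]
    constructor
    · filter_upwards [hgi] with y hy
      exact (Integrable.ofReal hy).mul_const (c y)
    · refine hGc.congr ?_
      filter_upwards [hG] with y hy
      rw [← hy, ← integral_mul_const]
      refine setIntegral_congr_fun measurableSet_Ioi fun ρ hρ => ?_
      simp [abs_of_nonneg (hg0 ρ hρ y)]

/-! ### The fractional Laplacian as a Riesz potential of the Laplacian -/

lemma pker_zero (a : ℝ) (v : Plane) : pker a v 0 = (‖v‖ ^ 2) ^ (-a) := by simp [pker]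

lemma pker_zero_measurable (a : ℝ) : Measurable fun v : Plane => pker a v 0 := by
  unfold pker
  fun_prop

/-- In polar coordinates the density is `r^(1 - 2a)`, which is integrable at zero exactly because `a
< 1`. -/
lemma pker_zero_integrableOn {a : ℝ} (ha₁ : a < 1) :
    IntegrableOn (fun v : Plane => pker a v 0) (ball 0 1) := by
  have h := (integrableOn_fun_norm_addHaar (volume : Measure Plane) (r := 1)
    (f := fun r : ℝ => (r ^ 2) ^ (-a))).2 ?_
  · simpa [pker_zero] using h
  · have h1 : IntegrableOn (fun y : ℝ => y ^ (1 - 2 * a)) (Ioo 0 1) :=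
      (intervalIntegral.integrableOn_Ioo_rpow_iff one_pos).2 (by linarith)
    refine h1.congr_fun (fun y hy => ?_) measurableSet_Ioo
    have hy0 : 0 < y := hy.1
    simp only [finrank_euclideanSpace, Fintype.card_fin, smul_eq_mul]
    rw [← Real.rpow_natCast y 2, ← Real.rpow_mul hy0.le, ← Real.rpow_natCast y (2 - 1),
      ← Real.rpow_add hy0]
    congr 1; norm_num; ring

/-- Within unit distance the kernel is integrable and is paired with the supremum of `k`; beyond it
the kernel is at most `1` and is paired with the integral of `|k|`. Translation invariance makes the
bound independent of `x`. -/
lemma pker_zero_mul_bound {a : ℝ} (ha₀ : 0 < a) (ha₁ : a < 1) {k : Plane → ℝ}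
    (hk : Continuous k) (hkc : HasCompactSupport k) :
    ∃ C, ∀ x, Integrable (fun y => pker a (y - x) 0 * |k y|) ∧
      ∫ y, pker a (y - x) 0 * |k y| ≤ C := by
  obtain ⟨M, hM⟩ := hk.bounded_above_of_compact_support hkc
  have hM0 : 0 ≤ M := (norm_nonneg _).trans (hM 0)
  set φ : Plane → ℝ := (ball (0 : Plane) 1).indicator fun v => pker a v 0 with hφ
  have hφi : Integrable φ := (pker_zero_integrableOn ha₁).integrable_indicator measurableSet_ball
  have hki : Integrable fun y => |k y| := (hk.integrable_of_hasCompactSupport hkc).abs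
  have hle : ∀ x y, pker a (y - x) 0 * |k y| ≤ |k y| + M * φ (y - x) := by
    intro x y
    have hp := pker_nonneg a (y - x) 0
    by_cases h : y - x ∈ ball (0 : Plane) 1
    · have h1 : φ (y - x) = pker a (y - x) 0 := indicator_of_mem h _
      rw [h1]
      have h2 : |k y| ≤ M := hM y
      nlinarith [abs_nonneg (k y)]
    · have h1 : φ (y - x) = 0 := indicator_of_notMem h _
      have h2 : 1 ≤ ‖y - x‖ := by simpa using h
      have h3 : pker a (y - x) 0 ≤ 1 := by
        rw [pker_zero]
        exact Real.rpow_le_one_of_one_le_of_nonpos (by nlinarith) (by linarith)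
      rw [h1, mul_zero, add_zero]
      exact mul_le_of_le_one_left (abs_nonneg _) h3
  have hi : ∀ x, Integrable fun y => |k y| + M * φ (y - x) := fun x =>
    hki.add ((hφi.comp_sub_right x).const_mul M)
  have hint : ∀ x, Integrable fun y => pker a (y - x) 0 * |k y| := fun x => by
    refine (hi x).mono' ?_ (Eventually.of_forall fun y => ?_)
    · exact (((pker_zero_measurable a).comp (measurable_id.sub_const x)).mul
        hk.measurable.abs).aestronglyMeasurable
    · rw [Real.norm_of_nonneg (mul_nonneg (pker_nonneg _ _ _) (abs_nonneg _))]
      exact hle x y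
  refine ⟨(∫ y, |k y|) + M * ∫ v, φ v, fun x => ⟨hint x, ?_⟩⟩
  calc ∫ y, pker a (y - x) 0 * |k y| ≤ ∫ y, |k y| + M * φ (y - x) :=
        integral_mono (hint x) (hi x) (hle x)
    _ = _ := by
        rw [integral_add hki ((hφi.comp_sub_right x).const_mul M), integral_const_mul,
          integral_sub_right_eq_self φ x]

/-- The multiplication formula `∫ ĝ k = ∫ g k̂` for a Gaussian `g` modulated by the character at
`x`, whose transform is a Gaussian centred at `x`. -/
lemma gaussian_identity {k : Plane → ℂ} (hk : Integrable k) (x : Plane) {ρ : ℝ} (hρ : 0 < ρ) :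
    ∫ y, ((Real.pi / ρ * Real.exp (-(Real.pi ^ 2 * ‖y - x‖ ^ 2 / ρ)) : ℝ) : ℂ) * k y =
      ∫ ξ, ((Real.exp (-(‖ξ‖ ^ 2 * ρ)) : ℝ) : ℂ) *
        (Complex.exp (2 * Real.pi * Complex.I * (inner ℝ x ξ : ℝ)) * 𝓕 k ξ) := by
  have hb : 0 < (ρ : ℂ).re := by simpa
  have J : Integrable (fun v : Plane =>
      Complex.exp (-(ρ : ℂ) * ‖v‖ ^ 2 + 2 * Real.pi * Complex.I * (inner ℝ x v : ℝ))) :=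
    GaussianFourier.integrable_cexp_neg_mul_sq_norm_add hb _ _
  have h : ∫ y, 𝓕 (fun v : Plane => Complex.exp (-(ρ : ℂ) * ‖v‖ ^ 2 +
      2 * Real.pi * Complex.I * (inner ℝ x v : ℝ))) y • k y =
      ∫ ξ, Complex.exp (-(ρ : ℂ) * ‖ξ‖ ^ 2 +
      2 * Real.pi * Complex.I * (inner ℝ x ξ : ℝ)) • 𝓕 k ξ := by
    simpa using! (VectorFourier.integral_fourierIntegral_smul_eq_flip (L := innerₗ Plane)
      Real.continuous_fourierChar continuous_inner J hk)
  refine (Eq.trans ?_ h).trans ?_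
  · refine integral_congr_ae (Eventually.of_forall fun y => ?_)
    simp only
    have h1 : ((Real.pi : ℂ) / ρ) ^ ((Module.finrank ℝ Plane : ℂ) / 2) = Real.pi / ρ := by simp
    rw [fourier_gaussian_innerProductSpace' hb, norm_sub_rev y x, h1, smul_eq_mul]
    push_cast
    congr 3
    ring
  · refine integral_congr_ae (Eventually.of_forall fun ξ => ?_)
    simp only [smul_eq_mul]
    rw [Complex.exp_add, ← mul_assoc]
    congr 2
    push_cast
    congr 1; ring

/-- `Λ^α` as a Riesz potential of the Laplacian. -/
lemma fracLap_eq_potential {α : ℝ} (hα₀ : 0 < α) (hα₂ : α < 2) {h : Plane → ℝ}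
    (hh : ContDiff ℝ ∞ h) (hc : HasCompactSupport h) (x : Plane) :
    fracLap α h x = -(wconst α / (2 * Real.pi)) * ∫ y, pker (α / 2) (y - x) 0 * lap h y := by
  have ha₀ : 0 < α / 2 := by linarith
  have ha₁ : 0 < 1 - α / 2 := by linarith
  have hΓ₀ := Real.Gamma_pos_of_pos ha₀
  have hΓ₁ := Real.Gamma_pos_of_pos ha₁
  have hlc := lap_continuous hh
  have hls := lap_hasCompactSupport hc
  set k : Plane → ℂ := fun y => (lap h y : ℂ) with hk
  have hki : Integrable k := (hlc.integrable_of_hasCompactSupport hls).ofReal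
  set c : Plane → ℂ := fun ξ =>
    Complex.exp (2 * Real.pi * Complex.I * (inner ℝ x ξ : ℝ)) * 𝓕 k ξ with hcdef
  have hnorm : ∀ ξ, ‖Complex.exp (2 * Real.pi * Complex.I * (inner ℝ x ξ : ℝ))‖ = 1 := fun ξ => by
    rw [show 2 * Real.pi * Complex.I * ((inner ℝ x ξ : ℝ) : ℂ) =
      ((2 * Real.pi * inner ℝ x ξ : ℝ) : ℂ) * Complex.I by push_cast; ring]
    exact Complex.norm_exp_ofReal_mul_I _
  have hkF : ∀ ξ, 𝓕 k ξ = ((-(4 * Real.pi ^ 2 * ‖ξ‖ ^ 2) : ℝ) : ℂ) *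
    𝓕 (fun y => (h y : ℂ)) ξ := fourier_lap hh hc
  have hFc : Continuous (𝓕 (fun y => (h y : ℂ))) := by
    rw [← fourier_toSchwartz hh hc]
    exact SchwartzMap.continuous _
  have hcc : Continuous c := by
    rw [hcdef]
    simp only [hkF]
    fun_prop
  have hne : ∀ v : Plane, ∀ᵐ y : Plane, y ≠ v := fun v => by
    simp [ae_iff]
  have hrpow : ∀ ξ : Plane, ξ ≠ 0 → (‖ξ‖ ^ 2) ^ (-(1 - α / 2)) * ‖ξ‖ ^ 2 = ‖ξ‖ ^ α := by
    intro ξ hξ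
    have h0 : 0 < ‖ξ‖ := norm_pos_iff.2 hξ
    rw [← Real.rpow_natCast ‖ξ‖ 2, ← Real.rpow_mul h0.le, ← Real.rpow_add h0]
    congr 1; push_cast; ring
  -- Physical side: superposing the Gaussians in `ρ` with density `ρ^(-α/2 - 1)` produces the Riesz
  -- kernel `|y - x|^(-α)`, with Gamma constant `Γ(α/2)`.
  have h1 := integral_swap_of_kernel (c := k)
    (g := fun ρ y => Real.pi * (ρ ^ (-(α / 2) - 1) *
      Real.exp (-(Real.pi ^ 2 * ‖y - x‖ ^ 2 / ρ))))
    (G := fun y => Real.pi * (Real.pi ^ 2) ^ (-(α / 2)) * Real.Gamma (α / 2) *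
      pker (α / 2) (y - x) 0)
    (by fun_prop) (fun ρ hρ y => by positivity)
    (by
      filter_upwards [hne x] with y hy
      have : 0 < ‖y - x‖ := norm_pos_iff.2 (sub_ne_zero.2 hy)
      exact (gamma_inv_integrableOn ha₀ (by positivity)).const_mul _)
    (by
      filter_upwards [hne x] with y hy
      have : 0 < ‖y - x‖ := norm_pos_iff.2 (sub_ne_zero.2 hy)
      rw [integral_const_mul, gamma_inv_integral ha₀ (by positivity),
        Real.mul_rpow (by positivity) (by positivity), pker_zero]
      ring)
    hki.aestronglyMeasurable
    (by
      obtain ⟨C, hC⟩ := pker_zero_mul_bound ha₀ (by linarith) hlc hls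
      refine ((hC x).1.const_mul
        (Real.pi * (Real.pi ^ 2) ^ (-(α / 2)) * Real.Gamma (α / 2))).congr
        (Eventually.of_forall fun y => ?_)
      simp [hk, mul_assoc])
  -- Fourier side: the same superposition produces `|ξ|^(α - 2)` with Gamma constant `Γ(1 - α/2)`.
  -- The factor `|ξ|²` from the Laplacian restores `|ξ|^α` and makes the integral converge
  -- absolutely.
  have h2 := integral_swap_of_kernel (c := c)
    (g := fun ρ ξ => ρ ^ (1 - α / 2 - 1) * Real.exp (-(‖ξ‖ ^ 2 * ρ)))
    (G := fun ξ => (‖ξ‖ ^ 2) ^ (-(1 - α / 2)) * Real.Gamma (1 - α / 2))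
    (by fun_prop) (fun ρ hρ y => by positivity)
    (by
      filter_upwards [hne 0] with y hy
      have : 0 < ‖y‖ := norm_pos_iff.2 hy
      exact gamma_integrableOn ha₁ (by positivity))
    (by
      filter_upwards [hne 0] with y hy
      have : 0 < ‖y‖ := norm_pos_iff.2 hy
      rw [gamma_integral ha₁ (by positivity)])
    hcc.aestronglyMeasurable
    (by
      refine ((fourier_integrable_rpow_mul hh hc hα₀ hα₂).const_mul
        (Real.Gamma (1 - α / 2) * (4 * Real.pi ^ 2))).congr ?_
      filter_upwards [hne 0] with ξ hξ
      rw [← hrpow ξ hξ]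
      have hn : ‖((-(4 * Real.pi ^ 2 * ‖ξ‖ ^ 2) : ℝ) : ℂ)‖ = 4 * Real.pi ^ 2 * ‖ξ‖ ^ 2 := by
        rw [Complex.norm_real, norm_neg, Real.norm_of_nonneg (by positivity)]
      simp only [hcdef, hkF]
      rw [norm_mul, norm_mul, hnorm, hn]
      ring)
  have h3 : ∫ ρ in Ioi (0 : ℝ), ∫ y, ((Real.pi * (ρ ^ (-(α / 2) - 1) *
      Real.exp (-(Real.pi ^ 2 * ‖y - x‖ ^ 2 / ρ))) : ℝ) : ℂ) * k y =
      ∫ ρ in Ioi (0 : ℝ), ∫ ξ, ((ρ ^ (1 - α / 2 - 1) * Real.exp (-(‖ξ‖ ^ 2 * ρ)) : ℝ) : ℂ) *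
        c ξ := by
    refine setIntegral_congr_fun measurableSet_Ioi fun ρ hρ => ?_
    have hρ : 0 < ρ := hρ
    -- The Gaussian identity is multiplied by `ρ^(-α/2)`. With the factor `π/ρ` on the left this
    -- gives the exponents of both superpositions.
    have h4 := congrArg (fun w : ℂ => ((ρ ^ (-(α / 2)) : ℝ) : ℂ) * w) (gaussian_identity hki x hρ)
    simp only [← integral_const_mul] at h4
    refine (Eq.trans ?_ h4).trans ?_
    · refine integral_congr_ae (Eventually.of_forall fun y => ?_)
      simp only [Real.rpow_sub_one hρ.ne']
      push_cast
      ring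
    · refine integral_congr_ae (Eventually.of_forall fun ξ => ?_)
      simp only [show 1 - α / 2 - 1 = -(α / 2) by ring]
      push_cast
      ring
  rw [h1, h2] at h3
  have h5 : 𝓕⁻ (fun ξ : Plane => (((2 * Real.pi * ‖ξ‖) ^ α : ℝ) : ℂ) *
      𝓕 (fun y : Plane => (h y : ℂ)) ξ) x =
      ((-((2 * Real.pi) ^ α / (4 * Real.pi ^ 2 * Real.Gamma (1 - α / 2))) : ℝ) : ℂ) *
      ∫ ξ, (((‖ξ‖ ^ 2) ^ (-(1 - α / 2)) * Real.Gamma (1 - α / 2) : ℝ) : ℂ) * c ξ := by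
    rw [Real.fourierInv_eq', ← integral_const_mul]
    refine integral_congr_ae ?_
    filter_upwards [hne 0] with ξ hξ
    simp only [hcdef, hkF]
    rw [Real.mul_rpow (by positivity) (norm_nonneg ξ), ← hrpow ξ hξ, real_inner_comm, smul_eq_mul]
    have hΓ : (Real.Gamma (1 - α / 2) : ℂ) ≠ 0 := by exact_mod_cast hΓ₁.ne'
    have hπ : (Real.pi : ℂ) ≠ 0 := by exact_mod_cast Real.pi_ne_zero
    push_cast
    rw [show 2 * (Real.pi : ℂ) * ((inner ℝ x ξ : ℝ) : ℂ) * Complex.I =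
      2 * Real.pi * Complex.I * ((inner ℝ x ξ : ℝ) : ℂ) by ring]
    generalize (Real.Gamma (1 - α / 2) : ℂ) = g at hΓ
    field_simp
  rw [fracLap, h5, ← h3]
  have h6 : ∫ y, ((Real.pi * (Real.pi ^ 2) ^ (-(α / 2)) * Real.Gamma (α / 2) *
      pker (α / 2) (y - x) 0 : ℝ) : ℂ) * k y =
      ((Real.pi * (Real.pi ^ 2) ^ (-(α / 2)) * Real.Gamma (α / 2) *
        ∫ y, pker (α / 2) (y - x) 0 * lap h y : ℝ) : ℂ) := by
    rw [← integral_const_mul, ← integral_complex_ofReal]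
    refine integral_congr_ae (Eventually.of_forall fun y => ?_)
    simp only [hk]
    push_cast
    ring
  rw [h6, ← Complex.ofReal_mul, Complex.ofReal_re, wconst]
  -- All fractional powers of `π` cancel. The factor `2^α` that remains is twice the factor
  -- `2^(α-1)` in the weight, so the normalization of `w` is exact.
  have h7 : (Real.pi ^ 2) ^ (-(α / 2)) * (2 * Real.pi) ^ α = 2 ^ α := by
    rw [Real.mul_rpow (by norm_num) Real.pi_pos.le, ← Real.rpow_natCast Real.pi 2,
      ← Real.rpow_mul Real.pi_pos.le, mul_left_comm, ← Real.rpow_add Real.pi_pos]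
    rw [show ((2 : ℕ) : ℝ) * -(α / 2) + α = 0 by push_cast; ring, Real.rpow_zero, mul_one]
  have h8 : (2 : ℝ) ^ α = 2 * 2 ^ (α - 1) := by
    rw [Real.rpow_sub_one (by norm_num)]; ring
  have hπ := Real.pi_pos
  rw [h8] at h7
  generalize Real.Gamma (1 - α / 2) = g at hΓ₁
  generalize (∫ y, pker (α / 2) (y - x) 0 * lap h y) = I
  field_simp
  linear_combination (-2 * I) * h7

lemma pker_le_pker_zero {a : ℝ} (ha₀ : 0 < a) {v : Plane} (hv : v ≠ 0) (z : ℝ) :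
    pker a v z ≤ pker a v 0 := by
  have h0 : 0 < ‖v‖ := norm_pos_iff.2 hv
  unfold pker
  refine Real.rpow_le_rpow_of_nonpos (by positivity) ?_ (by linarith)
  nlinarith [sq_nonneg z]

lemma ae_ne_plane (v : Plane) : ∀ᵐ y : Plane, y ≠ v := by simp [ae_iff]

lemma pker_measurable (a z : ℝ) : Measurable fun v : Plane => pker a v z := by
  unfold pker
  fun_prop

/-- The potential kernel decreases in `z`, so its value at `z = 0` dominates every height. -/
lemma vflux_bounded {α : ℝ} (hα₀ : 0 < α) (hα₂ : α < 2) {h : Plane → ℝ}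
    (hh : ContDiff ℝ ∞ h) (hc : HasCompactSupport h) :
    ∃ C, ∀ x z, 0 < z → |vflux α h x z| ≤ C := by
  have hw := wconst_pos hα₀ hα₂
  obtain ⟨C, hC⟩ := pker_zero_mul_bound (a := α / 2) (by linarith) (by linarith)
    (lap_continuous hh) (lap_hasCompactSupport hc)
  refine ⟨wconst α / (2 * Real.pi) * C, fun x z hz => ?_⟩
  rw [vflux_eq_potential hα₀ hh hc x hz, abs_mul,
    abs_of_pos (div_pos hw (by positivity))]
  gcongr
  rw [← Real.norm_eq_abs]
  refine (norm_integral_le_of_norm_le (hC x).1 ?_).trans (hC x).2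
  filter_upwards [ae_ne_plane x] with y hy
  rw [norm_mul, Real.norm_of_nonneg (pker_nonneg _ _ _), Real.norm_eq_abs]
  gcongr
  exact pker_le_pker_zero (by linarith) (sub_ne_zero.2 hy) z

/-- Dominated convergence in the potential, with the kernel at height zero as majorant. The limit is
a Riesz potential of the Laplacian, and `fracLap_eq_potential` identifies it. -/
lemma vflux_tendsto {α : ℝ} (hα₀ : 0 < α) (hα₂ : α < 2) {h : Plane → ℝ}
    (hh : ContDiff ℝ ∞ h) (hc : HasCompactSupport h) (x : Plane) :
    Tendsto (fun z => vflux α h x z) (𝓝[>] 0) (𝓝 (-fracLap α h x)) := by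
  obtain ⟨C, hC⟩ := pker_zero_mul_bound (a := α / 2) (by linarith) (by linarith)
    (lap_continuous hh) (lap_hasCompactSupport hc)
  have h1 : Tendsto (fun z => ∫ y, pker (α / 2) (y - x) z * lap h y) (𝓝[>] 0)
      (𝓝 (∫ y, pker (α / 2) (y - x) 0 * lap h y)) := by
    refine tendsto_integral_filter_of_dominated_convergence
      (fun y => pker (α / 2) (y - x) 0 * |lap h y|) ?_ ?_ (hC x).1 ?_
    · exact Eventually.of_forall fun z => (((pker_measurable (α / 2) z).comp
        (measurable_id.sub_const x)).mul (lap_continuous hh).measurable).aestronglyMeasurable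
    · refine Eventually.of_forall fun z => ?_
      filter_upwards [ae_ne_plane x] with y hy
      rw [norm_mul, Real.norm_of_nonneg (pker_nonneg _ _ _), Real.norm_eq_abs]
      gcongr
      exact pker_le_pker_zero (by linarith) (sub_ne_zero.2 hy) z
    · filter_upwards [ae_ne_plane x] with y hy
      have h0 : 0 < ‖y - x‖ := norm_pos_iff.2 (sub_ne_zero.2 hy)
      refine Tendsto.mul_const _ (tendsto_nhdsWithin_of_tendsto_nhds ?_)
      have : ContinuousAt (fun z : ℝ => (‖y - x‖ ^ 2 + z ^ 2) ^ (-(α / 2))) 0 :=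
        ContinuousAt.rpow_const (by fun_prop) (Or.inl (by positivity))
      exact this.tendsto
  have h2 := h1.const_mul (wconst α / (2 * Real.pi))
  rw [fracLap_eq_potential hα₀ hα₂ hh hc x, ← neg_mul, neg_neg]
  refine h2.congr' ?_
  filter_upwards [self_mem_nhdsWithin] with z hz
  rw [vflux_eq_potential hα₀ hh hc x hz]

/-! ### The Poisson kernel -/

lemma hasDerivAt_sq_add_one_rpow (p : ℝ) (y : ℝ) :
    HasDerivAt (fun y : ℝ => (y ^ 2 + 1) ^ p) (2 * y * p * (y ^ 2 + 1) ^ (p - 1)) y := by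
  have h1 : HasDerivAt (fun y : ℝ => y ^ 2 + 1) (2 * y) y := by
    simpa using (hasDerivAt_pow 2 y).add_const 1
  exact h1.rpow_const (Or.inl (by positivity))

/-- An explicit primitive is `-(1/α)(y² + 1)^(-α/2)`. It vanishes at infinity and equals `-1/α` at
zero. -/
lemma radial_integral {α : ℝ} (hα₀ : 0 < α) :
    IntegrableOn (fun y : ℝ => y * (y ^ 2 + 1) ^ (-(1 + α / 2))) (Ioi 0) ∧
      ∫ y in Ioi (0 : ℝ), y * (y ^ 2 + 1) ^ (-(1 + α / 2)) = 1 / α := by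
  have hd : ∀ y ∈ Ici (0 : ℝ), HasDerivAt (fun y : ℝ => -(1 / α) * (y ^ 2 + 1) ^ (-(α / 2)))
      (y * (y ^ 2 + 1) ^ (-(1 + α / 2))) y := fun y _ => by
    refine ((hasDerivAt_sq_add_one_rpow (-(α / 2)) y).const_mul (-(1 / α))).congr_deriv ?_
    rw [show -(α / 2) - 1 = -(1 + α / 2) by ring]
    field_simp
  have hp : ∀ y ∈ Ioi (0 : ℝ), 0 ≤ y * (y ^ 2 + 1) ^ (-(1 + α / 2)) := fun y hy => by
    have : 0 < y := hy
    positivity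
  have ht : Tendsto (fun y : ℝ => -(1 / α) * (y ^ 2 + 1) ^ (-(α / 2))) atTop (𝓝 0) := by
    have h1 : Tendsto (fun y : ℝ => y ^ 2 + 1) atTop atTop :=
      tendsto_atTop_add_const_right _ _ (tendsto_pow_atTop two_ne_zero)
    have h2 := (tendsto_rpow_neg_atTop (show 0 < α / 2 by linarith)).comp h1
    simpa using h2.const_mul (-(1 / α))
  refine ⟨integrableOn_Ioi_deriv_of_nonneg' hd hp ht, ?_⟩
  rw [integral_Ioi_of_hasDerivAt_of_nonneg' hd hp ht]
  simp

/-- The Poisson kernel at unit height is a probability density. -/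
lemma poissonKernel_one {α : ℝ} (hα₀ : 0 < α) :
    Integrable (fun v => poissonKernel α v 1) ∧ ∫ v, poissonKernel α v 1 = 1 := by
  have h1 : (fun v => poissonKernel α v 1) =
      fun v => (fun r : ℝ => α / (2 * Real.pi) * (r ^ 2 + 1) ^ (-(1 + α / 2))) ‖v‖ := by
    funext v
    simp [poissonKernel_eq, pker]
  have h2 : ∀ y : ℝ, y ^ (Module.finrank ℝ Plane - 1) •
      (α / (2 * Real.pi) * (y ^ 2 + 1) ^ (-(1 + α / 2))) =
      α / (2 * Real.pi) * (y * (y ^ 2 + 1) ^ (-(1 + α / 2))) := fun y => by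
    simp; ring
  obtain ⟨hi, hint⟩ := radial_integral hα₀
  rw [h1]
  constructor
  · rw [integrable_fun_norm_addHaar volume
      (f := fun r : ℝ => α / (2 * Real.pi) * (r ^ 2 + 1) ^ (-(1 + α / 2)))]
    simp only [h2]
    exact hi.const_mul _
  · rw [integral_fun_norm_addHaar volume
      (fun r : ℝ => α / (2 * Real.pi) * (r ^ 2 + 1) ^ (-(1 + α / 2)))]
    simp only [h2]
    rw [integral_const_mul, hint, Measure.real, EuclideanSpace.volume_ball_fin_two]
    have hπ : (ENNReal.ofReal Real.pi).toReal = Real.pi :=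
      ENNReal.toReal_ofReal Real.pi_pos.le
    have := Real.pi_pos
    simp [hπ]
    field_simp

lemma poissonKernel_nonneg {α : ℝ} (hα₀ : 0 < α) (v : Plane) {z : ℝ} (hz : 0 ≤ z) :
    0 ≤ poissonKernel α v z := by
  have := Real.pi_pos
  unfold poissonKernel
  positivity

/-- The kernel is homogeneous of degree `-2` in `(x, z)`. Hence its mass is the same at every height
and it is an approximate identity as `z → 0`. -/
lemma poissonKernel_smul {α : ℝ} (v : Plane) {z : ℝ} (hz : 0 < z) :
    poissonKernel α (z • v) z = (z ^ 2)⁻¹ * poissonKernel α v 1 := by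
  rw [poissonKernel_eq, poissonKernel_eq, pker, pker, norm_smul, Real.norm_of_nonneg hz.le,
    show (z * ‖v‖) ^ 2 + z ^ 2 = z ^ 2 * (‖v‖ ^ 2 + 1 ^ 2) by ring,
    Real.mul_rpow (by positivity) (by positivity), Real.one_rpow,
    ← Real.rpow_natCast z 2, ← Real.rpow_mul hz.le, ← Real.rpow_neg hz.le]
  have h : z ^ (-((2 : ℕ) : ℝ)) = z ^ α * z ^ (((2 : ℕ) : ℝ) * -(1 + α / 2)) := by
    rw [← Real.rpow_add hz]; congr 1; push_cast; ring
  rw [h]; ring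

/-- Rescaling of an integral against the Poisson kernel. -/
lemma integral_poissonKernel_mul {α : ℝ} (g : Plane → ℝ) (x : Plane) {z : ℝ} (hz : 0 < z) :
    ∫ y, poissonKernel α (x - y) z * g y = ∫ v, poissonKernel α v 1 * g (x - z • v) := by
  have h1 : ∫ y, poissonKernel α (x - y) z * g y = ∫ v, poissonKernel α v z * g (x - v) := by
    rw [← integral_sub_left_eq_self _ volume x]
    simp
  have h2 := Measure.integral_comp_smul volume (fun v => poissonKernel α v z * g (x - v)) z
  simp only [poissonKernel_smul _ hz] at h2
  have h3 : |(z ^ Module.finrank ℝ Plane)⁻¹| = (z ^ 2)⁻¹ := by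
    simp
  rw [h3, smul_eq_mul] at h2
  have h4 : ∫ v, (z ^ 2)⁻¹ * poissonKernel α v 1 * g (x - z • v) =
      (z ^ 2)⁻¹ * ∫ v, poissonKernel α v 1 * g (x - z • v) := by
    rw [← integral_const_mul]; simp only [mul_assoc]
  rw [h4] at h2
  rw [h1]
  exact (mul_left_cancel₀ (by positivity) h2).symm

lemma integral_poissonKernel {α : ℝ} (hα₀ : 0 < α) (x : Plane) {z : ℝ} (hz : 0 < z) :
    ∫ y, poissonKernel α (x - y) z = 1 := by
  have := integral_poissonKernel_mul (α := α) (fun _ => 1) x hz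
  simpa [(poissonKernel_one hα₀).2] using this

lemma poissonKernel_sub_continuous {α : ℝ} (x : Plane) {z : ℝ} (hz : 0 < z) :
    Continuous fun y : Plane => poissonKernel α (x - y) z := by
  simp only [poissonKernel_eq, pker_sub_comm _ x]
  exact continuous_const.mul (pker_sub_continuous _ x hz)

lemma poissonKernel_continuous {α : ℝ} {z : ℝ} (hz : 0 < z) :
    Continuous fun v : Plane => poissonKernel α v z := by
  simpa [Function.comp_def] using (poissonKernel_sub_continuous (α := α) 0 hz).comp continuous_neg

lemma poissonKernel_integrable {α : ℝ} (hα₀ : 0 < α) (x : Plane) {z : ℝ} (hz : 0 < z) :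
    Integrable fun y => poissonKernel α (x - y) z :=
  -- The integral of a non-integrable function has the default value `0`, so the value `1` forces
  -- integrability.
  Integrable.of_integral_ne_zero (by rw [integral_poissonKernel hα₀ x hz]; exact one_ne_zero)

lemma poissonKernel_le {α : ℝ} (hα₀ : 0 < α) {z : ℝ} (hz : 0 < z) :
    ∃ C, ∀ v, poissonKernel α v z ≤ C := by
  refine ⟨α / (2 * Real.pi) * z ^ α * (min 1 (z ^ 2)) ^ (-(1 + α / 2)), fun v => ?_⟩
  have := Real.pi_pos
  have hm : 0 < min 1 (z ^ 2) := lt_min one_pos (by positivity)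
  rw [poissonKernel_eq]
  gcongr
  refine (pker_le_decay (by linarith) hz v le_rfl).trans
    (mul_le_of_le_one_right (by positivity) ?_)
  exact inv_le_one_of_one_le₀ (by nlinarith [sq_nonneg ‖v‖])

/-- Averaging against a probability density does not increase the supremum. -/
lemma ext_test_bound {α : ℝ} (hα₀ : 0 < α) {h : Plane → ℝ} {M : ℝ} (hM : ∀ x, |h x| ≤ M)
    (x : Plane) {z : ℝ} (hz : 0 < z) : |ext α h x z| ≤ M := by
  rw [ext, if_neg hz.ne', ← Real.norm_eq_abs]
  refine (norm_integral_le_of_norm_le ((poissonKernel_integrable hα₀ x hz).mul_const M)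
    (Eventually.of_forall fun y => ?_)).trans ?_
  · rw [norm_mul, Real.norm_of_nonneg (poissonKernel_nonneg hα₀ _ hz.le)]
    exact mul_le_mul_of_nonneg_left (hM y) (poissonKernel_nonneg hα₀ _ hz.le)
  · rw [integral_mul_const, integral_poissonKernel hα₀ x hz, one_mul]

/-- After rescaling to unit height the kernel no longer depends on `z`, so dominated convergence
applies to `h (x - z • v)`. -/
lemma ext_test_tendsto {α : ℝ} (hα₀ : 0 < α) {h : Plane → ℝ} (hc : Continuous h) {M : ℝ}
    (hM : ∀ x, |h x| ≤ M) (x : Plane) :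
    Tendsto (fun z => ext α h x z) (𝓝[>] 0) (𝓝 (h x)) := by
  obtain ⟨hi, hint⟩ := poissonKernel_one hα₀
  have h1 : Tendsto (fun z : ℝ => ∫ v, poissonKernel α v 1 * h (x - z • v)) (𝓝[>] 0)
      (𝓝 (∫ v, poissonKernel α v 1 * h x)) := by
    refine tendsto_integral_filter_of_dominated_convergence
      (fun v => poissonKernel α v 1 * M) ?_ ?_ (hi.mul_const M) ?_
    · refine Eventually.of_forall fun z => Continuous.aestronglyMeasurable ?_
      exact (poissonKernel_continuous one_pos).mul (hc.comp (by fun_prop))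
    · refine Eventually.of_forall fun z => Eventually.of_forall fun v => ?_
      have h0 := poissonKernel_nonneg hα₀ v zero_le_one
      rw [norm_mul, Real.norm_of_nonneg h0]
      exact mul_le_mul_of_nonneg_left (hM _) h0
    · refine Eventually.of_forall fun v => Tendsto.const_mul _ ?_
      refine tendsto_nhdsWithin_of_tendsto_nhds ?_
      have : Continuous fun z : ℝ => h (x - z • v) := hc.comp (by fun_prop)
      simpa using this.tendsto 0
  rw [integral_mul_const, hint, one_mul] at h1
  refine h1.congr' ?_
  filter_upwards [self_mem_nhdsWithin] with z hz
  rw [ext, if_neg (ne_of_gt hz), integral_poissonKernel_mul h x hz]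

/-- Contractivity of the extension in `L²`. -/
lemma ext_sq_integral_le {α : ℝ} (hα₀ : 0 < α) {f : Plane → ℝ} (hf : MemLp f 2 volume)
    {z : ℝ} (hz : 0 < z) :
    Integrable (fun x => ext α f x z ^ 2) ∧ ∫ x, ext α f x z ^ 2 ≤ ∫ x, f x ^ 2 := by
  have hf2 : Integrable fun x => f x ^ 2 := hf.integrable_sq
  have hP : Integrable fun v => poissonKernel α v z := by
    have := (poissonKernel_integrable hα₀ 0 hz).comp_neg
    simpa using this
  have hP1 : ∫ v, poissonKernel α v z = 1 := by
    have h := integral_poissonKernel hα₀ 0 hz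
    rw [← integral_neg_eq_self] at h
    simpa using h
  set F : Plane → ℝ := fun x => ∫ y, poissonKernel α (x - y) z * f y ^ 2 with hF
  have hconv : F = MeasureTheory.convolution (fun y => f y ^ 2) (fun v => poissonKernel α v z)
      (ContinuousLinearMap.mul ℝ ℝ) volume := by
    funext x
    rw [hF, convolution_def]
    refine integral_congr_ae (Eventually.of_forall fun y => ?_)
    simp [mul_comm]
  have hFi : Integrable F := by
    rw [hconv]; exact Integrable.integrable_convolution _ hf2 hP
  have hFint : ∫ x, F x = ∫ x, f x ^ 2 := by
    rw [hconv, integral_convolution _ hf2 hP, hP1]; simp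
  obtain ⟨C, hC⟩ := poissonKernel_le hα₀ hz
  -- Jensen's inequality, obtained by expanding the nonnegative variance of `f` about its mean under
  -- the Poisson kernel. Integrating in `x` then uses that the convolution with a density preserves
  -- the integral.
  have hle : ∀ x, ext α f x z ^ 2 ≤ F x := by
    intro x
    have hcont := poissonKernel_sub_continuous (α := α) x hz
    have hi1 : Integrable fun y => poissonKernel α (x - y) z * f y ^ 2 := by
      refine hf2.bdd_mul hcont.aestronglyMeasurable (c := C) (Eventually.of_forall fun y => ?_)
      rw [Real.norm_of_nonneg (poissonKernel_nonneg hα₀ _ hz.le)]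
      exact hC _
    have hi2 : Integrable fun y => poissonKernel α (x - y) z * f y := by
      have h := ((isDecaying_pker (s := 1 + α / 2) (by linarith)).integrable hf x hz).const_mul
        (α / (2 * Real.pi) * z ^ α)
      refine h.congr (Eventually.of_forall fun y => ?_)
      simp only [poissonKernel_eq, mul_assoc]
    have hi3 := poissonKernel_integrable hα₀ x hz
    have hext : ext α f x z = ∫ y, poissonKernel α (x - y) z * f y := by
      rw [ext, if_neg hz.ne']
    have h0 : 0 ≤ ∫ y, poissonKernel α (x - y) z * (f y - ext α f x z) ^ 2 :=
      integral_nonneg fun y => mul_nonneg (poissonKernel_nonneg hα₀ _ hz.le) (sq_nonneg _)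
    have h1 : ∫ y, poissonKernel α (x - y) z * (f y - ext α f x z) ^ 2 =
        F x - 2 * ext α f x z * ext α f x z + ext α f x z ^ 2 * 1 := by
      conv_rhs => rw [← integral_poissonKernel hα₀ x hz]
      nth_rw 3 [hext]
      rw [hF, ← integral_const_mul, ← integral_const_mul,
        ← integral_sub hi1 (hi2.const_mul _), ← integral_add
          (f := fun y => poissonKernel α (x - y) z * f y ^ 2 -
            2 * ext α f x z * (poissonKernel α (x - y) z * f y))
          (hi1.sub (hi2.const_mul _)) (hi3.const_mul _)]
      refine integral_congr_ae (Eventually.of_forall fun y => ?_)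
      ring
    rw [h1] at h0
    linarith
  have hi : Integrable fun x => ext α f x z ^ 2 := by
    refine hFi.mono' ((continuous_slice (ext_continuousOn hα₀ hf) hz).pow
      2).aestronglyMeasurable (Eventually.of_forall fun x => ?_)
    rw [Real.norm_of_nonneg (sq_nonneg _)]
    exact hle x
  exact ⟨hi, (integral_mono hi hFi hle).trans hFint.le⟩

/-! ### The vertical flux as a kernel operator -/

/-- The kernel of the vertical flux. -/
def vker (α : ℝ) (v : Plane) (z : ℝ) : ℝ :=
  wconst α * (α / (2 * Real.pi)) * (α * pker (1 + α / 2) v z -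
    (2 + α) * (z ^ 2 * pker (1 + α / 2 + 1) v z))

lemma vker_sub_comm (α : ℝ) (x y : Plane) (z : ℝ) : vker α (x - y) z = vker α (y - x) z := by
  simp only [vker, pker_sub_comm _ x y]

lemma vflux_eq_hconv {α : ℝ} (hα₀ : 0 < α) {f : Plane → ℝ} (hf : MemLp f 2 volume) (x : Plane)
    {z : ℝ} (hz : 0 < z) : vflux α f x z = hconv (vker α) f x z := by
  have h1 := (isDecaying_pker (s := 1 + α / 2) (by linarith)).integrable hf x hz
  have h2 := (isDecaying_pker (s := 1 + α / 2 + 1) (by linarith)).integrable hf x hz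
  rw [vflux, hconv, hconv, hconv, ← integral_const_mul, ← integral_const_mul,
    ← integral_const_mul, ← integral_sub (h1.const_mul _) ((h2.const_mul _).const_mul _),
    ← integral_const_mul]
  refine integral_congr_ae (Eventually.of_forall fun y => ?_)
  simp only [vker]
  ring

/-- The second term is controlled by the first, since `z²` times the kernel with raised exponent is
at most the original kernel. -/
lemma abs_vker_le {α : ℝ} (hα₀ : 0 < α) (hα₂ : α < 2) :
    ∃ C, 0 ≤ C ∧ ∀ v z, 0 < z → |vker α v z| ≤ C * pker (1 + α / 2) v z := by
  have hw := wconst_pos hα₀ hα₂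
  have hπ := Real.pi_pos
  refine ⟨wconst α * (α / (2 * Real.pi)) * (2 + 2 * α), by positivity, fun v z hz => ?_⟩
  have h1 := height_sq_mul_pker_le (1 + α / 2) v hz
  have h2 := pker_pos (1 + α / 2) v hz
  have h3 : 0 ≤ z ^ 2 * pker (1 + α / 2 + 1) v z :=
    mul_nonneg (sq_nonneg z) (pker_nonneg _ _ _)
  rw [vker, abs_mul, abs_of_pos (by positivity), mul_assoc _ (2 + 2 * α)]
  refine mul_le_mul_of_nonneg_left ?_ (by positivity)
  rw [abs_le]
  constructor
  · nlinarith
  · nlinarith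

lemma isDecaying_vker {α : ℝ} (hα₀ : 0 < α) (hα₂ : α < 2) : IsDecaying (vker α) := by
  obtain ⟨C, hC0, hC⟩ := abs_vker_le hα₀ hα₂
  refine isDecaying_of_le_pker (s := 1 + α / 2) (by linarith) ?_ hC0 hC
  unfold vker
  exact continuousOn_const.mul ((continuousOn_const.mul (pker_continuousOn _)).sub
    (continuousOn_const.mul ((continuousOn_snd.pow 2).mul (pker_continuousOn _))))

/-- Away from the origin the kernel is dominated uniformly in the height. -/
lemma pker_le_far {s r : ℝ} (hs : 1 ≤ s) (hr : 0 < r) {v : Plane} (hv : r ≤ ‖v‖) (z : ℝ) :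
    pker s v z ≤ (r ^ 2 / (1 + r ^ 2)) ^ (-s) * decay v := by
  have h1 : r ^ 2 / (1 + r ^ 2) * (1 + ‖v‖ ^ 2) ≤ ‖v‖ ^ 2 + z ^ 2 := by
    rw [div_mul_eq_mul_div, div_le_iff₀ (by positivity)]
    nlinarith [sq_nonneg z, mul_nonneg (sq_nonneg z) (sq_nonneg r), mul_le_mul hv hv hr.le
      (norm_nonneg v)]
  unfold pker decay
  calc (‖v‖ ^ 2 + z ^ 2) ^ (-s) ≤ (r ^ 2 / (1 + r ^ 2) * (1 + ‖v‖ ^ 2)) ^ (-s) :=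
        Real.rpow_le_rpow_of_nonpos (by positivity) h1 (by linarith)
    _ = (r ^ 2 / (1 + r ^ 2)) ^ (-s) * (1 + ‖v‖ ^ 2) ^ (-s) :=
        Real.mul_rpow (by positivity) (by positivity)
    _ ≤ _ := by
        gcongr
        rw [← Real.rpow_neg_one]
        exact Real.rpow_le_rpow_of_exponent_le (by nlinarith [sq_nonneg ‖v‖]) (by linarith)

/-- If `g` vanishes within distance `r` of `x`, the singularity of the kernel is never met and
`pker_le_far` gives a majorant independent of `z`. This bound survives the limit `z → 0`. -/
lemma hconv_far {k : Plane → ℝ → ℝ} {s C r ρ : ℝ} (hs : 1 ≤ s) (hr : 0 < r) (hC0 : 0 ≤ C)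
    (hC : ∀ v z, 0 < z → |k v z| ≤ C * pker s v z) {g : Plane → ℝ} (hg : MemLp g 2 volume) :
    ∃ B, ∀ x, ‖x‖ ≤ ρ → (∀ y, ‖x - y‖ < r → g y = 0) → ∀ z, 0 < z → |hconv k g x z| ≤ B := by
  set D := C * (r ^ 2 / (1 + r ^ 2)) ^ (-s) * (2 * (1 + ρ ^ 2))
  refine ⟨∫ y, D * decay y * |g y|, fun x hx hxg z hz => ?_⟩
  rw [← Real.norm_eq_abs]
  refine norm_integral_le_of_norm_le (integrable_decay_mul hg D)
    (Eventually.of_forall fun y => ?_)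
  rw [norm_mul, Real.norm_eq_abs, Real.norm_eq_abs]
  by_cases h : ‖x - y‖ < r
  · simp [hxg y h]
  · refine mul_le_mul_of_nonneg_right ?_ (abs_nonneg _)
    have h1 := decay_sub_le_of_norm_le hx y
    calc |k (x - y) z| ≤ C * pker s (x - y) z := hC _ z hz
      _ ≤ C * ((r ^ 2 / (1 + r ^ 2)) ^ (-s) * decay (x - y)) := by
          gcongr; exact pker_le_far hs hr (not_lt.1 h) z
      _ ≤ C * ((r ^ 2 / (1 + r ^ 2)) ^ (-s) * (2 * (1 + ρ ^ 2) * decay y)) := by gcongr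
      _ = _ := by ring

/-- The vertical flux of a test function is square integrable, uniformly in the height. -/
lemma vflux_test_le_decay {α : ℝ} (hα₀ : 0 < α) (hα₂ : α < 2) {h : Plane → ℝ}
    (hh : ContDiff ℝ ∞ h) (hc : HasCompactSupport h) :
    ∃ C, ∀ x z, 0 < z → |vflux α h x z| ≤ C * decay x := by
  obtain ⟨B, hB⟩ := vflux_bounded hα₀ hα₂ hh hc
  obtain ⟨C, hC0, hC⟩ := abs_vker_le hα₀ hα₂
  obtain ⟨ρ, hρ⟩ := hc.isBounded.subset_closedBall (0 : Plane)
  have hB0 : 0 ≤ B := (abs_nonneg _).trans (hB 0 1 one_pos)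
  set D := C * (1 / 2 : ℝ) ^ (-(1 + α / 2))
  have hi : Integrable fun y => D * (2 * (1 + ‖y‖ ^ 2)) * |h y| :=
    Continuous.integrable_of_hasCompactSupport
      ((by fun_prop : Continuous fun y : Plane => D * (2 * (1 + ‖y‖ ^ 2))).mul hh.continuous.abs)
      (hc.norm.mul_left)
  have hD0 : 0 ≤ D := by positivity
  set I := ∫ y, D * (2 * (1 + ‖y‖ ^ 2)) * |h y|
  have hI0 : 0 ≤ I := integral_nonneg fun y => by positivity
  refine ⟨B * (1 + (|ρ| + 1) ^ 2) + I, fun x z hz => ?_⟩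
  have hd := decay_pos x
  -- Near the support the uniform bound suffices. Farther away, `x` is at distance at least `1` from
  -- the support and the kernel itself decays. The absolute value guards against a negative `ρ`.
  rcases le_total ‖x‖ (|ρ| + 1) with hx | hx
  · have h1 : 1 ≤ (1 + (|ρ| + 1) ^ 2) * decay x := by
      rw [decay, ← div_eq_mul_inv, one_le_div (by positivity)]
      gcongr
    calc |vflux α h x z| ≤ B * 1 := by rw [mul_one]; exact hB x z hz
      _ ≤ B * ((1 + (|ρ| + 1) ^ 2) * decay x) := by gcongr
      _ ≤ _ := by nlinarith
  · have h1 : |vflux α h x z| ≤ I * decay x := by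
      rw [vflux_eq_hconv hα₀ (memLp_of_contDiff hh hc) x hz, hconv, ← Real.norm_eq_abs,
        ← integral_mul_const]
      refine norm_integral_le_of_norm_le (hi.mul_const _) (Eventually.of_forall fun y => ?_)
      rw [norm_mul, Real.norm_eq_abs, Real.norm_eq_abs, mul_right_comm]
      by_cases hy : y ∈ tsupport h
      · refine mul_le_mul_of_nonneg_right ?_ (abs_nonneg _)
        have h2 : ‖y‖ ≤ |ρ| := by
          have := hρ hy
          rw [mem_closedBall_zero_iff] at this
          exact this.trans (le_abs_self ρ)
        have h3 : 1 ≤ ‖x - y‖ := by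
          have := norm_sub_norm_le x y
          linarith
        have h4 := pker_le_far (s := 1 + α / 2) (by linarith) one_pos h3 z
        rw [show ((1 : ℝ) ^ 2 / (1 + 1 ^ 2)) = 1 / 2 by norm_num] at h4
        have h5 := decay_sub_le y x
        have h6 : decay (x - y) = decay (y - x) := by simp [decay, norm_sub_rev]
        calc |vker α (x - y) z| ≤ C * pker (1 + α / 2) (x - y) z := hC _ z hz
          _ ≤ C * ((1 / 2) ^ (-(1 + α / 2)) * (2 * (1 + ‖y‖ ^ 2) * decay x)) := by
              gcongr; exact h4.trans (by rw [h6]; gcongr)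
          _ = _ := by ring
      · simp [image_eq_zero_of_notMem_tsupport hy]
    refine h1.trans ?_
    gcongr
    nlinarith [sq_nonneg (|ρ| + 1)]

/-- The vertical flux is symmetric. -/
lemma integral_vflux_mul_comm {α : ℝ} (hα₀ : 0 < α) (hα₂ : α < 2) {f h : Plane → ℝ}
    (hf : MemLp f 2 volume) (hh : ContDiff ℝ ∞ h) (hc : HasCompactSupport h) {z : ℝ}
    (hz : 0 < z) : ∫ x, vflux α f x z * h x = ∫ x, f x * vflux α h x z := by
  have hk := isDecaying_vker hα₀ hα₂
  have hkabs : IsDecaying fun v z => |vker α v z| :=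
    ⟨hk.cont.abs, fun a ha => by simpa using hk.bound a ha⟩
  have hh2 := memLp_of_contDiff hh hc
  have hint : Integrable (Function.uncurry fun x y => vker α (x - y) z * f y * h x)
      ((volume : Measure Plane).prod volume) := by
    have hm : AEStronglyMeasurable (Function.uncurry fun x y => vker α (x - y) z * f y * h x)
        ((volume : Measure Plane).prod volume) := by
      refine AEStronglyMeasurable.mul (AEStronglyMeasurable.mul ?_ ?_) ?_
      · exact ((hk.continuous_left hz).comp
          (continuous_fst.sub continuous_snd)).aestronglyMeasurable
      · exact hf.aestronglyMeasurable.comp_quasiMeasurePreserving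
          Measure.quasiMeasurePreserving_snd
      · exact (hh.continuous.comp continuous_fst).aestronglyMeasurable
    rw [integrable_prod_iff hm]
    refine ⟨Eventually.of_forall fun x => (hk.integrable hf x hz).mul_const (h x), ?_⟩
    have h1 : Integrable fun x => hconv (fun v z => |vker α v z|) (fun y => |f y|) x z * |h x| :=
      ((continuous_slice (hconv_continuousOn hkabs hf.abs) hz).mul
        hh.continuous.abs).integrable_of_hasCompactSupport hc.norm.mul_left
    refine h1.congr (Eventually.of_forall fun x => ?_)
    simp only [hconv, Function.uncurry_apply_pair, norm_mul, Real.norm_eq_abs]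
    rw [integral_mul_const]
  calc ∫ x, vflux α f x z * h x = ∫ x, ∫ y, vker α (x - y) z * f y * h x := by
        refine integral_congr_ae (Eventually.of_forall fun x => ?_)
        simp only [vflux_eq_hconv hα₀ hf x hz, hconv, integral_mul_const]
    _ = ∫ y, ∫ x, vker α (x - y) z * f y * h x := integral_integral_swap hint
    _ = _ := by
        refine integral_congr_ae (Eventually.of_forall fun y => ?_)
        simp only [vflux_eq_hconv hα₀ hh2 y hz, hconv, ← integral_const_mul]
        refine integral_congr_ae (Eventually.of_forall fun x => ?_)
        simp only [vker_sub_comm α x y]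
        ring

/-- The decay bound for the vertical flux is uniform in `z` and passes to the limit. It makes `Λ^α`
of a test function pair absolutely with any function in `L²`. -/
lemma fracLap_le_decay {α : ℝ} (hα₀ : 0 < α) (hα₂ : α < 2) {h : Plane → ℝ}
    (hh : ContDiff ℝ ∞ h) (hc : HasCompactSupport h) :
    ∃ C, ∀ x, |fracLap α h x| ≤ C * decay x := by
  obtain ⟨C, hC⟩ := vflux_test_le_decay hα₀ hα₂ hh hc
  refine ⟨C, fun x => ?_⟩
  have h1 := (vflux_tendsto hα₀ hα₂ hh hc x).abs
  rw [abs_neg] at h1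
  refine le_of_tendsto h1 ?_
  filter_upwards [self_mem_nhdsWithin] with z hz using hC x z hz

/-- The vertical flux converges weakly to `-Λ^α` at the boundary. -/
lemma integral_vflux_tendsto {α : ℝ} (hα₀ : 0 < α) (hα₂ : α < 2) {f h : Plane → ℝ}
    (hf : MemLp f 2 volume) (hh : ContDiff ℝ ∞ h) (hc : HasCompactSupport h) :
    Tendsto (fun z => ∫ x, vflux α f x z * h x) (𝓝[>] 0)
      (𝓝 (-∫ x, f x * fracLap α h x)) := by
  obtain ⟨C, hC⟩ := vflux_test_le_decay hα₀ hα₂ hh hc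
  have hh2 := memLp_of_contDiff hh hc
  have h1 : Tendsto (fun z => ∫ x, f x * vflux α h x z) (𝓝[>] 0)
      (𝓝 (∫ x, f x * -fracLap α h x)) := by
    refine tendsto_integral_filter_of_dominated_convergence (fun x => C * decay x * |f x|) ?_ ?_
      (integrable_decay_mul hf C) ?_
    · filter_upwards [self_mem_nhdsWithin] with z hz
      exact hf.aestronglyMeasurable.mul
        (continuous_slice (vflux_continuousOn hα₀ hh2) hz).aestronglyMeasurable
    · filter_upwards [self_mem_nhdsWithin] with z hz
      refine Eventually.of_forall fun x => ?_
      rw [norm_mul, Real.norm_eq_abs, Real.norm_eq_abs, mul_comm]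
      exact mul_le_mul_of_nonneg_right (hC x z hz) (abs_nonneg _)
    · exact Eventually.of_forall fun x => (vflux_tendsto hα₀ hα₂ hh hc x).const_mul _
  simp only [mul_neg, integral_neg] at h1
  refine h1.congr' ?_
  filter_upwards [self_mem_nhdsWithin] with z hz
  exact (integral_vflux_mul_comm hα₀ hα₂ hf hh hc hz).symm

/-! ### Functions that are smooth on a ball -/

/-- At points outside the topological support of `g` the product vanishes in a neighbourhood, so no
regularity of `f` is needed there. In this way `θφ` becomes a global test function. -/
lemma contDiff_mul_of_tsupport_subset {E : Type*} [NormedAddCommGroup E] [NormedSpace ℝ E]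
    {f g : E → ℝ} {U : Set E} (hU : IsOpen U) (hf : ContDiffOn ℝ ∞ f U) (hg : ContDiff ℝ ∞ g)
    (hs : tsupport g ⊆ U) : ContDiff ℝ ∞ fun x => f x * g x := by
  rw [contDiff_iff_contDiffAt]
  intro x
  by_cases hx : x ∈ tsupport g
  · exact (hf.contDiffAt (hU.mem_nhds (hs hx))).mul hg.contDiffAt
  · refine (contDiffAt_const (c := (0 : ℝ))).congr_of_eventuallyEq ?_
    filter_upwards [(isClosed_tsupport g).isOpen_compl.mem_nhds hx] with y hy
    rw [image_eq_zero_of_notMem_tsupport hy, mul_zero]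

/-- Near a compact subset of a ball on which it is smooth, a square integrable function is the sum
of a test function and a square integrable function that vanishes near the compact subset. -/
lemma exists_local_splitting {f : Plane → ℝ} (hf : MemLp f 2 volume) {x₀ : Plane} {ρ : ℝ}
    (hs : ContDiffOn ℝ ∞ f (ball x₀ ρ)) {K : Set Plane} (hK : IsClosed K)
    (hKs : K ⊆ ball x₀ ρ) (hne : 0 < ρ) :
    ∃ f₁ f₂ : Plane → ℝ, ∃ r > 0, ContDiff ℝ ∞ f₁ ∧ HasCompactSupport f₁ ∧ MemLp f₂ 2 volume ∧
      (∀ x, f x = f₁ x + f₂ x) ∧ ∀ x ∈ K, ∀ y, ‖x - y‖ < r → f₂ y = 0 := by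
  obtain ⟨r', hr', hKr⟩ : ∃ r' ∈ Ioo 0 ρ, K ⊆ ball x₀ r' := exists_pos_lt_subset_ball hne hK hKs
  have hlt : r' < ρ := hr'.2
  -- The gap `ρ - r'` is divided in three: `χ` is `1` up to one third past `r'` and vanishes beyond
  -- two thirds. The first third is the distance between `K` and the region where `f₂` can be
  -- nonzero.
  let χ : ContDiffBump x₀ := ⟨r' + (ρ - r') / 3, r' + 2 * (ρ - r') / 3,
    by linarith [hr'.1], by linarith⟩
  have hχs : tsupport χ ⊆ ball x₀ ρ := by
    rw [χ.tsupport_eq]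
    exact closedBall_subset_ball (by change r' + 2 * (ρ - r') / 3 < ρ; linarith)
  have h1 : ContDiff ℝ ∞ fun x => f x * χ x :=
    contDiff_mul_of_tsupport_subset isOpen_ball hs χ.contDiff hχs
  have h1c : HasCompactSupport fun x => f x * χ x := χ.hasCompactSupport.mul_left
  refine ⟨fun x => f x * χ x, fun x => f x - f x * χ x, (ρ - r') / 3, by linarith, h1, h1c,
    hf.sub (memLp_of_contDiff h1 h1c), fun x => by ring, fun x hx y hy => ?_⟩
  have h2 : y ∈ closedBall x₀ (r' + (ρ - r') / 3) := by
    have h3 : dist x x₀ < r' := hKr hx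
    have h4 : dist y x < (ρ - r') / 3 := by rwa [dist_comm, dist_eq_norm]
    rw [mem_closedBall]
    linarith [dist_triangle y x x₀]
  have h3 : χ y = 1 := χ.one_of_mem_closedBall h2
  simp [h3]

lemma hconv_add {k : Plane → ℝ → ℝ} (hk : IsDecaying k) {f f₁ f₂ : Plane → ℝ}
    (h₁ : MemLp f₁ 2 volume) (h₂ : MemLp f₂ 2 volume) (h : ∀ x, f x = f₁ x + f₂ x) (x : Plane)
    {z : ℝ} (hz : 0 < z) : hconv k f x z = hconv k f₁ x z + hconv k f₂ x z := by
  rw [hconv, hconv, hconv, ← integral_add (hk.integrable h₁ x hz) (hk.integrable h₂ x hz)]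
  simp only [h, mul_add]

/-- Local boundedness of the vertical flux and of the extension up to the boundary, where the
function is smooth, and convergence of the extension. -/
lemma local_bounds {α : ℝ} (hα₀ : 0 < α) (hα₂ : α < 2) {f : Plane → ℝ} (hf : MemLp f 2 volume)
    {x₀ : Plane} {ρ : ℝ} (hs : ContDiffOn ℝ ∞ f (ball x₀ ρ)) {K : Set Plane} (hK : IsCompact K)
    (hKs : K ⊆ ball x₀ ρ) (hne : 0 < ρ) :
    ∃ C, (∀ x ∈ K, ∀ z ∈ Ioo (0 : ℝ) 1, |vflux α f x z| ≤ C ∧ |ext α f x z| ≤ C ∧ |f x| ≤ C) ∧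
      ∀ x ∈ K, Tendsto (fun z => ext α f x z) (𝓝[>] 0) (𝓝 (f x)) := by
  obtain ⟨f₁, f₂, r, hr, h1, h1c, h2, hsum, hfar⟩ :=
    exists_local_splitting hf hs hK.isClosed hKs hne
  have h1m := memLp_of_contDiff h1 h1c
  obtain ⟨A, hA⟩ := vflux_bounded hα₀ hα₂ h1 h1c
  obtain ⟨M, hM⟩ := h1.continuous.bounded_above_of_compact_support h1c
  obtain ⟨R, hR⟩ := hK.isBounded.subset_closedBall (0 : Plane)
  obtain ⟨C, hC0, hC⟩ := abs_vker_le hα₀ hα₂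
  obtain ⟨B, hB⟩ := hconv_far (ρ := R) (by linarith : 1 ≤ 1 + α / 2) hr hC0 hC h2
  obtain ⟨B', hB'⟩ := hconv_far (k := pker (1 + α / 2)) (ρ := R) (by linarith : 1 ≤ 1 + α / 2) hr
    zero_le_one (fun v z hz => by rw [one_mul, abs_of_pos (pker_pos _ v hz)]) h2
  have hπ := Real.pi_pos
  have hRK : ∀ x ∈ K, ‖x‖ ≤ R := fun x hx => by simpa using hR hx
  have hext : ∀ x, ∀ z, 0 < z → ext α f x z = ext α f₁ x z + ext α f₂ x z := by
    intro x z hz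
    rw [ext_eq _ _ _ hz, ext_eq _ _ _ hz, ext_eq _ _ _ hz,
      hconv_add (isDecaying_pker (by linarith)) h1m h2 hsum x hz, mul_add]
  -- For the far part the convolution is bounded up to the boundary, and the prefactor `z^α` then
  -- forces its extension to zero.
  have hext2 : ∀ x ∈ K, ∀ z, 0 < z → |ext α f₂ x z| ≤ α / (2 * Real.pi) * z ^ α * B' := by
    intro x hx z hz
    rw [ext_eq _ _ _ hz, abs_mul, abs_of_pos (by positivity)]
    have := hB' x (hRK x hx) (hfar x hx) z hz
    gcongr
  have hf2 : ∀ x ∈ K, f₂ x = 0 := fun x hx => hfar x hx x (by simpa using hr)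
  have hM' : ∀ x, |f₁ x| ≤ M := hM
  refine ⟨max (A + B) (M + α / (2 * Real.pi) * |B'|), fun x hx z hz => ⟨?_, ?_, ?_⟩,
    fun x hx => ?_⟩
  · refine le_max_of_le_left ?_
    rw [vflux_eq_hconv hα₀ hf x hz.1, hconv_add (isDecaying_vker hα₀ hα₂) h1m h2 hsum x hz.1,
      ← vflux_eq_hconv hα₀ h1m x hz.1]
    exact (abs_add_le _ _).trans (add_le_add (hA x z hz.1)
      (hB x (hRK x hx) (hfar x hx) z hz.1))
  · refine le_max_of_le_right ?_
    rw [hext x z hz.1]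
    refine (abs_add_le _ _).trans (add_le_add (ext_test_bound hα₀ hM' x hz.1)
      ((hext2 x hx z hz.1).trans ?_))
    have h3 : z ^ α ≤ 1 := Real.rpow_le_one hz.1.le hz.2.le hα₀.le
    have h4 : 0 ≤ z ^ α := Real.rpow_nonneg hz.1.le α
    calc α / (2 * Real.pi) * z ^ α * B' ≤ α / (2 * Real.pi) * z ^ α * |B'| := by
          gcongr; exact le_abs_self B'
      _ ≤ α / (2 * Real.pi) * 1 * |B'| := by gcongr
      _ = _ := by ring
  · refine le_max_of_le_right ?_
    rw [hsum, hf2 x hx, add_zero]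
    have : 0 ≤ α / (2 * Real.pi) * |B'| := by positivity
    linarith [hM' x]
  · have h3 : Tendsto (fun z => ext α f₂ x z) (𝓝[>] 0) (𝓝 0) := by
      have h4 : Tendsto (fun z : ℝ => α / (2 * Real.pi) * z ^ α * B') (𝓝[>] 0) (𝓝 0) := by
        have h5 : Tendsto (fun z : ℝ => z ^ α) (𝓝[>] 0) (𝓝 0) := by
          have := (Real.continuousAt_rpow_const 0 α (Or.inr hα₀.le)).tendsto
          rw [Real.zero_rpow hα₀.ne'] at this
          exact tendsto_nhdsWithin_of_tendsto_nhds this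
        simpa using (h5.const_mul (α / (2 * Real.pi))).mul_const B'
      refine squeeze_zero_norm' ?_ h4
      filter_upwards [self_mem_nhdsWithin] with z hz using hext2 x hx z hz
    have h6 := (ext_test_tendsto hα₀ h1.continuous hM' x).add h3
    rw [hsum, hf2 x hx]
    refine h6.congr' ?_
    filter_upwards [self_mem_nhdsWithin] with z hz using (hext x z hz).symm

/-- The boundary flux of the energy of the extension. -/
lemma boundary_flux_tendsto {α : ℝ} (hα₀ : 0 < α) (hα₂ : α < 2) {f : Plane → ℝ}
    (hf : MemLp f 2 volume) {x₀ : Plane} {ρ : ℝ} (hne : 0 < ρ)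
    (hs : ContDiffOn ℝ ∞ f (ball x₀ ρ)) {ψ : Plane → ℝ} (hψ : ContDiff ℝ ∞ ψ)
    (hψc : HasCompactSupport ψ) (hψs : tsupport ψ ⊆ ball x₀ ρ) :
    Tendsto (fun z => -∫ x, ext α f x z * vflux α f x z * ψ x) (𝓝[>] 0)
      (𝓝 (∫ x, f x * fracLap α (fun y => f y * ψ y) x)) := by
  have hh : ContDiff ℝ ∞ fun y => f y * ψ y :=
    contDiff_mul_of_tsupport_subset isOpen_ball hs hψ hψs
  have hhc : HasCompactSupport fun y => f y * ψ y := hψc.mul_left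
  obtain ⟨C, hC, hlim⟩ := local_bounds hα₀ hα₂ hf hs hψc hψs hne
  have hIoo : ∀ᶠ z : ℝ in 𝓝[>] 0, z ∈ Ioo (0 : ℝ) 1 := Ioo_mem_nhdsGT one_pos
  have hU := ext_continuousOn hα₀ hf
  have hq := vflux_continuousOn hα₀ hf
  have h1 := integral_vflux_tendsto hα₀ hα₂ hf hh hhc
  -- In the flux the extension is written as `f` plus `f* - f`. The first part pairs the vertical
  -- flux with the test function `fψ` and is covered by `h1`. The second tends to zero, since the
  -- flux is bounded on the support of `ψ` and `f* - f` converges to zero boundedly there.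
  have h2 : Tendsto (fun z => ∫ x, vflux α f x z * (ext α f x z - f x) * ψ x) (𝓝[>] 0)
      (𝓝 (∫ _ : Plane, (0 : ℝ))) := by
    refine tendsto_integral_filter_of_dominated_convergence (fun x => C * (C + C) * |ψ x|)
      ?_ ?_ ?_ ?_
    · filter_upwards [hIoo] with z hz
      exact ((continuous_slice hq hz.1).aestronglyMeasurable.mul
        ((continuous_slice hU hz.1).aestronglyMeasurable.sub hf.aestronglyMeasurable)).mul
        hψ.continuous.aestronglyMeasurable
    · filter_upwards [hIoo] with z hz
      refine Eventually.of_forall fun x => ?_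
      by_cases hx : x ∈ tsupport ψ
      · obtain ⟨b1, b2, b3⟩ := hC x hx z hz
        rw [norm_mul, norm_mul, Real.norm_eq_abs, Real.norm_eq_abs, Real.norm_eq_abs]
        gcongr
        · exact (abs_nonneg _).trans b1
        · exact (abs_sub _ _).trans (add_le_add b2 b3)
      · simp [image_eq_zero_of_notMem_tsupport hx]
    · exact (hψ.continuous.integrable_of_hasCompactSupport hψc).abs.const_mul _
    · refine Eventually.of_forall fun x => ?_
      by_cases hx : x ∈ tsupport ψ
      · have h3 : Tendsto (fun z => (ext α f x z - f x) * ψ x) (𝓝[>] 0) (𝓝 0) := by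
          simpa using ((hlim x hx).sub_const (f x)).mul_const (ψ x)
        have h4 := h3.abs.const_mul C
        rw [abs_zero, mul_zero] at h4
        refine squeeze_zero_norm' ?_ h4
        filter_upwards [hIoo] with z hz
        rw [mul_assoc, norm_mul, Real.norm_eq_abs, Real.norm_eq_abs]
        exact mul_le_mul_of_nonneg_right (hC x hx z hz).1 (abs_nonneg _)
      · simp [image_eq_zero_of_notMem_tsupport hx]
  rw [integral_zero] at h2
  have h3 := (h1.add h2).neg
  rw [add_zero, neg_neg] at h3
  refine h3.congr' ?_
  filter_upwards [hIoo] with z hz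
  have hi1 : Integrable fun x => vflux α f x z * (f x * ψ x) :=
    ((continuous_slice hq hz.1).mul hh.continuous).integrable_of_hasCompactSupport hhc.mul_left
  have hi2 : Integrable fun x => ext α f x z * vflux α f x z * ψ x :=
    (((continuous_slice hU hz.1).mul (continuous_slice hq hz.1)).mul
      hψ.continuous).integrable_of_hasCompactSupport hψc.mul_left
  have h4 : ∫ x, vflux α f x z * (ext α f x z - f x) * ψ x =
      (∫ x, ext α f x z * vflux α f x z * ψ x) - ∫ x, vflux α f x z * (f x * ψ x) := by
    rw [← integral_sub hi2 hi1]
    refine integral_congr_ae (Eventually.of_forall fun x => ?_)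
    ring
  rw [h4]; ring

/-! ### The energy balance of the extension -/

/-- Lebesgue measure on the half-space. -/
abbrev halfSpace : Measure (Plane × ℝ) :=
  (volume : Measure Plane).prod (volume.restrict (Ioi (0 : ℝ)))

lemma ae_halfSpace : ∀ᵐ p ∂halfSpace, 0 < p.2 := by
  have h : ∀ᵐ z ∂(volume.restrict (Ioi (0 : ℝ))), z ∈ Ioi (0 : ℝ) :=
    ae_restrict_mem measurableSet_Ioi
  exact Measure.quasiMeasurePreserving_snd.ae h

lemma aestronglyMeasurable_halfSpace {F : Plane × ℝ → ℝ}
    (hF : ContinuousOn F (univ ×ˢ Ioi 0)) : AEStronglyMeasurable F halfSpace := by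
  have h : halfSpace = (volume.prod volume).restrict (univ ×ˢ Ioi 0) := by
    rw [halfSpace, ← Measure.prod_restrict, Measure.restrict_univ]
  rw [h]
  exact hF.aestronglyMeasurable (MeasurableSet.univ.prod measurableSet_Ioi)

/-- The condition `α < 2` is exactly `1 - α > -1`, integrability of the weight at `z = 0`. -/
lemma weight_integrableOn {α : ℝ} (hα₂ : α < 2) (M : ℝ) : IntegrableOn (weight α) (Ioc 0 M) := by
  rcases le_total M 0 with hM | hM
  · simp [Ioc_eq_empty_of_le hM]
  · have h := (intervalIntegral.intervalIntegrable_rpow' (a := 0) (b := M)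
      (r := 1 - α) (by linarith)).const_mul (wconst α)
    rw [intervalIntegrable_iff_integrableOn_Ioc_of_le hM] at h
    exact h

/-- Integrability of weighted squares of the extension over slabs. -/
lemma integrable_weight_ext_sq {α : ℝ} (hα₀ : 0 < α) (hα₂ : α < 2) {f : Plane → ℝ}
    (hf : MemLp f 2 volume) {G : Plane × ℝ → ℝ} (hG : AEStronglyMeasurable G halfSpace) {C M : ℝ}
    (hC : ∀ x z, 0 < z → |G (x, z)| ≤ C) (hM : ∀ x z, M < z → G (x, z) = 0) :
    Integrable (fun p : Plane × ℝ => weight α p.2 * ext α f p.1 p.2 ^ 2 * G p) halfSpace ∧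
      |∫ x, ∫ z in Ioi (0 : ℝ), weight α z * ext α f x z ^ 2 * G (x, z)| ≤
        C * (∫ z in Ioc 0 M, weight α z) * ∫ x, f x ^ 2 := by
  have hU := ext_continuousOn hα₀ hf
  have hC0 : 0 ≤ C := (abs_nonneg _).trans (hC 0 1 one_pos)
  have hm : AEStronglyMeasurable
      (fun p : Plane × ℝ => weight α p.2 * ext α f p.1 p.2 ^ 2 * G p) halfSpace :=
    (aestronglyMeasurable_halfSpace (((weight_continuousOn α).comp continuousOn_snd
      fun p hp => hp.2).mul (hU.pow 2))).mul hG
  -- The majorant in height: on each slice `L²` contractivity replaces the integral of the squared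
  -- extension by that of `f²`, leaving the weight on `(0, M]`.
  set B : ℝ → ℝ := (Ioc (0 : ℝ) M).indicator fun z => C * weight α z * ∫ x, f x ^ 2
  have hBi : Integrable B (volume.restrict (Ioi 0)) :=
    (IntegrableOn.integrable_indicator (μ := volume)
      (((weight_integrableOn hα₂ M).const_mul C).mul_const (∫ x, f x ^ 2))
      measurableSet_Ioc).restrict
  have hBint : ∫ z in Ioi (0 : ℝ), B z = C * (∫ z in Ioc 0 M, weight α z) * ∫ x, f x ^ 2 := by
    rw [setIntegral_indicator measurableSet_Ioc,
      inter_eq_self_of_subset_right Ioc_subset_Ioi_self, integral_mul_const, integral_const_mul]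
  have hpt : ∀ x z, 0 < z → ‖weight α z * ext α f x z ^ 2 * G (x, z)‖ ≤
      (if z ≤ M then C * weight α z else 0) * ext α f x z ^ 2 := by
    intro x z hz
    have hw := weight_pos hα₀ hα₂ hz
    rw [norm_mul, norm_mul, Real.norm_of_nonneg hw.le, Real.norm_of_nonneg (sq_nonneg _),
      Real.norm_eq_abs]
    split_ifs with h
    · have := hC x z hz
      calc weight α z * ext α f x z ^ 2 * |G (x, z)| ≤ weight α z * ext α f x z ^ 2 * C := by
            gcongr
        _ = _ := by ring
    · rw [hM x z (not_le.1 h)]; simp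
  have hslice : ∀ᵐ z ∂(volume.restrict (Ioi (0 : ℝ))),
      Integrable fun x => weight α z * ext α f x z ^ 2 * G (x, z) := by
    have h1 := hm.prodMk_right
    filter_upwards [ae_restrict_mem measurableSet_Ioi, h1] with z hz hmz
    exact ((ext_sq_integral_le hα₀ hf hz).1.const_mul _).mono' hmz
      (Eventually.of_forall fun x => hpt x z hz)
  have hnorm : ∀ z, 0 < z → ∫ x, ‖weight α z * ext α f x z ^ 2 * G (x, z)‖ ≤ B z := by
    intro z hz
    have hw := weight_pos hα₀ hα₂ hz
    obtain ⟨h1, h2⟩ := ext_sq_integral_le hα₀ hf hz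
    have h3 : ∫ x, ‖weight α z * ext α f x z ^ 2 * G (x, z)‖ ≤
        ∫ x, (if z ≤ M then C * weight α z else 0) * ext α f x z ^ 2 :=
      integral_mono_of_nonneg (Eventually.of_forall fun x => norm_nonneg _) (h1.const_mul _)
        (Eventually.of_forall fun x => hpt x z hz)
    refine h3.trans ?_
    rw [integral_const_mul]
    by_cases h : z ≤ M
    · rw [if_pos h]
      simp only [B]
      rw [indicator_of_mem (show z ∈ Ioc 0 M from ⟨hz, h⟩)]
      gcongr
    · rw [if_neg h, zero_mul]
      simp only [B]
      rw [indicator_of_notMem (fun h' => h h'.2)]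
  have hint : Integrable (fun p : Plane × ℝ => weight α p.2 * ext α f p.1 p.2 ^ 2 * G p)
      halfSpace := by
    rw [integrable_prod_iff' hm]
    refine ⟨hslice, hBi.mono' hm.norm.prod_swap.integral_prod_right' ?_⟩
    filter_upwards [ae_restrict_mem measurableSet_Ioi] with z hz
    rw [Real.norm_of_nonneg (integral_nonneg fun x => norm_nonneg _)]
    exact hnorm z hz
  refine ⟨hint, ?_⟩
  rw [integral_integral_swap (f := fun x z => weight α z * ext α f x z ^ 2 * G (x, z)) hint,
    ← hBint, ← Real.norm_eq_abs]
  refine norm_integral_le_of_norm_le hBi ?_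
  filter_upwards [ae_restrict_mem measurableSet_Ioi] with z hz
  exact (norm_integral_le_integral_norm _).trans (hnorm z hz)

lemma gradSq_nonneg (v : Plane → ℝ → ℝ) (x : Plane) (z : ℝ) : 0 ≤ gradSq v x z := by
  unfold gradSq; positivity

section

variable {α Rs R₀ C₀ δ : ℝ} {ψs : ℝ → ℝ}

/-- Below `Rs` the cut-off is constant, so the singular factor `1/z` plays no role. The rest is
continuity on a compact interval and vanishing above. -/
lemma IsVerticalCutoff.vlap_bounded (h : IsVerticalCutoff α Rs R₀ C₀ δ ψs)
    (hRs : 0 < Rs) : ∃ C, 0 ≤ C ∧ ∀ z, 0 < z → |vlap α ψs z| ≤ C := by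
  obtain ⟨C, hC⟩ := isCompact_Icc.exists_bound_of_continuousOn
    (h.vlap_continuousOn.mono (fun z (hz : z ∈ Icc (Rs / 2) (Rs + R₀ + 1)) =>
      (half_pos hRs).trans_le hz.1))
  refine ⟨|C|, abs_nonneg C, fun z hz => ?_⟩
  rcases lt_or_ge z (Rs / 2) with h1 | h1
  · rw [h.vlap_eq_zero_low hz (by linarith), abs_zero]; exact abs_nonneg C
  rcases le_or_gt z (Rs + R₀ + 1) with h2 | h2
  · exact (hC z ⟨h1, h2⟩).trans (le_abs_self C)
  · rw [h.vlap_eq_zero_high (by linarith), abs_zero]; exact abs_nonneg C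

/-- The lower order terms of the energy balance. -/
lemma integrable_lower_order (hα₀ : 0 < α) (hα₂ : α < 2) (hRs : 0 < Rs)
    (h : IsVerticalCutoff α Rs R₀ C₀ δ ψs) {f : Plane → ℝ} (hf : MemLp f 2 volume)
    {ψ : Plane → ℝ} (hψ : ContDiff ℝ ∞ ψ) (hψc : HasCompactSupport ψ) :
    Integrable (fun p : Plane × ℝ => weight α p.2 * ext α f p.1 p.2 ^ 2 *
      (lap ψ p.1 * ψs p.2 + ψ p.1 * vlap α ψs p.2)) halfSpace := by
  obtain ⟨A, hA⟩ := hψ.continuous.bounded_above_of_compact_support hψc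
  obtain ⟨B, hB⟩ := (lap_continuous hψ).bounded_above_of_compact_support
    (lap_hasCompactSupport hψc)
  obtain ⟨V, hV0, hV⟩ := h.vlap_bounded hRs
  have hψsc : ContinuousOn ψs (Ioi 0) := h.smooth.continuousOn.mono Ioi_subset_Ici_self
  have hG : ContinuousOn (fun p : Plane × ℝ => lap ψ p.1 * ψs p.2 + ψ p.1 * vlap α ψs p.2)
      (univ ×ˢ Ioi 0) := by
    have h1 : ContinuousOn (fun p : Plane × ℝ => ψs p.2) (univ ×ˢ Ioi 0) :=
      hψsc.comp continuousOn_snd fun p hp => hp.2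
    have h2 : ContinuousOn (fun p : Plane × ℝ => vlap α ψs p.2) (univ ×ˢ Ioi 0) :=
      h.vlap_continuousOn.comp continuousOn_snd fun p hp => hp.2
    exact (((lap_continuous hψ).comp continuous_fst).continuousOn.mul h1).add
      ((hψ.continuous.comp continuous_fst).continuousOn.mul h2)
  refine (integrable_weight_ext_sq hα₀ hα₂ hf (aestronglyMeasurable_halfSpace hG)
    (C := B * 1 + A * V) (M := Rs + R₀) (fun x z hz => ?_) fun x z hz => ?_).1
  · refine (abs_add_le _ _).trans (add_le_add ?_ ?_)
    · rw [abs_mul]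
      refine mul_le_mul (hB x) ?_ (abs_nonneg _) ((norm_nonneg _).trans (hB x))
      rw [abs_of_nonneg (h.nonneg hz.le)]
      exact h.le_one hRs hz.le
    · rw [abs_mul]
      exact mul_le_mul (hA x) (hV z hz) (abs_nonneg _) ((norm_nonneg _).trans (hA x))
  · simp [h.eq_zero z hz.le, h.vlap_eq_zero_high hz]

/-- The local energy balance of the extension of a function that is smooth near the support of the
cut-off function. -/
lemma energy_balance (hα₀ : 0 < α) (hα₂ : α < 2) (hR₀ : 0 < R₀) (hRs : 0 < Rs)
    (h : IsVerticalCutoff α Rs R₀ C₀ δ ψs) {f : Plane → ℝ} (hf : MemLp f 2 volume)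
    {x₀ : Plane} {ρ : ℝ} (hne : 0 < ρ)
    (hs : ContDiffOn ℝ ∞ f (ball x₀ ρ)) {ψ : Plane → ℝ} (hψ : ContDiff ℝ ∞ ψ)
    (hψc : HasCompactSupport ψ) (hψs : tsupport ψ ⊆ ball x₀ ρ) (hψ0 : ∀ x, 0 ≤ ψ x) :
    Integrable (fun p : Plane × ℝ =>
      weight α p.2 * gradSq (ext α f) p.1 p.2 * (ψ p.1 * ψs p.2)) halfSpace ∧
    ∫ x, f x * fracLap α (fun y => f y * ψ y) x =
      (∫ x, ∫ z in Ioi (0 : ℝ), weight α z * gradSq (ext α f) x z * (ψ x * ψs z)) -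
      1 / 2 * ∫ x, ∫ z in Ioi (0 : ℝ), weight α z * ext α f x z ^ 2 *
        (lap ψ x * ψs z + ψ x * vlap α ψs z) := by
  have hU := ext_continuousOn hα₀ hf
  have hgr := gradSq_ext_continuousOn hα₀ hα₂ hf
  have hψsc : ContinuousOn ψs (Ioi 0) := h.smooth.continuousOn.mono Ioi_subset_Ici_self
  have hLi := integrable_lower_order hα₀ hα₂ hRs h hf hψ hψc
  set I := ∫ x, f x * fracLap α (fun y => f y * ψ y) x
  set M := Rs + R₀ + 1 with hMdef
  have hM0 : 0 < M := by positivity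
  -- the one-dimensional densities
  set Dw : ℝ → ℝ := fun z => weight α z * (∫ x, gradSq (ext α f) x z * ψ x) * ψs z with hDw
  set Hw : ℝ → ℝ := fun z => ∫ x, weight α z * ext α f x z ^ 2 *
        (lap ψ x * ψs z + ψ x * vlap α ψs z) with hHw
  have hHi : Integrable Hw (volume.restrict (Ioi 0)) := hLi.integral_prod_right
  have hHeq : ∀ z, 0 < z → 1 / 2 * weight α z * ((∫ x, ext α f x z ^ 2 * lap ψ x) * ψs z +
            (∫ x, ext α f x z ^ 2 * ψ x) * vlap α ψs z) = 1 / 2 * Hw z := by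
    intro z hz
    have hUz := continuous_slice hU hz
    have hi1 : Integrable fun x => ext α f x z ^ 2 * lap ψ x :=
      ((hUz.pow 2).mul (lap_continuous hψ)).integrable_of_hasCompactSupport
        (lap_hasCompactSupport hψc).mul_left
    have hi2 : Integrable fun x => ext α f x z ^ 2 * ψ x :=
      ((hUz.pow 2).mul hψ.continuous).integrable_of_hasCompactSupport hψc.mul_left
    rw [hHw, mul_assoc, ← integral_mul_const, ← integral_mul_const,
      ← integral_add (hi1.mul_const _) (hi2.mul_const _), ← integral_const_mul]
    congr 1
    refine integral_congr_ae (Eventually.of_forall fun x => ?_)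
    ring
  have hDc : ContinuousOn Dw (Ioi 0) :=
    ((weight_continuousOn α).mul (continuousOn_integral_mul hgr hψ.continuous hψc)).mul hψsc
  have hD0 : ∀ z, 0 < z → 0 ≤ Dw z := fun z hz =>
    mul_nonneg (mul_nonneg (weight_pos hα₀ hα₂ hz).le
      (integral_nonneg fun x => mul_nonneg (gradSq_nonneg _ _ _) (hψ0 x))) (h.nonneg hz.le)
  have hDii : ∀ a, 0 < a → IntervalIntegrable Dw volume a M := fun a ha => by
    rcases le_total a M with haM | haM
    · refine (hDc.mono fun z hz => ?_).intervalIntegrable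
      rw [uIcc_of_le haM] at hz
      exact ha.trans_le hz.1
    · refine (hDc.mono fun z hz => ?_).intervalIntegrable
      rw [uIcc_of_ge haM] at hz
      exact hM0.trans_le hz.1
  have hHii : ∀ a, 0 ≤ a → IntervalIntegrable Hw volume a M := fun a ha => by
    have h1 : IntegrableOn Hw (Ioi 0) := hHi
    rw [intervalIntegrable_iff]
    refine h1.mono_set fun z hz => ?_
    rw [uIoc] at hz
    exact (le_min ha hM0.le).trans_lt hz.1
  have hbal : ∀ a, 0 < a → a < Rs → -(∫ x, ext α f x a * vflux α f x a * ψ x) =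
      (∫ z in a..M, Dw z) - 1 / 2 * ∫ z in a..M, Hw z := by
    intro a ha haR
    rw [energy_balance_above hα₀ hα₂ hR₀ h hf hψ hψc ha haR, ← intervalIntegral.integral_const_mul,
      ← intervalIntegral.integral_sub (hDii a ha) ((hHii a ha.le).const_mul _)]
    refine intervalIntegral.integral_congr fun z hz => ?_
    rw [uIcc_of_le (by linarith)] at hz
    simp only [hHeq z (ha.trans_le hz.1)]
    rfl
  have hlim := boundary_flux_tendsto hα₀ hα₂ hf hne hs hψ hψc hψs
  have hleft : ∀ {g : ℝ → ℝ}, IntervalIntegrable g volume 0 M →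
      Tendsto (fun a => ∫ z in a..M, g z) (𝓝[>] 0) (𝓝 (∫ z in (0 : ℝ)..M, g z)) := by
    intro g hg
    have h1 : ContinuousOn (fun a => ∫ z in a..M, g z) (uIcc 0 M) :=
      intervalIntegral.continuousOn_primitive_interval_left (by
        rw [uIcc_of_le hM0.le, integrableOn_Icc_iff_integrableOn_Ioc]
        exact (intervalIntegrable_iff_integrableOn_Ioc_of_le hM0.le).1 hg)
    have h2 := h1 0 left_mem_uIcc
    refine (h2.mono_left ?_)
    rw [uIcc_of_le hM0.le, nhdsWithin_Icc_eq_nhdsGE hM0]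
    exact nhdsWithin_mono _ Ioi_subset_Ici_self
  -- The balance above height `a` expresses the truncated dissipation through the boundary flux and
  -- the lower order terms, both of which have limits as `a → 0`.
  have hDlim : Tendsto (fun a => ∫ z in a..M, Dw z) (𝓝[>] 0)
      (𝓝 (I + 1 / 2 * ∫ z in (0 : ℝ)..M, Hw z)) := by
    refine (hlim.add ((hleft (hHii 0 le_rfl)).const_mul (1 / 2))).congr' ?_
    filter_upwards [Ioo_mem_nhdsGT hRs] with a ha
    rw [hbal a ha.1 ha.2]; ring
  -- Since `Dw ≥ 0`, bounded truncated integrals give integrability down to `z = 0`. The heights `a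
  -- n` are positive, stay below `M` and tend to zero.
  have hDint : IntervalIntegrable Dw volume 0 M := by
    rw [intervalIntegrable_iff_integrableOn_Ioc_of_le hM0.le]
    set a : ℕ → ℝ := fun n => min Rs M / (n + 2) with ha
    have hmin : 0 < min Rs M := lt_min hRs hM0
    have ha0 : ∀ n, 0 < a n := fun n => by positivity
    have haM : ∀ n, a n ≤ M := fun n => by
      refine (div_le_self hmin.le ?_).trans (min_le_right _ _)
      have : (0 : ℝ) ≤ n := n.cast_nonneg
      linarith
    have hat : Tendsto a atTop (𝓝 0) := by
      refine Tendsto.div_atTop tendsto_const_nhds ?_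
      exact tendsto_atTop_add_const_right _ _ tendsto_natCast_atTop_atTop
    have hat' : Tendsto a atTop (𝓝[>] 0) :=
      tendsto_nhdsWithin_iff.2 ⟨hat, Eventually.of_forall ha0⟩
    refine integrableOn_Ioc_of_intervalIntegral_norm_bounded_left (l := atTop) (a := a)
      (I := I + 1 / 2 * (∫ z in (0 : ℝ)..M, Hw z) + 1) (fun n => ?_) hat ?_
    · exact (intervalIntegrable_iff_integrableOn_Ioc_of_le (haM n)).1 (hDii _ (ha0 n))
    · have h1 := (hDlim.comp hat').eventually_lt_const (lt_add_one _)
      filter_upwards [h1] with n hn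
      refine le_trans (le_of_eq ?_) hn.le
      simp only [Function.comp_apply]
      rw [intervalIntegral.integral_of_le (haM n)]
      refine setIntegral_congr_fun measurableSet_Ioc fun z hz => ?_
      exact Real.norm_of_nonneg (hD0 z ((ha0 n).trans hz.1))
  have hDzero : ∀ z, M < z → Dw z = 0 := fun z hz => by
    simp [hDw, h.eq_zero z (by linarith)]
  have hHzero : ∀ z, M < z → Hw z = 0 := fun z hz => by
    simp [hHw, h.eq_zero z (by linarith), h.vlap_eq_zero_high (by linarith : Rs + R₀ < z)]
  have hIoi : ∀ {g : ℝ → ℝ}, (∀ z, M < z → g z = 0) →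
      ∫ z in (0 : ℝ)..M, g z = ∫ z in Ioi (0 : ℝ), g z := by
    intro g hg
    rw [intervalIntegral.integral_of_le hM0.le]
    refine (setIntegral_eq_of_subset_of_forall_sdiff_eq_zero measurableSet_Ioi
      Ioc_subset_Ioi_self fun z hz => hg z ?_).symm
    by_contra h'
    exact hz.2 ⟨hz.1, not_lt.1 h'⟩
  have hDIoi : IntegrableOn Dw (Ioi 0) := by
    have h1 := (intervalIntegrable_iff_integrableOn_Ioc_of_le hM0.le).1 hDint
    refine h1.of_forall_sdiff_eq_zero measurableSet_Ioi fun z hz => hDzero z ?_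
    by_contra h'
    exact hz.2 ⟨hz.1, not_lt.1 h'⟩
  have hEm : AEStronglyMeasurable (fun p : Plane × ℝ =>
      weight α p.2 * gradSq (ext α f) p.1 p.2 * (ψ p.1 * ψs p.2)) halfSpace := by
    refine aestronglyMeasurable_halfSpace ?_
    exact (((weight_continuousOn α).comp continuousOn_snd fun p hp => hp.2).mul hgr).mul
      ((hψ.continuous.comp continuous_fst).continuousOn.mul
        (hψsc.comp continuousOn_snd fun p hp => hp.2))
  have hDeq : ∀ z, Dw z = ∫ x, weight α z * gradSq (ext α f) x z * (ψ x * ψs z) := by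
    intro z
    rw [hDw]
    simp only
    rw [← integral_const_mul, ← integral_mul_const]
    refine integral_congr_ae (Eventually.of_forall fun x => ?_)
    ring
  have hEi : Integrable (fun p : Plane × ℝ =>
      weight α p.2 * gradSq (ext α f) p.1 p.2 * (ψ p.1 * ψs p.2)) halfSpace := by
    rw [integrable_prod_iff' hEm]
    constructor
    · filter_upwards [ae_restrict_mem measurableSet_Ioi] with z hz
      have h1 : Integrable fun x => gradSq (ext α f) x z * ψ x :=
        ((continuous_slice hgr hz).mul hψ.continuous).integrable_of_hasCompactSupport hψc.mul_left
      refine (h1.const_mul (weight α z * ψs z)).congr (Eventually.of_forall fun x => ?_)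
      ring
    · refine Integrable.congr (f := Dw) hDIoi ?_
      filter_upwards [ae_restrict_mem measurableSet_Ioi] with z hz
      rw [hDeq]
      refine integral_congr_ae (Eventually.of_forall fun x => ?_)
      refine (Real.norm_of_nonneg (mul_nonneg (mul_nonneg (weight_pos hα₀ hα₂ hz).le
        (gradSq_nonneg _ _ _)) (mul_nonneg (hψ0 x) (h.nonneg (le_of_lt hz))))).symm
  refine ⟨hEi, ?_⟩
  -- The truncated integrals converge both to the value given by the balance and to the full
  -- integral.
  have huniq := tendsto_nhds_unique hDlim (hleft hDint)
  rw [hIoi hDzero, hIoi hHzero] at huniq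
  have hswap1 : ∫ x, ∫ z in Ioi (0 : ℝ), weight α z * gradSq (ext α f) x z * (ψ x * ψs z) =
      ∫ z in Ioi (0 : ℝ), Dw z := by
    rw [integral_integral_swap
      (f := fun x z => weight α z * gradSq (ext α f) x z * (ψ x * ψs z)) hEi]
    exact integral_congr_ae (Eventually.of_forall fun z => (hDeq z).symm)
  have hswap2 : ∫ x, ∫ z in Ioi (0 : ℝ), weight α z * ext α f x z ^ 2 *
        (lap ψ x * ψs z + ψ x * vlap α ψs z) = ∫ z in Ioi (0 : ℝ), Hw z :=
    integral_integral_swap (f := fun x z => weight α z * ext α f x z ^ 2 *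
        (lap ψ x * ψs z + ψ x * vlap α ψs z)) hLi
  rw [hswap1, hswap2, ← huniq]
  ring

end

/-! ### The velocity is divergence free -/

lemma fderiv_eq_coord {h : Plane → ℝ} (x v : Plane) :
    fderiv ℝ h x v = v 0 * fderiv ℝ h x (e 0) + v 1 * fderiv ℝ h x (e 1) := by
  have hv : v = v 0 • e 0 + v 1 • e 1 := by
    ext i; fin_cases i <;> simp [e]
  conv_lhs => rw [hv]
  simp

/-- Plancherel's identity, paired with a derivative of a test function. -/
lemma integral_mul_fderiv_eq_fourier {f : Plane → ℝ} (hf : MemLp (fun x => (f x : ℂ)) 2 volume)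
    {h : Plane → ℝ} (hh : ContDiff ℝ ∞ h) (hc : HasCompactSupport h) (i : Fin 2) :
    Integrable (fun ξ => 2 * Real.pi * Complex.I * (ξ i : ℂ) * 𝓕 (fun y => (h y : ℂ)) ξ *
      (starRingEnd ℂ) (l2Fourier f hf ξ)) ∧
    ((∫ x, f x * fderiv ℝ h x (e i) : ℝ) : ℂ) =
      ∫ ξ, 2 * Real.pi * Complex.I * (ξ i : ℂ) * 𝓕 (fun y => (h y : ℂ)) ξ *
        (starRingEnd ℂ) (l2Fourier f hf ξ) := by
  set k : Plane → ℝ := fun x => fderiv ℝ h x (e i) with hk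
  have hks : ContDiff ℝ ∞ k := contDiff_fderiv_apply hh (e i)
  have hkc : HasCompactSupport k := hc.fderiv_apply ℝ (e i)
  set S := toSchwartz hks hkc
  have h1 := Lp.inner_fourier_eq (hf.toLp _) (S.toLp 2)
  rw [SchwartzMap.toLp_fourier_eq, L2.inner_def, L2.inner_def] at h1
  have h2 : (fun ξ => inner ℂ ((𝓕 (hf.toLp (fun x => (f x : ℂ))) :
      Lp ℂ 2 (volume : Measure Plane)) ξ) ((𝓕 S).toLp 2 (volume : Measure Plane) ξ)) =ᵐ[volume]
      fun ξ => 2 * Real.pi * Complex.I * (ξ i : ℂ) * 𝓕 (fun y => (h y : ℂ)) ξ *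
        (starRingEnd ℂ) (l2Fourier f hf ξ) := by
    filter_upwards [(𝓕 S).coeFn_toLp 2 (volume : Measure Plane)] with ξ hξ
    rw [hξ, fourier_toSchwartz, fourier_fderiv_apply hh hc, inner_e]
    rfl
  have h3 : (fun x => inner ℂ (hf.toLp (fun x => (f x : ℂ)) x) (S.toLp 2 (volume : Measure Plane) x))
      =ᵐ[volume] fun x => ((f x * k x : ℝ) : ℂ) := by
    filter_upwards [S.coeFn_toLp 2 (volume : Measure Plane), hf.coeFn_toLp] with x hx1 hx2
    rw [hx1, hx2, toSchwartz_apply]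
    simp [mul_comm]
  refine ⟨(L2.integrable_inner _ _).congr h2, ?_⟩
  rw [integral_congr_ae h2, integral_congr_ae h3, integral_complex_ofReal] at h1
  exact h1.symm

lemma IsVelocityOf.memLp {θ : Plane → ℝ} {u : Plane → Plane} (h : IsVelocityOf θ u) :
    MemLp θ 2 volume := by
  obtain ⟨hθ, -⟩ := h
  exact hθ.re

/-- The velocity field is weakly divergence free. -/
lemma IsVelocityOf.integral_fderiv_eq_zero {θ : Plane → ℝ} {u : Plane → Plane}
    (h : IsVelocityOf θ u) {g : Plane → ℝ} (hg : ContDiff ℝ ∞ g) (hc : HasCompactSupport g) :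
    Integrable (fun x => fderiv ℝ g x (u x)) ∧ ∫ x, fderiv ℝ g x (u x) = 0 := by
  obtain ⟨hθ, hu₁, hu₂, Ψ, hΨ⟩ := h
  obtain ⟨i0, h0⟩ := integral_mul_fderiv_eq_fourier hu₁ hg hc 0
  obtain ⟨i1, h1⟩ := integral_mul_fderiv_eq_fourier hu₂ hg hc 1
  have hint : ∀ {f : Plane → ℝ}, MemLp (fun x => (f x : ℂ)) 2 volume → ∀ i,
      Integrable fun x => f x * fderiv ℝ g x (e i) := fun hf i =>
    MemLp.integrable_mul hf.re (memLp_of_contDiff (contDiff_fderiv_apply hg (e i))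
      (hc.fderiv_apply ℝ (e i)))
  have h2 : ∫ x, fderiv ℝ g x (u x) =
      (∫ x, u x 0 * fderiv ℝ g x (e 0)) + ∫ x, u x 1 * fderiv ℝ g x (e 1) := by
    rw [← integral_add (hint hu₁ 0) (hint hu₂ 1)]
    exact integral_congr_ae (Eventually.of_forall fun x => fderiv_eq_coord x (u x))
  have h3 : ((∫ x, fderiv ℝ g x (u x) : ℝ) : ℂ) = 0 := by
    rw [h2, Complex.ofReal_add, h0, h1, ← integral_add i0 i1]
    refine integral_eq_zero_of_ae ?_
    -- In terms of the stream function the two components contribute the product `ξ₀ξ₁` with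
    -- opposite signs, so the integrand vanishes almost everywhere.
    filter_upwards [hΨ] with ξ hξ
    rw [hξ.2.1, hξ.2.2]
    simp
    ring
  exact ⟨((hint hu₁ 0).add (hint hu₂ 1)).congr
    (Eventually.of_forall fun x => (fderiv_eq_coord x (u x)).symm), by exact_mod_cast h3⟩

/-! ### Products with cut-off functions -/

lemma continuous_mul_of_tsupport_subset {E : Type*} [TopologicalSpace E]
    {f g : E → ℝ} {U : Set E} (hU : IsOpen U) (hf : ContinuousOn f U) (hg : Continuous g)
    (hs : tsupport g ⊆ U) : Continuous fun x => f x * g x := by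
  rw [continuous_iff_continuousAt]
  intro x
  by_cases hx : x ∈ tsupport g
  · exact (hf.continuousAt (hU.mem_nhds (hs hx))).mul hg.continuousAt
  · refine (continuousAt_const (y := (0 : ℝ))).congr ?_
    filter_upwards [(isClosed_tsupport g).isOpen_compl.mem_nhds hx] with y hy
    rw [image_eq_zero_of_notMem_tsupport hy, mul_zero]

/-- The product rule behind the localization of `θ²/2`. -/
lemma mul_fderiv_mul {E : Type*} [NormedAddCommGroup E] [NormedSpace ℝ E]
    {f g : E → ℝ} {U : Set E} (hU : IsOpen U) (hf : ContDiffOn ℝ ∞ f U) (hg : ContDiff ℝ ∞ g)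
    (hs : tsupport g ⊆ U) (x v : E) :
    f x * fderiv ℝ (fun y => f y * g y) x v =
      fderiv ℝ (fun y => f y ^ 2 * (1 / 2 * g y)) x v + 1 / 2 * f x ^ 2 * fderiv ℝ g x v := by
  by_cases hx : x ∈ tsupport g
  · have h1 := ((hf.contDiffAt (hU.mem_nhds (hs hx))).differentiableAt (by simp)).hasFDerivAt
    have h2 := (hg.differentiable (by simp) x).hasFDerivAt
    rw [(show HasFDerivAt (fun y => f y * g y) _ x from h1.mul h2).fderiv,
      (show HasFDerivAt (fun y => f y ^ 2 * (1 / 2 * g y)) _ x from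
        (h1.pow 2).mul (h2.const_mul (1 / 2))).fderiv]
    simp
    ring
  · have h0 : g =ᶠ[𝓝 x] fun _ => 0 := notMem_tsupport_iff_eventuallyEq.1 hx
    have h1 : (fun y => f y * g y) =ᶠ[𝓝 x] fun _ => 0 := by
      filter_upwards [h0] with y hy; simp [hy]
    have h2 : (fun y => f y ^ 2 * (1 / 2 * g y)) =ᶠ[𝓝 x] fun _ => 0 := by
      filter_upwards [h0] with y hy; simp [hy]
    rw [h0.fderiv_eq, h1.fderiv_eq, h2.fderiv_eq]
    simp

lemma deriv_slice_eq {F : ℝ × Plane → ℝ} (hF : Differentiable ℝ F) (t : ℝ) (x : Plane) :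
    HasDerivAt (fun s => F (s, x)) (fderiv ℝ F (t, x) (1, 0)) t := by
  have h := (hF (t, x)).hasFDerivAt.comp_hasDerivAt t
    ((hasDerivAt_id t).prodMk (hasDerivAt_const t x))
  exact h

lemma fderiv_slice_eq {F : ℝ × Plane → ℝ} (hF : Differentiable ℝ F) (t : ℝ) (x v : Plane) :
    fderiv ℝ (fun y => F (t, y)) x v = fderiv ℝ F (t, x) (0, v) := by
  have h := (hF (t, x)).hasFDerivAt.comp x
    ((hasFDerivAt_const t x).prodMk (hasFDerivAt_id x))
  rw [show fderiv ℝ (fun y => F (t, y)) x = _ from h.fderiv]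
  simp

lemma hasCompactSupport_slice {F : ℝ × Plane → ℝ} (hc : HasCompactSupport F) (t : ℝ) :
    HasCompactSupport fun x => F (t, x) := by
  refine HasCompactSupport.intro (hc.isCompact.image continuous_snd) fun x hx => ?_
  by_contra h
  exact hx ⟨(t, x), subset_tsupport F h, rfl⟩

lemma integrable_slice {F : ℝ × Plane → ℝ} (hF : Continuous F) (hc : HasCompactSupport F)
    (t : ℝ) : Integrable fun x => F (t, x) :=
  (hF.comp (by fun_prop : Continuous fun x : Plane => (t, x))).integrable_of_hasCompactSupport
    (hasCompactSupport_slice hc t)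

lemma intervalIntegrable_integral_slice {F : ℝ × Plane → ℝ} (hF : Continuous F)
    (hc : HasCompactSupport F) (a b : ℝ) :
    IntervalIntegrable (fun t => ∫ x, F (t, x)) volume a b := by
  have h : Integrable F (volume.prod volume) := hF.integrable_of_hasCompactSupport hc
  exact h.integral_prod_left.intervalIntegrable

/-- By Fubini the time integral may be taken first, where the fundamental theorem of calculus leaves
only the vanishing end values. -/
lemma integral_fderiv_time_eq_zero {F : ℝ × Plane → ℝ} (hF : ContDiff ℝ ∞ F)
    (hc : HasCompactSupport F) {a b : ℝ} (ha : ∀ x, F (a, x) = 0) (hb : ∀ x, F (b, x) = 0) :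
    ∫ t in a..b, ∫ x, fderiv ℝ F (t, x) (1, 0) = 0 := by
  have hd := hF.differentiable (by simp)
  have hDc : Continuous fun p => fderiv ℝ F p (1, 0) :=
    ((hF.fderiv_right (m := ∞) (by simp)).clm_apply contDiff_const).continuous
  have hDs : HasCompactSupport fun p => fderiv ℝ F p (1, 0) := hc.fderiv_apply ℝ (1, 0)
  have hi : Integrable (fun p => fderiv ℝ F p (1, 0)) (volume.prod volume) :=
    hDc.integrable_of_hasCompactSupport hDs
  have hsw : ∫ t in a..b, ∫ x, fderiv ℝ F (t, x) (1, 0) =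
      ∫ x, ∫ t in a..b, fderiv ℝ F (t, x) (1, 0) := by
    refine intervalIntegral_integral_swap ?_
    refine Integrable.mono_measure hi ?_
    gcongr
    exact Measure.restrict_le_self
  rw [hsw]
  refine integral_eq_zero_of_ae (Eventually.of_forall fun x => ?_)
  have h2 := intervalIntegral.integral_eq_sub_of_hasDerivAt (a := a) (b := b)
    (fun t _ => deriv_slice_eq hd t x)
    ((hDc.comp (by fun_prop : Continuous fun t : ℝ => (t, x))).intervalIntegrable a b)
  rw [ha, hb, sub_zero] at h2
  exact h2

/-! ### Space-time cut-off functions -/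

section

variable {T C₀ δ : ℝ} {η : ℝ → ℝ} {ψ : Plane → ℝ}

lemma IsTimeCutoff.contDiff_mul (hη : IsTimeCutoff T C₀ δ η) (hψ : ContDiff ℝ ∞ ψ) :
    ContDiff ℝ ∞ fun p : ℝ × Plane => η p.1 * ψ p.2 :=
  (hη.smooth.comp contDiff_fst).mul (hψ.comp contDiff_snd)

lemma IsTimeCutoff.tsupport_mul (hη : IsTimeCutoff T C₀ δ η) :
    tsupport (fun p : ℝ × Plane => η p.1 * ψ p.2) ⊆ Icc (T / 3) (5 * T / 3) ×ˢ tsupport ψ := by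
  refine closure_minimal (fun p hp => ?_) (isClosed_Icc.prod (isClosed_tsupport ψ))
  refine ⟨?_, subset_tsupport ψ (right_ne_zero_of_mul hp)⟩
  by_contra h
  exact hp (by simp [hη.eq_zero p.1 h])

lemma IsTimeCutoff.hasCompactSupport_mul (hη : IsTimeCutoff T C₀ δ η)
    (hc : HasCompactSupport ψ) : HasCompactSupport fun p : ℝ × Plane => η p.1 * ψ p.2 :=
  (isCompact_Icc.prod hc).of_isClosed_subset (isClosed_tsupport _) hη.tsupport_mul

/-- The interval `[T/3, 5T/3]` lies in the open interval `(0, 2T)`, the range of times on which the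
solution is smooth. -/
lemma IsTimeCutoff.tsupport_mul_subset (hη : IsTimeCutoff T C₀ δ η) (hT : 0 < T) {V : Set Plane}
    (hs : tsupport ψ ⊆ V) :
    tsupport (fun p : ℝ × Plane => η p.1 * ψ p.2) ⊆ Ioo 0 (2 * T) ×ˢ V := by
  refine hη.tsupport_mul.trans (prod_mono (fun t ht => ?_) hs)
  exact ⟨by linarith [ht.1], by linarith [ht.2]⟩

end

/-! ### The localized equation -/

section

variable {α T C₀ δ R₀ : ℝ} {x₀ : Plane} {η : ℝ → ℝ} {ψ : Plane → ℝ}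
  {θ : ℝ → Plane → ℝ} {u : ℝ → Plane → Plane}

lemma isTestFunction_localized (hη : IsTimeCutoff T C₀ δ η) (hT : 0 < T) (hψ : ContDiff ℝ ∞ ψ)
    (hψc : HasCompactSupport ψ) (hψs : tsupport ψ ⊆ ball x₀ (2 * R₀))
    (hθ : ContDiffOn ℝ ∞ (fun p : ℝ × Plane => θ p.1 p.2) (Ioo 0 (2 * T) ×ˢ ball x₀ (2 * R₀))) :
    IsTestFunction fun t x => θ t x * (η t * ψ x) := by
  have hsub : tsupport (fun p : ℝ × Plane => θ p.1 p.2 * (η p.1 * ψ p.2)) ⊆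
      tsupport fun p : ℝ × Plane => η p.1 * ψ p.2 :=
    closure_mono fun p hp => right_ne_zero_of_mul hp
  refine ⟨contDiff_mul_of_tsupport_subset (isOpen_Ioo.prod isOpen_ball) hθ (hη.contDiff_mul hψ)
    (hη.tsupport_mul_subset hT hψs), (hη.hasCompactSupport_mul hψc).mul_left, ?_⟩
  refine hsub.trans ((hη.tsupport_mul_subset hT hψs).trans (prod_mono ?_ (subset_univ _)))
  exact fun t ht => ht.1

lemma flux_integrand_continuous (hη : IsTimeCutoff T C₀ δ η) (hT : 0 < T) (hψ : ContDiff ℝ ∞ ψ)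
    (hψc : HasCompactSupport ψ) (hψs : tsupport ψ ⊆ ball x₀ (2 * R₀))
    (hsm : SmoothOnMacro x₀ R₀ T θ u) :
    Continuous (fun p : ℝ × Plane => 1 / 2 * θ p.1 p.2 ^ 2 *
      fderiv ℝ (fun y => η p.1 * ψ y) p.2 (u p.1 p.2)) ∧
    HasCompactSupport (fun p : ℝ × Plane => 1 / 2 * θ p.1 p.2 ^ 2 *
      fderiv ℝ (fun y => η p.1 * ψ y) p.2 (u p.1 p.2)) := by
  have hd : ∀ p : ℝ × Plane, fderiv ℝ (fun y => η p.1 * ψ y) p.2 = η p.1 • fderiv ℝ ψ p.2 :=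
    fun p => fderiv_const_mul (hψ.differentiable (by simp) p.2) _
  have hU : IsOpen (Ioo 0 (2 * T) ×ˢ ball x₀ (2 * R₀)) := isOpen_Ioo.prod isOpen_ball
  have hterm : ∀ i : Fin 2, Continuous fun p : ℝ × Plane =>
      (1 / 2 * θ p.1 p.2 ^ 2 * u p.1 p.2 i) * (η p.1 * fderiv ℝ ψ p.2 (e i)) := by
    intro i
    have hc := contDiff_fderiv_apply hψ (e i)
    refine continuous_mul_of_tsupport_subset hU ?_ (hη.contDiff_mul hc).continuous
      (hη.tsupport_mul_subset hT ((tsupport_fderiv_apply_subset ℝ (e i)).trans hψs))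
    refine (continuousOn_const.mul (hsm.1.continuousOn.pow 2)).mul ?_
    exact (EuclideanSpace.proj (𝕜 := ℝ) i).continuous.comp_continuousOn hsm.2.continuousOn
  have heq : (fun p : ℝ × Plane => 1 / 2 * θ p.1 p.2 ^ 2 *
      fderiv ℝ (fun y => η p.1 * ψ y) p.2 (u p.1 p.2)) = fun p =>
      (1 / 2 * θ p.1 p.2 ^ 2 * u p.1 p.2 0) * (η p.1 * fderiv ℝ ψ p.2 (e 0)) +
      (1 / 2 * θ p.1 p.2 ^ 2 * u p.1 p.2 1) * (η p.1 * fderiv ℝ ψ p.2 (e 1)) := by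
    funext p
    rw [fderiv_eq_coord, hd]
    simp
    ring
  have hcs : ∀ i : Fin 2, HasCompactSupport fun p : ℝ × Plane =>
      (1 / 2 * θ p.1 p.2 ^ 2 * u p.1 p.2 i) * (η p.1 * fderiv ℝ ψ p.2 (e i)) := fun i =>
    (hη.hasCompactSupport_mul (hψc.fderiv_apply ℝ (e i))).mul_left
  rw [heq]
  exact ⟨(hterm 0).add (hterm 1), (hcs 0).add (hcs 1)⟩

lemma time_integrand_continuous (hη : IsTimeCutoff T C₀ δ η) (hT : 0 < T) (hψ : ContDiff ℝ ∞ ψ)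
    (hψc : HasCompactSupport ψ) (hψs : tsupport ψ ⊆ ball x₀ (2 * R₀))
    (hsm : SmoothOnMacro x₀ R₀ T θ u) :
    Continuous (fun p : ℝ × Plane => 1 / 2 * θ p.1 p.2 ^ 2 * (deriv η p.1 * ψ p.2)) ∧
    HasCompactSupport (fun p : ℝ × Plane => 1 / 2 * θ p.1 p.2 ^ 2 * (deriv η p.1 * ψ p.2)) := by
  have hη' : Continuous (deriv η) := hη.smooth.continuous_deriv (by simp)
  have hsub : tsupport (fun p : ℝ × Plane => deriv η p.1 * ψ p.2) ⊆
      Icc (T / 3) (5 * T / 3) ×ˢ tsupport ψ := by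
    refine closure_minimal (fun p hp => ?_) (isClosed_Icc.prod (isClosed_tsupport ψ))
    refine ⟨?_, subset_tsupport ψ (right_ne_zero_of_mul hp)⟩
    have h1 : tsupport η ⊆ Icc (T / 3) (5 * T / 3) := closure_minimal (fun t ht => by
      by_contra h; exact ht (hη.eq_zero t h)) isClosed_Icc
    exact h1 (support_deriv_subset (left_ne_zero_of_mul hp))
  constructor
  · refine continuous_mul_of_tsupport_subset
      (U := Ioo 0 (2 * T) ×ˢ ball x₀ (2 * R₀)) (isOpen_Ioo.prod isOpen_ball)
      (continuousOn_const.mul (hsm.1.continuousOn.pow 2))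
      ((hη'.comp continuous_fst).mul (hψ.continuous.comp continuous_snd)) ?_
    refine hsub.trans (prod_mono (fun t ht => ?_) hψs)
    exact ⟨by linarith [ht.1], by linarith [ht.2]⟩
  · exact HasCompactSupport.mul_left
      ((isCompact_Icc.prod hψc).of_isClosed_subset (isClosed_tsupport _) hsub)

/-- Joint measurability of the fractional Laplacian of time-dependent functions. -/
lemma stronglyMeasurable_fracLap {G : ℝ × Plane → ℝ} (hG : Continuous G) :
    StronglyMeasurable fun p : ℝ × Plane => fracLap α (fun y => G (p.1, y)) p.2 := by
  have h1 : StronglyMeasurable fun p : ℝ × Plane => 𝓕 (fun y => (G (p.1, y) : ℂ)) p.2 := by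
    simp only [Real.fourier_eq']
    refine StronglyMeasurable.integral_prod_right (f := fun (p : ℝ × Plane) (y : Plane) =>
      Complex.exp (((-2 * Real.pi * inner ℝ y p.2 : ℝ) : ℂ) * Complex.I) • (G (p.1, y) : ℂ)) ?_
    refine Continuous.stronglyMeasurable ?_
    unfold Function.uncurry
    fun_prop
  have h2 : StronglyMeasurable fun p : ℝ × Plane => 𝓕⁻ (fun ξ : Plane =>
      (((2 * Real.pi * ‖ξ‖) ^ α : ℝ) : ℂ) * 𝓕 (fun y : Plane => (G (p.1, y) : ℂ)) ξ) p.2 := by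
    simp only [Real.fourierInv_eq']
    refine StronglyMeasurable.integral_prod_right (f := fun (p : ℝ × Plane) (ξ : Plane) =>
      Complex.exp (((2 * Real.pi * inner ℝ ξ p.2 : ℝ) : ℂ) * Complex.I) •
        ((((2 * Real.pi * ‖ξ‖) ^ α : ℝ) : ℂ) * 𝓕 (fun y : Plane => (G (p.1, y) : ℂ)) ξ)) ?_
    have h3 : Continuous fun q : (ℝ × Plane) × Plane =>
        Complex.exp (((2 * Real.pi * inner ℝ q.2 q.1.2 : ℝ) : ℂ) * Complex.I) := by fun_prop
    have h4 : Measurable fun q : (ℝ × Plane) × Plane =>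
        (((2 * Real.pi * ‖q.2‖) ^ α : ℝ) : ℂ) := by fun_prop
    refine h3.stronglyMeasurable.smul (h4.stronglyMeasurable.mul ?_)
    exact h1.comp_measurable (g := fun q : (ℝ × Plane) × Plane => (q.1.1, q.2)) (by fun_prop)
  exact Complex.continuous_re.comp_stronglyMeasurable h2

lemma fracLap_zero (x : Plane) : fracLap α (fun _ => 0) x = 0 := by
  have h : 𝓕 (fun _ : Plane => (0 : ℂ)) = 0 := by
    funext ξ; simp [Real.fourier_eq]
  simp [fracLap, h, Real.fourierInv_eq]

/-- The weak equation, tested with `θ η ψ`. -/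
lemma localized_identity (hα₀ : 0 < α) (hα₂ : α < 2) (hη : IsTimeCutoff T C₀ δ η) (hT : 0 < T)
    (hψ : ContDiff ℝ ∞ ψ) (hψc : HasCompactSupport ψ) (hψs : tsupport ψ ⊆ ball x₀ (2 * R₀))
    (hsol : IsSolution α θ u) (hsm : SmoothOnMacro x₀ R₀ T θ u)
    (hC : IntervalIntegrable
      (fun t => ∫ x, θ t x * fracLap α (fun y => θ t y * (η t * ψ y)) x) volume 0 (2 * T)) :
    ∫ t in (0 : ℝ)..(2 * T), ∫ x, 1 / 2 * θ t x ^ 2 * fderiv ℝ (fun y => η t * ψ y) x (u t x) =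
      (∫ t in (0 : ℝ)..(2 * T), ∫ x, θ t x * fracLap α (fun y => θ t y * (η t * ψ y)) x) -
      ∫ t in (0 : ℝ)..(2 * T), ∫ x, 1 / 2 * θ t x ^ 2 * (deriv η t * ψ x) := by
  set f : ℝ × Plane → ℝ := fun p => θ p.1 p.2 with hf
  set φ : ℝ × Plane → ℝ := fun p => η p.1 * ψ p.2 with hφdef
  set U : Set (ℝ × Plane) := Ioo 0 (2 * T) ×ˢ ball x₀ (2 * R₀) with hUdef
  have hU : IsOpen U := isOpen_Ioo.prod isOpen_ball
  have hφ : ContDiff ℝ ∞ φ := hη.contDiff_mul hψ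
  have hφc : HasCompactSupport φ := hη.hasCompactSupport_mul hψc
  have hφs : tsupport φ ⊆ U := hη.tsupport_mul_subset hT hψs
  have hφd := hφ.differentiable (by simp)
  have hφ0 : ∀ t, t ∉ Icc (T / 3) (5 * T / 3) → ∀ x, φ (t, x) = 0 := fun t ht x => by
    simp [hφdef, hη.eq_zero t ht]
  have htest := isTestFunction_localized hη hT hψ hψc hψs hsm.1
  set G : ℝ × Plane → ℝ := fun p => f p * φ p with hG
  set H : ℝ × Plane → ℝ := fun p => f p ^ 2 * (1 / 2 * φ p) with hH
  have hGs : ContDiff ℝ ∞ G := htest.smooth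
  have hGc : HasCompactSupport G := htest.compact
  have hφs' : tsupport (fun p => 1 / 2 * φ p) ⊆ U :=
    (closure_mono fun p hp => right_ne_zero_of_mul hp).trans hφs
  have hHs : ContDiff ℝ ∞ H :=
    contDiff_mul_of_tsupport_subset hU (hsm.1.pow 2) (contDiff_const.mul hφ) hφs'
  have hHc : HasCompactSupport H := (hφc.mul_left (f := fun _ => 1 / 2)).mul_left
  have hGd := hGs.differentiable (by simp)
  have hHd := hHs.differentiable (by simp)
  have hH0 : ∀ t, t ∉ Icc (T / 3) (5 * T / 3) → ∀ x, H (t, x) = 0 := fun t ht x => by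
    simp [hH, hφ0 t ht x]
  obtain ⟨hBc, hBs⟩ := flux_integrand_continuous hη hT hψ hψc hψs hsm
  obtain ⟨hAc, hAs⟩ := time_integrand_continuous hη hT hψ hψc hψs hsm
  have hHtc : Continuous fun p => fderiv ℝ H p (1, 0) :=
    ((hHs.fderiv_right (m := ∞) (by simp)).clm_apply contDiff_const).continuous
  have hHts : HasCompactSupport fun p => fderiv ℝ H p (1, 0) := hHc.fderiv_apply ℝ (1, 0)
  have hweak := hsol.weak _ htest
  -- Beyond `2T` the cut-off `η` vanishes in a whole neighbourhood of `t`, so the time derivative of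
  -- the test function vanishes as well.
  have hIoc : (∫ t in Ioi (0 : ℝ), ∫ x : Plane,
      θ t x * (deriv (fun s => θ s x * (η s * ψ x)) t +
        fderiv ℝ (fun y => θ t y * (η t * ψ y)) x (u t x) -
        fracLap α (fun y => θ t y * (η t * ψ y)) x)) =
      ∫ t in (0 : ℝ)..(2 * T), ∫ x : Plane,
      θ t x * (deriv (fun s => θ s x * (η s * ψ x)) t +
        fderiv ℝ (fun y => θ t y * (η t * ψ y)) x (u t x) -
        fracLap α (fun y => θ t y * (η t * ψ y)) x) := by
    rw [intervalIntegral.integral_of_le (by linarith)]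
    refine setIntegral_eq_of_subset_of_forall_sdiff_eq_zero measurableSet_Ioi
      (fun t ht => ht.1) fun t ht => ?_
    have ht2 : 2 * T < t := not_le.1 fun h => ht.2 ⟨ht.1, h⟩
    have hz : ∀ᶠ s in 𝓝 t, η s = 0 := by
      filter_upwards [lt_mem_nhds ht2] with s hs
      exact hη.eq_zero s fun h => by linarith [h.2]
    refine integral_eq_zero_of_ae (Eventually.of_forall fun x => ?_)
    have h1 : (fun s => θ s x * (η s * ψ x)) =ᶠ[𝓝 t] fun _ => 0 := by
      filter_upwards [hz] with s hs; simp [hs]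
    have h2 : (fun y => θ t y * (η t * ψ y)) = fun _ => 0 := by
      funext y; simp [hz.self_of_nhds]
    simp only [h1.deriv_eq, h2, fracLap_zero]
    simp
  -- With `H = ½θ²φ`, the products of `θ` with the derivatives of `θφ` are derivatives of `H` plus
  -- `½θ²` times derivatives of `φ`. The term `u·∇H` is absent on the right because its integral
  -- vanishes.
  have hsplit : ∀ᵐ t ∂(volume.restrict (Ioi (0 : ℝ))), (∫ x : Plane,
      θ t x * (deriv (fun s => θ s x * (η s * ψ x)) t +
        fderiv ℝ (fun y => θ t y * (η t * ψ y)) x (u t x) -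
        fracLap α (fun y => θ t y * (η t * ψ y)) x)) =
      (∫ x, fderiv ℝ H (t, x) (1, 0)) + (∫ x, 1 / 2 * θ t x ^ 2 * (deriv η t * ψ x)) +
      (∫ x, 1 / 2 * θ t x ^ 2 * fderiv ℝ (fun y => η t * ψ y) x (u t x)) -
      ∫ x, θ t x * fracLap α (fun y => θ t y * (η t * ψ y)) x := by
    filter_upwards [hsol.velocity] with t ht
    have hGt : ContDiff ℝ ∞ fun y => θ t y * (η t * ψ y) :=
      hGs.comp (contDiff_const.prodMk contDiff_id)
    have hGtc : HasCompactSupport fun y => θ t y * (η t * ψ y) := hasCompactSupport_slice hGc t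
    have hHt : ContDiff ℝ ∞ fun y => H (t, y) := hHs.comp (contDiff_const.prodMk contDiff_id)
    have hHtc' : HasCompactSupport fun y => H (t, y) := hasCompactSupport_slice hHc t
    obtain ⟨i4, hdiv⟩ := ht.integral_fderiv_eq_zero hHt hHtc'
    have i1 : Integrable fun x => fderiv ℝ H (t, x) (1, 0) := integrable_slice hHtc hHts t
    have i2 : Integrable fun x => 1 / 2 * θ t x ^ 2 * (deriv η t * ψ x) :=
      integrable_slice hAc hAs t
    have i3 : Integrable fun x => 1 / 2 * θ t x ^ 2 * fderiv ℝ (fun y => η t * ψ y) x (u t x) :=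
      integrable_slice hBc hBs t
    have i5 : Integrable fun x => θ t x * fracLap α (fun y => θ t y * (η t * ψ y)) x := by
      obtain ⟨K, hK⟩ := fracLap_le_decay hα₀ hα₂ hGt hGtc
      refine (integrable_decay_mul ht.memLp K).mono'
        (ht.memLp.aestronglyMeasurable.mul ?_) (Eventually.of_forall fun x => ?_)
      · exact ((stronglyMeasurable_fracLap (α := α) hGs.continuous).comp_measurable
          measurable_prodMk_left).aestronglyMeasurable
      · rw [norm_mul, mul_comm]
        exact mul_le_mul_of_nonneg_right (hK x) (abs_nonneg _)
    have j1 := integral_add i1 i2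
    have j2 := integral_add (i1.add i2) i4
    have j3 := integral_add ((i1.add i2).add i4) i3
    have j4 := integral_sub (((i1.add i2).add i4).add i3) i5
    simp only [Pi.add_apply] at j1 j2 j3 j4
    -- Weak incompressibility, applied to `H` at time `t`, removes the transport term.
    rw [hdiv, add_zero] at j2
    rw [← j1, ← j2, ← j3, ← j4]
    refine integral_congr_ae (Eventually.of_forall fun x => ?_)
    have e1 : deriv (fun s => θ s x * (η s * ψ x)) t = fderiv ℝ G (t, x) (1, 0) :=
      (deriv_slice_eq hGd t x).deriv
    have e2 : fderiv ℝ (fun y => θ t y * (η t * ψ y)) x (u t x) = fderiv ℝ G (t, x) (0, u t x) :=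
      fderiv_slice_eq hGd t x _
    have e3 : θ t x * fderiv ℝ G (t, x) (1, 0) = fderiv ℝ H (t, x) (1, 0) +
        1 / 2 * θ t x ^ 2 * fderiv ℝ φ (t, x) (1, 0) :=
      mul_fderiv_mul hU hsm.1 hφ hφs (t, x) (1, 0)
    have e4 : θ t x * fderiv ℝ G (t, x) (0, u t x) = fderiv ℝ H (t, x) (0, u t x) +
        1 / 2 * θ t x ^ 2 * fderiv ℝ φ (t, x) (0, u t x) :=
      mul_fderiv_mul hU hsm.1 hφ hφs (t, x) (0, u t x)
    have e5 : fderiv ℝ (fun y => η t * ψ y) x (u t x) = fderiv ℝ φ (t, x) (0, u t x) := fderiv_slice_eq hφd t x (u t x)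
    have e6 := (deriv_slice_eq hφd t x).deriv
    have e7 : deriv (fun s => φ (s, x)) t = deriv η t * ψ x :=
      ((hη.smooth.differentiable (by simp) t).hasDerivAt.mul_const (ψ x)).deriv
    have e8 := fderiv_slice_eq hHd t x (u t x)
    beta_reduce
    rw [e1, e2, e8, mul_sub, mul_add, e3, e4, e5, ← e6, e7]
    ring
  have hBi := intervalIntegrable_integral_slice hBc hBs 0 (2 * T)
  have hAi := intervalIntegrable_integral_slice hAc hAs 0 (2 * T)
  have hHi := intervalIntegrable_integral_slice hHtc hHts 0 (2 * T)
  have hH : ∫ t in (0 : ℝ)..(2 * T), ∫ x, fderiv ℝ H (t, x) (1, 0) = 0 :=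
    integral_fderiv_time_eq_zero hHs hHc (hH0 0 fun h => by linarith [h.1])
      (hH0 (2 * T) fun h => by linarith [h.2])
  have hI : ∫ t in (0 : ℝ)..(2 * T), ∫ x : Plane,
      θ t x * (deriv (fun s => θ s x * (η s * ψ x)) t +
        fderiv ℝ (fun y => θ t y * (η t * ψ y)) x (u t x) -
        fracLap α (fun y => θ t y * (η t * ψ y)) x) =
      ∫ t in (0 : ℝ)..(2 * T), ((∫ x, fderiv ℝ H (t, x) (1, 0)) +
        (∫ x, 1 / 2 * θ t x ^ 2 * (deriv η t * ψ x)) +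
        (∫ x, 1 / 2 * θ t x ^ 2 * fderiv ℝ (fun y => η t * ψ y) x (u t x)) -
        ∫ x, θ t x * fracLap α (fun y => θ t y * (η t * ψ y)) x) := by
    rw [intervalIntegral.integral_of_le (by linarith),
      intervalIntegral.integral_of_le (by linarith)]
    exact integral_congr_ae (ae_restrict_of_ae_restrict_of_subset (fun t ht => ht.1) hsplit)
  rw [hIoc, hI, intervalIntegral.integral_sub ((hHi.add hAi).add hBi) hC,
    intervalIntegral.integral_add (hHi.add hAi) hBi, intervalIntegral.integral_add hHi hAi, hH]
    at hweak
  linarith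

end

/-! ### Measurability and integrability in time -/

section

variable {α T C₀ δ R₀ Rs : ℝ} {x₀ : Plane} {η : ℝ → ℝ} {ψ : Plane → ℝ} {ψs : ℝ → ℝ}
  {θ : ℝ → Plane → ℝ} {u : ℝ → Plane → Plane}

lemma IsSolution.aestronglyMeasurable (h : IsSolution α θ u) :
    AEStronglyMeasurable (fun p : ℝ × Plane => θ p.1 p.2)
      ((volume.restrict (Ioi (0 : ℝ))).prod volume) := by
  have h1 := h.meas_θ
  rwa [Measure.volume_eq_prod, ← Measure.prod_restrict, Measure.restrict_univ] at h1

/-- Turns the essential bound on the `L²` norm into a real bound on the energy, valid at almost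
every time together with membership in `L²`. -/
lemma IsSolution.exists_energy_bound (h : IsSolution α θ u) :
    ∃ K, 0 ≤ K ∧ ∀ᵐ t ∂(volume.restrict (Ioi (0 : ℝ))), MemLp (θ t) 2 volume ∧
      ∫ x, θ t x ^ 2 ≤ K := by
  obtain ⟨M, hM⟩ := h.bounded
  refine ⟨(M : ℝ) ^ 2, by positivity, ?_⟩
  filter_upwards [hM, h.velocity] with t h1 h2
  refine ⟨h2.memLp, ?_⟩
  have h3 : 0 ≤ ∫ x, θ t x ^ 2 := integral_nonneg fun x => sq_nonneg _
  rw [h2.memLp.eLpNorm_eq_integral_rpow_norm (by simp) (by simp)] at h1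
  have h4 : ∀ x, ‖θ t x‖ ^ (2 : ENNReal).toReal = θ t x ^ 2 := fun x => by
    simp
  simp only [h4] at h1
  have h5 : (∫ x, θ t x ^ 2) ^ ((2 : ENNReal).toReal)⁻¹ ≤ M := by
    rw [← ENNReal.ofReal_coe_nnreal] at h1
    exact (ENNReal.ofReal_le_ofReal_iff M.coe_nonneg).1 h1
  have h6 : ((∫ x, θ t x ^ 2) ^ ((2 : ENNReal).toReal)⁻¹) ^ 2 = ∫ x, θ t x ^ 2 := by
    rw [← Real.rpow_natCast, ← Real.rpow_mul h3]
    simp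
  rw [← h6]
  gcongr

lemma IsSolution.aestronglyMeasurable_pairing (h : IsSolution α θ u) {g : ℝ → Plane → ℝ}
    (hg : IsTestFunction g) :
    AEStronglyMeasurable (fun t => ∫ x, θ t x * fracLap α (g t) x)
      (volume.restrict (Ioi (0 : ℝ))) :=
  AEStronglyMeasurable.integral_prod_right' (h.aestronglyMeasurable.mul
    (stronglyMeasurable_fracLap (α := α) hg.smooth.continuous).aestronglyMeasurable)

lemma measurable_poissonKernel : Measurable fun p : Plane × ℝ => poissonKernel α p.1 p.2 := by
  unfold poissonKernel
  fun_prop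

/-- The extension of a time-dependent function is jointly measurable, up to null sets of times. -/
lemma exists_stronglyMeasurable_ext (h : IsSolution α θ u) :
    ∃ E : ℝ × (Plane × ℝ) → ℝ, StronglyMeasurable E ∧
      ∀ᵐ t ∂(volume.restrict (Ioi (0 : ℝ))), ∀ x z, 0 < z → ext α (θ t) x z = E (t, (x, z)) := by
  have hm := h.aestronglyMeasurable
  refine ⟨fun q => ∫ y, poissonKernel α (q.2.1 - y) q.2.2 * hm.mk _ (q.1, y), ?_, ?_⟩
  · refine StronglyMeasurable.integral_prod_right
      (f := fun (q : ℝ × (Plane × ℝ)) (y : Plane) =>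
        poissonKernel α (q.2.1 - y) q.2.2 * hm.mk _ (q.1, y)) ?_
    have h1 : Measurable fun r : (ℝ × (Plane × ℝ)) × Plane => (r.1.2.1 - r.2, r.1.2.2) := by
      fun_prop
    have h2 : Measurable fun r : (ℝ × (Plane × ℝ)) × Plane => (r.1.1, r.2) := by
      fun_prop
    exact (measurable_poissonKernel.comp h1).stronglyMeasurable.mul
      (hm.stronglyMeasurable_mk.comp_measurable h2)
  · filter_upwards [Measure.ae_ae_of_ae_prod hm.ae_eq_mk] with t ht x z hz
    rw [ext, if_neg hz.ne']
    refine integral_congr_ae ?_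
    filter_upwards [ht] with y hy
    rw [hy]

lemma IsVerticalCutoff.aestronglyMeasurable (h : IsVerticalCutoff α Rs R₀ C₀ δ ψs) :
    AEStronglyMeasurable ψs (volume.restrict (Ioi (0 : ℝ))) :=
  (h.smooth.continuousOn.mono Ioi_subset_Ici_self).aestronglyMeasurable measurableSet_Ioi

/-- Weighted squares of the extension against a power of the cut-off function. -/
lemma integrable_weight_ext_sq_cutoff (hα₀ : 0 < α) (hα₂ : α < 2) (hδ₀ : 1 / 2 < δ)
    (hRs : 0 < Rs)
    (h : IsVerticalCutoff α Rs R₀ C₀ δ ψs) {f : Plane → ℝ} (hf : MemLp f 2 volume)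
    (hψ : Continuous ψ) (hψ0 : ∀ x, 0 ≤ ψ x) (hψ1 : ∀ x, ψ x ≤ 1) {a : ℝ} (ha0 : 0 ≤ a)
    (ha1 : a ≤ 1) :
    Integrable (fun p : Plane × ℝ => weight α p.2 * (1 / 2 * ext α f p.1 p.2 ^ 2) *
      (a * ψ p.1 * ψs p.2) ^ (2 * δ - 1)) halfSpace ∧
    |∫ x, ∫ z in Ioi (0 : ℝ), weight α z * (1 / 2 * ext α f x z ^ 2) *
      (a * ψ x * ψs z) ^ (2 * δ - 1)| ≤
      1 / 2 * (∫ z in Ioc 0 (Rs + R₀), weight α z) * ∫ x, f x ^ 2 := by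
  have hq : 0 < 2 * δ - 1 := by linarith
  have hG : AEStronglyMeasurable
      (fun p : Plane × ℝ => 1 / 2 * (a * ψ p.1 * ψs p.2) ^ (2 * δ - 1)) halfSpace := by
    have h1 : AEMeasurable (fun p : Plane × ℝ => a * ψ p.1 * ψs p.2) halfSpace :=
      ((hψ.comp continuous_fst).measurable.const_mul a).aemeasurable.mul
        h.aestronglyMeasurable.comp_snd.aemeasurable
    exact ((h1.pow_const _).const_mul _).aestronglyMeasurable
  have hI := integrable_weight_ext_sq hα₀ hα₂ hf hG (C := 1 / 2) (M := Rs + R₀) ?_ ?_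
  · have he : ∀ x z, weight α z * ext α f x z ^ 2 * (1 / 2 * (a * ψ x * ψs z) ^ (2 * δ - 1)) =
        weight α z * (1 / 2 * ext α f x z ^ 2) * (a * ψ x * ψs z) ^ (2 * δ - 1) :=
      fun x z => by ring
    simpa only [he] using hI
  · intro x z hz
    have h0 : 0 ≤ a * ψ x * ψs z := mul_nonneg (mul_nonneg ha0 (hψ0 x)) (h.nonneg hz.le)
    have h1 : a * ψ x * ψs z ≤ 1 :=
      mul_le_one₀ (mul_le_one₀ ha1 (hψ0 x) (hψ1 x)) (h.nonneg hz.le) (h.le_one hRs hz.le)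
    have h2 := Real.rpow_nonneg h0 (2 * δ - 1)
    rw [abs_of_nonneg (by positivity)]
    linarith [Real.rpow_le_one h0 h1 hq.le]
  · intro x z hz
    rw [h.eq_zero z hz.le, mul_zero, Real.zero_rpow hq.ne', mul_zero]

/-- Contractivity of the extension bounds each time slice by the energy, which is essentially
bounded in time. Joint measurability comes from a measurable version of the extension. -/
lemma intervalIntegrable_varthetaStar (hα₀ : 0 < α) (hα₂ : α < 2) (hδ₀ : 1 / 2 < δ)
    (hRs : 0 < Rs) (hT : 0 < T)
    (h : IsVerticalCutoff α Rs R₀ C₀ δ ψs) (hη : IsTimeCutoff T C₀ δ η)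
    (hψ : Continuous ψ) (hψ0 : ∀ x, 0 ≤ ψ x) (hψ1 : ∀ x, ψ x ≤ 1) (hsol : IsSolution α θ u) :
    IntervalIntegrable (fun t => ∫ x, ∫ z in Ioi (0 : ℝ),
      weight α z * (1 / 2 * ext α (θ t) x z ^ 2) * (η t * ψ x * ψs z) ^ (2 * δ - 1))
      volume 0 (2 * T) := by
  rw [intervalIntegrable_iff_integrableOn_Ioc_of_le (by linarith)]
  have hsub : Ioc 0 (2 * T) ⊆ Ioi (0 : ℝ) := fun t ht => ht.1
  obtain ⟨E, hE, hEq⟩ := exists_stronglyMeasurable_ext hsol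
  obtain ⟨K, hK0, hK⟩ := hsol.exists_energy_bound
  have hm : AEStronglyMeasurable (fun t => ∫ x, ∫ z in Ioi (0 : ℝ),
      weight α z * (1 / 2 * ext α (θ t) x z ^ 2) * (η t * ψ x * ψs z) ^ (2 * δ - 1))
      (volume.restrict (Ioi (0 : ℝ))) := by
    have h1 : AEStronglyMeasurable (fun q : (ℝ × Plane) × ℝ =>
        weight α q.2 * (1 / 2 * E (q.1.1, (q.1.2, q.2)) ^ 2) *
          (η q.1.1 * ψ q.1.2 * ψs q.2) ^ (2 * δ - 1))
        (((volume.restrict (Ioi (0 : ℝ))).prod (volume : Measure Plane)).prod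
          (volume.restrict (Ioi (0 : ℝ)))) := by
      have hw : Measurable (weight α) := by unfold weight; fun_prop
      have hE' : Measurable fun q : (ℝ × Plane) × ℝ => E (q.1.1, (q.1.2, q.2)) :=
        hE.measurable.comp (by fun_prop)
      have h2 : Measurable fun q : (ℝ × Plane) × ℝ =>
          weight α q.2 * (1 / 2 * E (q.1.1, (q.1.2, q.2)) ^ 2) :=
        (hw.comp measurable_snd).mul ((hE'.pow_const 2).const_mul _)
      have h3 : Measurable fun q : (ℝ × Plane) × ℝ => η q.1.1 * ψ q.1.2 :=
        (hη.smooth.continuous.measurable.comp (by fun_prop)).mul (hψ.measurable.comp (by fun_prop))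
      exact (h2.aemeasurable.mul ((h3.aemeasurable.mul
        h.aestronglyMeasurable.comp_snd.aemeasurable).pow_const _)).aestronglyMeasurable
    refine (h1.integral_prod_right'.integral_prod_right').congr ?_
    filter_upwards [hEq] with t ht
    refine integral_congr_ae (Eventually.of_forall fun x => ?_)
    refine setIntegral_congr_fun measurableSet_Ioi fun z hz => ?_
    simp only [ht x z hz]
  refine Integrable.mono' (g := fun _ => 1 / 2 * (∫ z in Ioc 0 (Rs + R₀), weight α z) * K)
    (integrable_const _) (hm.mono_measure (Measure.restrict_mono hsub le_rfl)) ?_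
  filter_upwards [ae_restrict_of_ae_restrict_of_subset hsub hK] with t ht
  refine (integrable_weight_ext_sq_cutoff hα₀ hα₂ hδ₀ hRs h ht.1 hψ hψ0 hψ1 (hη.nonneg t)
    (hη.le_one t)).2.trans ?_
  have hw : 0 ≤ ∫ z in Ioc 0 (Rs + R₀), weight α z :=
    setIntegral_nonneg measurableSet_Ioc fun z hz => (weight_pos hα₀ hα₂ hz.1).le
  have := ht.2
  gcongr

/-- Because `2δ - 1 > 0`, the power is continuous where the cut-off vanishes and has no larger
support. -/
lemma vartheta_integrand_continuous (hδ₀ : 1 / 2 < δ) (hη : IsTimeCutoff T C₀ δ η) (hT : 0 < T)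
    (hψ : ContDiff ℝ ∞ ψ) (hψc : HasCompactSupport ψ) (hψs : tsupport ψ ⊆ ball x₀ (2 * R₀))
    (hsm : SmoothOnMacro x₀ R₀ T θ u) :
    Continuous (fun p : ℝ × Plane => 1 / 2 * θ p.1 p.2 ^ 2 * (η p.1 * ψ p.2) ^ (2 * δ - 1)) ∧
    HasCompactSupport
      (fun p : ℝ × Plane => 1 / 2 * θ p.1 p.2 ^ 2 * (η p.1 * ψ p.2) ^ (2 * δ - 1)) := by
  have hq : 0 < 2 * δ - 1 := by linarith
  have hsub : tsupport (fun p : ℝ × Plane => (η p.1 * ψ p.2) ^ (2 * δ - 1)) ⊆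
      tsupport fun p : ℝ × Plane => η p.1 * ψ p.2 := closure_mono fun p hp h0 => hp (by
    simp only at h0 ⊢
    rw [h0, Real.zero_rpow hq.ne'])
  constructor
  · exact continuous_mul_of_tsupport_subset
      (U := Ioo 0 (2 * T) ×ˢ ball x₀ (2 * R₀)) (isOpen_Ioo.prod isOpen_ball)
      (continuousOn_const.mul (hsm.1.continuousOn.pow 2))
      ((hη.contDiff_mul hψ).continuous.rpow_const fun p => Or.inr hq.le)
      (hsub.trans (hη.tsupport_mul_subset hT hψs))
  · exact HasCompactSupport.mul_left
      ((hη.hasCompactSupport_mul hψc).of_isClosed_subset (isClosed_tsupport _) hsub)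

end

/-! ### Sums over the cover -/

section

variable {α δ C₀ R₀ R : ℝ} {x₀ : Plane} {K₁ K₂ n : ℕ} {c : Fin n → Plane}
  {ψ₀ : Plane → ℝ} {ψ : Fin n → Plane → ℝ}

lemma IsElementCutoff.le {c : Plane} {ψ : Plane → ℝ} (h : IsElementCutoff x₀ R₀ C₀ δ ψ₀ c R ψ)
    (x : Plane) : ψ x ≤ ψ₀ x := by
  obtain ⟨-, h, -⟩ := h
  exact h x

lemma IsElementCutoff.tsupport_subset {c : Plane} {ψ : Plane → ℝ}
    (h₀ : IsMacroCutoff x₀ R₀ C₀ δ ψ₀) (h : IsElementCutoff x₀ R₀ C₀ δ ψ₀ c R ψ) :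
    tsupport ψ ⊆ ball x₀ (2 * R₀) := by
  refine (closure_mono fun x hx => ?_).trans h₀.support
  have h1 : 0 < ψ x := lt_of_le_of_ne (h.cutoff.nonneg x) (Ne.symm hx)
  exact (h1.trans_le (h.le x)).ne'

lemma IsMacroCutoff.eq_zero (h₀ : IsMacroCutoff x₀ R₀ C₀ δ ψ₀) {x : Plane}
    (hx : x ∉ ball x₀ (2 * R₀)) : ψ₀ x = 0 :=
  image_eq_zero_of_notMem_tsupport fun h => hx (h₀.support h)

/-- The rays through a point outside the ball that lies in a closed cover element leave it. -/
lemma exists_mem_sphere {p v c : Plane} {R : ℝ} (hp : p ∈ closedBall c R) (hv : v ≠ 0) :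
    ∃ s : ℝ, 0 ≤ s ∧ p + s • v ∈ sphere c R := by
  have hv' := norm_pos_iff.2 hv
  have hR : 0 ≤ R := dist_nonneg.trans hp
  -- At this parameter the displacement has length `R + dist p c`, and the triangle inequality puts
  -- the endpoint at distance at least `R` from `c`. The intermediate value theorem then gives a
  -- crossing.
  set b : ℝ := (R + dist p c) / ‖v‖
  have hb : 0 ≤ b := by positivity
  have hcont : ContinuousOn (fun s : ℝ => dist (p + s • v) c) (Icc 0 b) := by fun_prop
  have h0 : dist (p + (0 : ℝ) • v) c ≤ R := by simpa using hp
  have h1 : R ≤ dist (p + b • v) c := by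
    have h2 : ‖b • v‖ = R + dist p c := by
      rw [norm_smul, Real.norm_of_nonneg hb, div_mul_cancel₀ _ hv'.ne']
    have h3 : ‖b • v‖ ≤ dist (p + b • v) c + dist p c := by
      rw [dist_eq_norm, dist_eq_norm]
      calc ‖b • v‖ = ‖(p + b • v - c) - (p - c)‖ := by congr 1; abel
        _ ≤ _ := norm_sub_le _ _
    linarith
  obtain ⟨s, hs, hs'⟩ := intermediate_value_Icc hb hcont ⟨h0, h1⟩
  exact ⟨s, hs.1, hs'⟩

/-- At every point of the macroscopic ball or annulus some single element already has a cut-off at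
least `ψ₀`. In the ball this is the covering property. In the annulus the point is projected
radially onto the boundary sphere, and an element whose closed ball contains the projection casts
its shadow `S1` over the point. -/
lemma le_sum_cutoff (hR₀ : 0 < R₀) (h₀ : IsMacroCutoff x₀ R₀ C₀ δ ψ₀)
    (hc : IsCover K₁ K₂ x₀ R₀ R c)
    (hψ : ∀ i, IsElementCutoff x₀ R₀ C₀ δ ψ₀ (c i) R (ψ i)) (x : Plane) :
    ψ₀ x ≤ ∑ i, ψ i x := by
  have hle : ∀ i, ψ₀ x ≤ ψ i x → ψ₀ x ≤ ∑ i, ψ i x := fun i hi =>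
    hi.trans (Finset.single_le_sum (f := fun i => ψ i x)
      (fun j _ => (hψ j).cutoff.nonneg x) (Finset.mem_univ i))
  by_cases hx2 : x ∈ ball x₀ (2 * R₀)
  swap
  · rw [h₀.eq_zero hx2]
    exact Finset.sum_nonneg fun i _ => (hψ i).cutoff.nonneg x
  by_cases hx1 : x ∈ ball x₀ R₀
  · obtain ⟨i, hi⟩ := mem_iUnion.1 (hc.covers hx1)
    refine hle i ?_
    rw [h₀.eq_one x hx1]
    by_cases hint : Interior x₀ R₀ (c i) R
    · rw [(hψ i).interior hint x hi]
    · rw [(hψ i).boundary₀ hint x ⟨hi, hx1⟩]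
  have hd : R₀ ≤ dist x x₀ := not_lt.1 hx1
  have hd0 : 0 < dist x x₀ := hR₀.trans_le hd
  have hv : x - x₀ ≠ 0 := fun h => by rw [dist_eq_norm, h, norm_zero] at hd0; exact hd0.false
  set p : Plane := x₀ + (R₀ / dist x x₀) • (x - x₀) with hp
  have hpd : dist p x₀ = R₀ := by
    rw [hp, dist_eq_norm, add_sub_cancel_left, norm_smul, ← dist_eq_norm,
      Real.norm_of_nonneg (by positivity), div_mul_cancel₀ _ hd0.ne']
  have hpc : p ∈ ⋃ i, closedBall (c i) R := by
    -- The open balls cover only the open ball. A finite union of closed balls is closed, so it also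
    -- contains the boundary sphere.
    have h1 : closedBall x₀ R₀ ⊆ ⋃ i, closedBall (c i) R := by
      rw [← closure_ball x₀ hR₀.ne']
      exact closure_minimal (hc.covers.trans (iUnion_mono fun i => ball_subset_closedBall))
        (isClosed_iUnion_of_finite fun i => isClosed_closedBall)
    exact h1 hpd.le
  obtain ⟨i, hi⟩ := mem_iUnion.1 hpc
  -- An interior element has its closed ball inside `B(x₀, R₀)`, whereas `p` lies on the boundary
  -- sphere.
  have hint : ¬ Interior x₀ R₀ (c i) R := fun h => by
    have := mem_ball.1 (h hi)
    linarith
  refine hle i ((hψ i).boundary₁ hint x ⟨hd, hx2, ?_⟩).ge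
  obtain ⟨s, hs, hs'⟩ := exists_mem_sphere hi hv
  have he : p + s • (x - x₀) = x₀ + (R₀ / dist x x₀ + s) • (x - x₀) := by
    rw [hp, add_smul, add_assoc]
  have hnn : 0 ≤ R₀ / dist x x₀ := by positivity
  refine ⟨R₀ / dist x x₀ + s, by positivity, he ▸ hs', fun hb => ?_⟩
  rw [mem_ball, dist_eq_norm, add_sub_cancel_left, norm_smul, ← dist_eq_norm,
    Real.norm_of_nonneg (by positivity), add_mul, div_mul_cancel₀ _ hd0.ne'] at hb
  linarith [mul_nonneg hs hd0.le]

/-- Sums of monotone functions of the cut-off functions are controlled by the multiplicity. -/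
lemma sum_cutoff_le (h₀ : IsMacroCutoff x₀ R₀ C₀ δ ψ₀) (hc : IsCover K₁ K₂ x₀ R₀ R c)
    (hψ : ∀ i, IsElementCutoff x₀ R₀ C₀ δ ψ₀ (c i) R (ψ i)) {g : ℝ → ℝ} (hg0 : g 0 = 0)
    (hg : MonotoneOn g (Ici 0)) (x : Plane) :
    ∑ i, g (ψ i x) ≤ K₂ * g (ψ₀ x) := by
  classical
  have hle : ∀ i, g (ψ i x) ≤ g (ψ₀ x) := fun i =>
    hg ((hψ i).cutoff.nonneg x) (h₀.cutoff.nonneg x) ((hψ i).le x)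
  have hg1 : 0 ≤ g (ψ₀ x) := hg0 ▸ hg (mem_Ici.2 le_rfl) (h₀.cutoff.nonneg x) (h₀.cutoff.nonneg x)
  by_cases hx2 : x ∈ ball x₀ (2 * R₀)
  swap
  · have hz : ∀ i, ψ i x = 0 := fun i =>
      le_antisymm (((hψ i).le x).trans (h₀.eq_zero hx2).le) ((hψ i).cutoff.nonneg x)
    simp only [hz, hg0, Finset.sum_const_zero]
    positivity
  have hcard := hc.multiplicity x hx2
  rw [ncard_eq_toFinset_card'] at hcard
  calc ∑ i, g (ψ i x) = ∑ i ∈ {i : Fin n | x ∈ region x₀ R₀ (c i) R}.toFinset, g (ψ i x) := by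
        refine (Finset.sum_subset (Finset.subset_univ _) fun i _ hi => ?_).symm
        have h1 : ψ i x = 0 := by
          by_contra h
          exact hi (mem_toFinset.2 ((hψ i).support h))
        rw [h1, hg0]
    _ ≤ ∑ i ∈ {i : Fin n | x ∈ region x₀ R₀ (c i) R}.toFinset, g (ψ₀ x) :=
        Finset.sum_le_sum fun i _ => hle i
    _ = (({i : Fin n | x ∈ region x₀ R₀ (c i) R}.toFinset.card : ℕ) : ℝ) * g (ψ₀ x) := by
        rw [Finset.sum_const, nsmul_eq_mul]
    _ ≤ K₂ * g (ψ₀ x) := by gcongr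

end

/-! ### The energy balance at one time -/

section

variable {α δ C₀ R₀ R Rs : ℝ} {x₀ : Plane} {ψ : Plane → ℝ} {ψs : ℝ → ℝ}

/-- Cut-offs lie in `[0, 1]` and `0 < 2δ - 1 < 1`. Undifferentiated factors can therefore be raised
to the power `2δ - 1`, so that every error carries the same power of the full cut-off. -/
lemma le_rpow_self {a q : ℝ} (ha0 : 0 ≤ a) (ha1 : a ≤ 1) (hq : 0 < q) (hq1 : q ≤ 1) :
    a ≤ a ^ q := by
  rcases ha0.eq_or_lt with h | h
  · rw [← h, Real.zero_rpow hq.ne']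
  · conv_lhs => rw [← Real.rpow_one a]
    exact Real.rpow_le_rpow_of_exponent_ge h ha1 hq1

lemma lap_const_mul (hψ : ContDiff ℝ ∞ ψ) (a : ℝ) (x : Plane) :
    lap (fun y => a * ψ y) x = a * lap ψ x := by
  have h1 : ∀ i : Fin 2, (fun y => fderiv ℝ (fun y => a * ψ y) y (e i)) =
      fun y => a * fderiv ℝ ψ y (e i) := fun i => by
    funext y
    rw [fderiv_const_mul (hψ.differentiable (by simp) y)]
    rfl
  unfold lap
  rw [Finset.mul_sum]
  refine Finset.sum_congr rfl fun i _ => ?_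
  rw [h1, fderiv_const_mul ((contDiff_fderiv_apply hψ (e i)).differentiable (by simp) x)]
  rfl

lemma IsSpaceCutoff.abs_lap_le (h : IsSpaceCutoff R C₀ δ ψ) (x : Plane) :
    |lap ψ x| ≤ 2 * (C₀ / R ^ 2) * ψ x ^ (2 * δ - 1) := by
  unfold lap
  rw [Fin.sum_univ_two]
  refine (abs_add_le _ _).trans ?_
  linarith [h.deriv2_le x 0 0, h.deriv2_le x 1 1]

lemma IsVerticalCutoff.abs_vlap_le (h : IsVerticalCutoff α Rs R₀ C₀ δ ψs) {z : ℝ} (hz : 0 < z) :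
    |vlap α ψs z| ≤ 2 * (C₀ / R₀ ^ 2) * ψs z ^ (2 * δ - 1) := by
  unfold vlap
  refine (abs_add_le _ _).trans ?_
  linarith [h.deriv2_le z hz, h.deriv_div_le z hz]

/-- The lower order coefficient of the energy balance. -/
lemma abs_lower_order_le (hδ₀ : 1 / 2 < δ) (hδ₁ : δ < 1) (hC₀ : 0 < C₀) (hRs : 0 < Rs)
    (hR : 0 < R) (hRR : R ≤ R₀) (hs : IsVerticalCutoff α Rs R₀ C₀ δ ψs)
    (h : IsSpaceCutoff R C₀ δ ψ) {a : ℝ} (ha0 : 0 ≤ a) (ha1 : a ≤ 1) (x : Plane) {z : ℝ}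
    (hz : 0 < z) :
    |lap (fun y => a * ψ y) x * ψs z + a * ψ x * vlap α ψs z| ≤
      4 * C₀ / R ^ 2 * (a * ψ x * ψs z) ^ (2 * δ - 1) := by
  have hq : 0 < 2 * δ - 1 := by linarith
  have hq1 : 2 * δ - 1 ≤ 1 := by linarith
  have hp0 := h.nonneg x
  have hp1 := h.le_one x
  have hs0 := hs.nonneg hz.le
  have hs1 := hs.le_one hRs hz.le
  rw [lap_const_mul h.smooth, Real.mul_rpow (mul_nonneg ha0 hp0) hs0, Real.mul_rpow ha0 hp0]
  have ha := le_rpow_self ha0 ha1 hq hq1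
  have hp := le_rpow_self hp0 hp1 hq hq1
  have hss := le_rpow_self hs0 hs1 hq hq1
  have hA := Real.rpow_nonneg ha0 (2 * δ - 1)
  have hP := Real.rpow_nonneg hp0 (2 * δ - 1)
  have hS := Real.rpow_nonneg hs0 (2 * δ - 1)
  refine (abs_add_le _ _).trans ?_
  rw [abs_mul, abs_mul, abs_mul, abs_of_nonneg ha0, abs_of_nonneg hs0,
    abs_of_nonneg (mul_nonneg ha0 hp0)]
  have h1 := h.abs_lap_le x
  have h2 := hs.abs_vlap_le hz
  -- The vertical cut-off varies at scale `R₀ ≥ R`, so its bounds are absorbed in those at scale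
  -- `R`. The factor `4` counts two horizontal second derivatives and the two parts of the vertical
  -- operator.
  have hCR : C₀ / R₀ ^ 2 ≤ C₀ / R ^ 2 := by gcongr
  have hCR' : 0 ≤ C₀ / R ^ 2 := by positivity
  have h3 : a * |lap ψ x| * ψs z ≤ a ^ (2 * δ - 1) *
      (2 * (C₀ / R ^ 2) * ψ x ^ (2 * δ - 1)) * ψs z ^ (2 * δ - 1) := by gcongr
  have h4 : a * ψ x * |vlap α ψs z| ≤ a ^ (2 * δ - 1) * ψ x ^ (2 * δ - 1) *
      (2 * (C₀ / R ^ 2) * ψs z ^ (2 * δ - 1)) := by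
    have h5 : |vlap α ψs z| ≤ 2 * (C₀ / R ^ 2) * ψs z ^ (2 * δ - 1) := h2.trans (by gcongr)
    gcongr
  calc _ ≤ _ := add_le_add h3 h4
    _ = _ := by ring

/-- The energy balance at one time, with the lower order terms estimated. -/
lemma abs_pairing_sub_le (hα₀ : 0 < α) (hα₂ : α < 2) (hδ₀ : 1 / 2 < δ) (hδ₁ : δ < 1)
    (hC₀ : 0 < C₀) (hRs : 0 < Rs) (hR : 0 < R) (hRR : R ≤ R₀)
    (hs : IsVerticalCutoff α Rs R₀ C₀ δ ψs) (h : IsSpaceCutoff R C₀ δ ψ)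
    (hψs : tsupport ψ ⊆ ball x₀ (2 * R₀)) {a : ℝ} (ha0 : 0 ≤ a) (ha1 : a ≤ 1)
    {f : Plane → ℝ} (hf : MemLp f 2 volume) (hfs : ContDiffOn ℝ ∞ f (ball x₀ (2 * R₀))) :
    Integrable (fun p : Plane × ℝ =>
      weight α p.2 * gradSq (ext α f) p.1 p.2 * (a * ψ p.1 * ψs p.2)) halfSpace ∧
    |(∫ x, f x * fracLap α (fun y => f y * (a * ψ y)) x) -
      ∫ p, weight α p.2 * gradSq (ext α f) p.1 p.2 * (a * ψ p.1 * ψs p.2) ∂halfSpace| ≤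
      4 * C₀ / R ^ 2 * ∫ p, weight α p.2 * (1 / 2 * ext α f p.1 p.2 ^ 2) *
        (a * ψ p.1 * ψs p.2) ^ (2 * δ - 1) ∂halfSpace := by
  have hR₀ := hR.trans_le hRR
  have hψ : ContDiff ℝ ∞ fun x => a * ψ x := contDiff_const.mul h.smooth
  have hψc : HasCompactSupport fun x => a * ψ x := h.compact.mul_left
  have hψs' : tsupport (fun x => a * ψ x) ⊆ ball x₀ (2 * R₀) :=
    (closure_mono fun x hx => right_ne_zero_of_mul hx).trans hψs
  obtain ⟨hI, hE⟩ := energy_balance hα₀ hα₂ hR₀ hRs hs hf (by positivity) hfs hψ hψc hψs'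
    fun x => mul_nonneg ha0 (h.nonneg x)
  refine ⟨hI, ?_⟩
  have hL := integrable_lower_order hα₀ hα₂ hRs hs hf hψ hψc
  have hV := (integrable_weight_ext_sq_cutoff hα₀ hα₂ hδ₀ hRs hs hf h.smooth.continuous h.nonneg
    h.le_one ha0 ha1).1
  -- After the dissipation cancels, only the lower order integral is left. Its factor `½` is the one
  -- in the density `½θ*²`.
  rw [hE, ← integral_prod _ hI, ← integral_prod _ hL, sub_sub_cancel_left, abs_neg,
    ← integral_const_mul, ← integral_const_mul, ← Real.norm_eq_abs]
  refine norm_integral_le_of_norm_le (hV.const_mul _) ?_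
  filter_upwards [ae_halfSpace] with p hp
  have hw := (weight_pos hα₀ hα₂ hp).le
  have hb := abs_lower_order_le hδ₀ hδ₁ hC₀ hRs hR hRR hs h ha0 ha1 p.1 hp
  rw [Real.norm_eq_abs, abs_mul, abs_mul, abs_of_nonneg (by norm_num : (0 : ℝ) ≤ 1 / 2),
    abs_of_nonneg (mul_nonneg hw (sq_nonneg _))]
  calc _ ≤ 1 / 2 * (weight α p.2 * ext α f p.1 p.2 ^ 2 *
        (4 * C₀ / R ^ 2 * (a * ψ p.1 * ψs p.2) ^ (2 * δ - 1))) := by gcongr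
    _ = _ := by ring

end

/-! ### The energy balance over the cover -/

section

variable {α δ C₀ R₀ R Rs T : ℝ} {x₀ : Plane} {K₁ K₂ n : ℕ} {c : Fin n → Plane}
  {ψ₀ : Plane → ℝ} {ψ : Fin n → Plane → ℝ} {ψs : ℝ → ℝ} {η : ℝ → ℝ}
  {θ : ℝ → Plane → ℝ} {u : ℝ → Plane → Plane}

/-- The dissipation parts are compared through `ψ₀ ≤ Σ ψ_i ≤ K₂ψ₀`, and the error parts through the
same multiplicity bound for the monotone power `2δ - 1`. The bound for a single element is needed
only to make each pairing integrable in time. -/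
lemma cover_pairing_bounds (hα₀ : 0 < α) (hα₂ : α < 2) (hδ₀ : 1 / 2 < δ) (hδ₁ : δ < 1)
    (hC₀ : 0 < C₀) (hRs : 0 < Rs) (hR : 0 < R) (hRR : R ≤ R₀)
    (hs : IsVerticalCutoff α Rs R₀ C₀ δ ψs) (h₀ : IsMacroCutoff x₀ R₀ C₀ δ ψ₀)
    (hc : IsCover K₁ K₂ x₀ R₀ R c)
    (hψ : ∀ i, IsElementCutoff x₀ R₀ C₀ δ ψ₀ (c i) R (ψ i)) {a : ℝ} (ha0 : 0 ≤ a) (ha1 : a ≤ 1)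
    {f : Plane → ℝ} (hf : MemLp f 2 volume) (hfs : ContDiffOn ℝ ∞ f (ball x₀ (2 * R₀)))
    {D V : ℝ} (hD : D = ∫ x, ∫ z in Ioi (0 : ℝ),
      weight α z * gradSq (ext α f) x z * (a * ψ₀ x * ψs z))
    (hV : V = ∫ x, ∫ z in Ioi (0 : ℝ),
      weight α z * (1 / 2 * ext α f x z ^ 2) * (a * ψ₀ x * ψs z) ^ (2 * δ - 1)) :
    (∀ i, |∫ x, f x * fracLap α (fun y => f y * (a * ψ i y)) x| ≤ D + 4 * C₀ / R ^ 2 * V) ∧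
    D - 4 * C₀ / R ^ 2 * (K₂ * V) ≤
      ∑ i, ∫ x, f x * fracLap α (fun y => f y * (a * ψ i y)) x ∧
    ∑ i, ∫ x, f x * fracLap α (fun y => f y * (a * ψ i y)) x ≤
      K₂ * D + 4 * C₀ / R ^ 2 * (K₂ * V) := by
  have hR₀ := hR.trans_le hRR
  have hq : 0 < 2 * δ - 1 := by linarith
  have hI₀ := (abs_pairing_sub_le hα₀ hα₂ hδ₀ hδ₁ hC₀ hRs hR₀ le_rfl hs h₀.cutoff h₀.support
    ha0 ha1 hf hfs).1
  have hW : ∀ {χ : Plane → ℝ} {r : ℝ}, IsSpaceCutoff r C₀ δ χ →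
      Integrable (fun p : Plane × ℝ => weight α p.2 * (1 / 2 * ext α f p.1 p.2 ^ 2) *
        (a * χ p.1 * ψs p.2) ^ (2 * δ - 1)) halfSpace := fun h =>
    (integrable_weight_ext_sq_cutoff hα₀ hα₂ hδ₀ hRs hs hf h.smooth.continuous h.nonneg
      h.le_one ha0 ha1).1
  rw [← integral_prod _ hI₀] at hD
  rw [← integral_prod _ (hW h₀.cutoff)] at hV
  have hb := fun i => abs_pairing_sub_le hα₀ hα₂ hδ₀ hδ₁ hC₀ hRs hR hRR hs (hψ i).cutoff
    ((hψ i).tsupport_subset h₀) ha0 ha1 hf hfs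
  set P : Fin n → ℝ := fun i => ∫ x, f x * fracLap α (fun y => f y * (a * ψ i y)) x
  set Di : Fin n → ℝ := fun i =>
    ∫ p, weight α p.2 * gradSq (ext α f) p.1 p.2 * (a * ψ i p.1 * ψs p.2) ∂halfSpace
  set Vi : Fin n → ℝ := fun i => ∫ p, weight α p.2 * (1 / 2 * ext α f p.1 p.2 ^ 2) *
    (a * ψ i p.1 * ψs p.2) ^ (2 * δ - 1) ∂halfSpace
  have hb' : ∀ i, |P i - Di i| ≤ 4 * C₀ / R ^ 2 * Vi i := fun i => (hb i).2
  have hcR : 0 ≤ 4 * C₀ / R ^ 2 := by positivity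
  have hwg : ∀ᵐ p ∂halfSpace, 0 ≤ weight α p.2 * gradSq (ext α f) p.1 p.2 ∧
      0 ≤ weight α p.2 * (1 / 2 * ext α f p.1 p.2 ^ 2) ∧ 0 ≤ ψs p.2 := by
    filter_upwards [ae_halfSpace] with p hp
    have hw := (weight_pos hα₀ hα₂ hp).le
    exact ⟨mul_nonneg hw (gradSq_nonneg _ _ _), by positivity, hs.nonneg hp.le⟩
  have hDi0 : ∀ i, 0 ≤ Di i := fun i => integral_nonneg_of_ae (by
    filter_upwards [hwg] with p hp
    exact mul_nonneg hp.1 (mul_nonneg (mul_nonneg ha0 ((hψ i).cutoff.nonneg _)) hp.2.2))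
  have hDi1 : ∀ i, Di i ≤ D := fun i => by
    rw [hD]
    refine integral_mono_ae (hb i).1 hI₀ ?_
    filter_upwards [hwg] with p hp
    have := (hψ i).le p.1
    have h1 := hp.1
    have h2 := hp.2.2
    gcongr
  have hVi1 : ∀ i, Vi i ≤ V := fun i => by
    rw [hV]
    refine integral_mono_ae (hW (hψ i).cutoff) (hW h₀.cutoff) ?_
    filter_upwards [hwg] with p hp
    have h3 := (hψ i).le p.1
    have h4 := (hψ i).cutoff.nonneg p.1
    have h1 := hp.2.1
    have h2 := hp.2.2
    gcongr
  have hsD1 : D ≤ ∑ i, Di i := by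
    rw [hD, ← integral_finsetSum _ fun i _ => (hb i).1]
    refine integral_mono_ae hI₀ (integrable_finsetSum _ fun i _ => (hb i).1) ?_
    filter_upwards [hwg] with p hp
    have h1 := hp.1
    have h2 := hp.2.2
    rw [← Finset.mul_sum, ← Finset.sum_mul, ← Finset.mul_sum]
    have := le_sum_cutoff hR₀ h₀ hc hψ p.1
    gcongr
  have hsD2 : ∑ i, Di i ≤ K₂ * D := by
    rw [hD, ← integral_finsetSum _ fun i _ => (hb i).1, ← integral_const_mul]
    refine integral_mono_ae (integrable_finsetSum _ fun i _ => (hb i).1) (hI₀.const_mul _) ?_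
    filter_upwards [hwg] with p hp
    have h1 := hp.1
    have h2 := hp.2.2
    rw [← Finset.mul_sum, ← Finset.sum_mul, ← Finset.mul_sum]
    have h3 : ∑ i, ψ i p.1 ≤ K₂ * ψ₀ p.1 :=
      sum_cutoff_le h₀ hc hψ (g := id) rfl (monotone_id.monotoneOn _) p.1
    calc _ ≤ weight α p.2 * gradSq (ext α f) p.1 p.2 * (a * (K₂ * ψ₀ p.1) * ψs p.2) := by
          gcongr
      _ = _ := by ring
  have hsV : ∑ i, Vi i ≤ K₂ * V := by
    rw [hV, ← integral_finsetSum _ fun i _ => hW (hψ i).cutoff, ← integral_const_mul]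
    refine integral_mono_ae (integrable_finsetSum _ fun i _ => hW (hψ i).cutoff)
      ((hW h₀.cutoff).const_mul _) ?_
    filter_upwards [hwg] with p hp
    have h1 := hp.2.1
    have h2 := hp.2.2
    rw [← Finset.mul_sum]
    have h3 := sum_cutoff_le h₀ hc hψ (g := fun r => (a * r * ψs p.2) ^ (2 * δ - 1))
      (by simp [Real.zero_rpow hq.ne']) (fun r hr r' hr' hrr => by
        have hr0 : 0 ≤ r := hr
        dsimp only
        gcongr) p.1
    calc _ ≤ weight α p.2 * (1 / 2 * ext α f p.1 p.2 ^ 2) *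
          (K₂ * (a * ψ₀ p.1 * ψs p.2) ^ (2 * δ - 1)) := by gcongr
      _ = _ := by ring
  have hsum : |∑ i, P i - ∑ i, Di i| ≤ 4 * C₀ / R ^ 2 * (K₂ * V) := by
    rw [← Finset.sum_sub_distrib]
    refine (Finset.abs_sum_le_sum_abs _ _).trans ((Finset.sum_le_sum fun i _ => hb' i).trans ?_)
    rw [← Finset.mul_sum]
    gcongr
  have hsum' := abs_le.1 hsum
  refine ⟨fun i => ?_, by linarith [hsum'.1], by linarith [hsum'.2]⟩
  have h1 : 4 * C₀ / R ^ 2 * Vi i ≤ 4 * C₀ / R ^ 2 * V := by have := hVi1 i; gcongr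
  calc |P i| = |(P i - Di i) + Di i| := by rw [sub_add_cancel]
    _ ≤ |P i - Di i| + |Di i| := abs_add_le _ _
    _ ≤ _ := by rw [abs_of_nonneg (hDi0 i)]; linarith [hb' i, hDi1 i]

/-- The contribution of the time derivative of the cut-off functions. -/
lemma cover_time_bound (hδ₀ : 1 / 2 < δ) (hδ₁ : δ < 1) (hC₀ : 0 < C₀) (hT : 0 < T)
    (hη : IsTimeCutoff T C₀ δ η) (h₀ : IsMacroCutoff x₀ R₀ C₀ δ ψ₀)
    (hc : IsCover K₁ K₂ x₀ R₀ R c)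
    (hψ : ∀ i, IsElementCutoff x₀ R₀ C₀ δ ψ₀ (c i) R (ψ i))
    (hsm : SmoothOnMacro x₀ R₀ T θ u) (t : ℝ) :
    |∑ i, ∫ x, 1 / 2 * θ t x ^ 2 * (deriv η t * ψ i x)| ≤
      C₀ / T * (K₂ * ∫ x, 1 / 2 * θ t x ^ 2 * (η t * ψ₀ x) ^ (2 * δ - 1)) := by
  have hq : 0 < 2 * δ - 1 := by linarith
  have hq1 : 2 * δ - 1 ≤ 1 := by linarith
  have hi : ∀ i, Integrable fun x => 1 / 2 * θ t x ^ 2 * (deriv η t * ψ i x) := fun i => by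
    obtain ⟨h1, h2⟩ := time_integrand_continuous hη hT (hψ i).cutoff.smooth (hψ i).cutoff.compact
      ((hψ i).tsupport_subset h₀) hsm
    exact integrable_slice h1 h2 t
  have hV : Integrable fun x => 1 / 2 * θ t x ^ 2 * (η t * ψ₀ x) ^ (2 * δ - 1) := by
    obtain ⟨h1, h2⟩ := vartheta_integrand_continuous hδ₀ hη hT h₀.cutoff.smooth h₀.cutoff.compact
      h₀.support hsm
    exact integrable_slice h1 h2 t
  rw [← integral_finsetSum _ fun i _ => hi i, ← integral_const_mul, ← integral_const_mul,
    ← Real.norm_eq_abs]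
  refine norm_integral_le_of_norm_le ((hV.const_mul _).const_mul _)
    (Eventually.of_forall fun x => ?_)
  have hη0 := hη.nonneg t
  have hp0 := fun i => (hψ i).cutoff.nonneg x
  have h3 := sum_cutoff_le h₀ hc hψ (g := fun r => (η t * r) ^ (2 * δ - 1))
    (by simp [Real.zero_rpow hq.ne']) (fun r hr r' hr' hrr => by
      have hr0 : 0 ≤ r := hr
      dsimp only
      gcongr) x
  have h4 : |deriv η t| * ∑ i, ψ i x ≤ C₀ / T * ∑ i, (η t * ψ i x) ^ (2 * δ - 1) := by
    rw [Finset.mul_sum, Finset.mul_sum]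
    refine Finset.sum_le_sum fun i _ => ?_
    rw [Real.mul_rpow hη0 (hp0 i), ← mul_assoc]
    have := le_rpow_self (hp0 i) ((hψ i).cutoff.le_one x) hq hq1
    have h5 := hη.deriv_le t
    have h6 := hp0 i
    gcongr
  rw [← Finset.mul_sum, ← Finset.mul_sum, Real.norm_eq_abs, abs_mul (1 / 2 * θ t x ^ 2),
    abs_of_nonneg (by positivity : 0 ≤ 1 / 2 * θ t x ^ 2), abs_mul (deriv η t),
    abs_of_nonneg (Finset.sum_nonneg fun i _ => hp0 i)]
  have h7 : |deriv η t| * ∑ i, ψ i x ≤ C₀ / T * (K₂ * (η t * ψ₀ x) ^ (2 * δ - 1)) :=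
    h4.trans (by gcongr)
  calc _ ≤ 1 / 2 * θ t x ^ 2 * (C₀ / T * (K₂ * (η t * ψ₀ x) ^ (2 * δ - 1))) := by gcongr
    _ = _ := by ring

/-- The energy balance over the cover, integrated in time. -/
lemma cover_flux_bounds (hα₀ : 0 < α) (hα₂ : α < 2) (hδ₀ : 1 / 2 < δ) (hδ₁ : δ < 1)
    (hC₀ : 0 < C₀) (hRs : 0 < Rs) (hT : 0 < T) (hR : 0 < R) (hRR : R ≤ R₀)
    (hη : IsTimeCutoff T C₀ δ η)
    (hs : IsVerticalCutoff α Rs R₀ C₀ δ ψs) (h₀ : IsMacroCutoff x₀ R₀ C₀ δ ψ₀)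
    (hc : IsCover K₁ K₂ x₀ R₀ R c)
    (hψ : ∀ i, IsElementCutoff x₀ R₀ C₀ δ ψ₀ (c i) R (ψ i))
    (hsol : IsSolution α θ u) (hsm : SmoothOnMacro x₀ R₀ T θ u)
    (hε : IntervalIntegrable (fun t => ∫ x, ∫ z in Ioi (0 : ℝ),
      weight α z * gradSq (ext α (θ t)) x z * (η t * ψ₀ x * ψs z)) volume 0 (2 * T))
    {D V W : ℝ} (hD : D = ∫ t in (0 : ℝ)..(2 * T), ∫ x, ∫ z in Ioi (0 : ℝ),
      weight α z * gradSq (ext α (θ t)) x z * (η t * ψ₀ x * ψs z))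
    (hV : V = ∫ t in (0 : ℝ)..(2 * T), ∫ x, ∫ z in Ioi (0 : ℝ),
      weight α z * (1 / 2 * ext α (θ t) x z ^ 2) * (η t * ψ₀ x * ψs z) ^ (2 * δ - 1))
    (hW : W = ∫ t in (0 : ℝ)..(2 * T), ∫ x,
      1 / 2 * θ t x ^ 2 * (η t * ψ₀ x) ^ (2 * δ - 1)) :
    D - 4 * C₀ / R ^ 2 * (K₂ * V) - C₀ / T * (K₂ * W) ≤
      ∑ i, ∫ t in (0 : ℝ)..(2 * T), ∫ x,
        1 / 2 * θ t x ^ 2 * fderiv ℝ (fun y => η t * ψ i y) x (u t x) ∧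
    ∑ i, ∫ t in (0 : ℝ)..(2 * T), ∫ x,
        1 / 2 * θ t x ^ 2 * fderiv ℝ (fun y => η t * ψ i y) x (u t x) ≤
      K₂ * D + 4 * C₀ / R ^ 2 * (K₂ * V) + C₀ / T * (K₂ * W) := by
  have h2T : (0 : ℝ) ≤ 2 * T := by linarith
  have hVi := intervalIntegrable_varthetaStar hα₀ hα₂ hδ₀ hRs hT hs hη h₀.cutoff.smooth.continuous
    h₀.cutoff.nonneg h₀.cutoff.le_one hsol
  obtain ⟨hWc, hWs⟩ := vartheta_integrand_continuous hδ₀ hη hT h₀.cutoff.smooth h₀.cutoff.compact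
    h₀.support hsm
  have hWi := intervalIntegrable_integral_slice hWc hWs 0 (2 * T)
  obtain ⟨K, hK0, hK⟩ := hsol.exists_energy_bound
  have hIoi : Ioc 0 (2 * T) ⊆ Ioi (0 : ℝ) := fun t ht => ht.1
  have hslice := fun (t : ℝ) (ht : t ∈ Ioo 0 (2 * T)) (hf : MemLp (θ t) 2 volume) =>
    cover_pairing_bounds hα₀ hα₂ hδ₀ hδ₁ hC₀ hRs hR hRR hs h₀ hc hψ (hη.nonneg t) (hη.le_one t) hf
      (hsm.1.comp (contDiff_const.prodMk contDiff_id).contDiffOn fun x hx => ⟨ht, hx⟩) rfl rfl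
  -- Smoothness holds on the open time interval only; the endpoint is a null set.
  have hae : ∀ᵐ t ∂(volume.restrict (Ioc 0 (2 * T))), t ∈ Ioo 0 (2 * T) ∧
      MemLp (θ t) 2 volume := by
    rw [← restrict_Ioo_eq_restrict_Ioc]
    filter_upwards [ae_restrict_mem measurableSet_Ioo,
      ae_restrict_of_ae_restrict_of_subset (fun t (ht : t ∈ Ioo 0 (2 * T)) => ht.1) hK]
      with t h1 h2 using ⟨h1, h2.1⟩
  set P : Fin n → ℝ → ℝ := fun i t =>
    ∫ x, θ t x * fracLap α (fun y => θ t y * (η t * ψ i y)) x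
  have hPi : ∀ i, IntervalIntegrable (P i) volume 0 (2 * T) := fun i => by
    have hm : AEStronglyMeasurable (P i) (volume.restrict (Ioi (0 : ℝ))) :=
      hsol.aestronglyMeasurable_pairing (isTestFunction_localized hη hT (hψ i).cutoff.smooth
        (hψ i).cutoff.compact ((hψ i).tsupport_subset h₀) hsm.1)
    -- The majorant in time is the macroscopic dissipation plus a multiple of the macroscopic `ϑ₀*`
    -- density.
    have hb := hε.add (hVi.const_mul (4 * C₀ / R ^ 2))
    rw [intervalIntegrable_iff_integrableOn_Ioc_of_le h2T] at hb ⊢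
    refine Integrable.mono' hb (hm.mono_measure (Measure.restrict_mono hIoi le_rfl)) ?_
    filter_upwards [hae] with t ht
    exact (hslice t ht.1 ht.2).1 i
  have hAcs := fun i => time_integrand_continuous hη hT (hψ i).cutoff.smooth
    (hψ i).cutoff.compact ((hψ i).tsupport_subset h₀) hsm
  have hAi : ∀ i, IntervalIntegrable (fun t => ∫ x, 1 / 2 * θ t x ^ 2 * (deriv η t * ψ i x))
      volume 0 (2 * T) := fun i =>
    intervalIntegrable_integral_slice (hAcs i).1 (hAcs i).2 0 (2 * T)
  have hid : ∑ i, ∫ t in (0 : ℝ)..(2 * T), ∫ x,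
        1 / 2 * θ t x ^ 2 * fderiv ℝ (fun y => η t * ψ i y) x (u t x) =
      (∫ t in (0 : ℝ)..(2 * T), ∑ i, P i t) -
      ∫ t in (0 : ℝ)..(2 * T), ∑ i, ∫ x, 1 / 2 * θ t x ^ 2 * (deriv η t * ψ i x) := by
    rw [intervalIntegral.integral_finsetSum fun i _ => hPi i,
      intervalIntegral.integral_finsetSum fun i _ => hAi i, ← Finset.sum_sub_distrib]
    exact Finset.sum_congr rfl fun i _ => localized_identity hα₀ hα₂ hη hT (hψ i).cutoff.smooth
      (hψ i).cutoff.compact ((hψ i).tsupport_subset h₀) hsol hsm (hPi i)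
  have hA : |∫ t in (0 : ℝ)..(2 * T), ∑ i, ∫ x, 1 / 2 * θ t x ^ 2 * (deriv η t * ψ i x)| ≤
      C₀ / T * (K₂ * W) := by
    rw [hW, ← intervalIntegral.integral_const_mul, ← intervalIntegral.integral_const_mul,
      ← Real.norm_eq_abs]
    exact intervalIntegral.norm_integral_le_of_norm_le h2T
      (Eventually.of_forall fun t _ => cover_time_bound hδ₀ hδ₁ hC₀ hT hη h₀ hc hψ hsm t)
      ((hWi.const_mul _).const_mul _)
  have hPs : IntervalIntegrable (fun t => ∑ i, P i t) volume 0 (2 * T) :=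
    by simpa only [Finset.sum_fn] using IntervalIntegrable.sum Finset.univ fun i _ => hPi i
  have hlow : D - 4 * C₀ / R ^ 2 * (K₂ * V) ≤ ∫ t in (0 : ℝ)..(2 * T), ∑ i, P i t := by
    rw [hD, hV, ← intervalIntegral.integral_const_mul, ← intervalIntegral.integral_const_mul,
      ← intervalIntegral.integral_sub hε ((hVi.const_mul _).const_mul _)]
    refine intervalIntegral.integral_mono_ae_restrict h2T
      (hε.sub ((hVi.const_mul _).const_mul _)) hPs ?_
    rw [Measure.restrict_congr_set Ioc_ae_eq_Icc.symm]
    filter_upwards [hae] with t ht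
    exact (hslice t ht.1 ht.2).2.1
  have hupp : ∫ t in (0 : ℝ)..(2 * T), ∑ i, P i t ≤ K₂ * D + 4 * C₀ / R ^ 2 * (K₂ * V) := by
    rw [hD, hV, ← intervalIntegral.integral_const_mul, ← intervalIntegral.integral_const_mul,
      ← intervalIntegral.integral_const_mul,
      ← intervalIntegral.integral_add (hε.const_mul _) ((hVi.const_mul _).const_mul _)]
    refine intervalIntegral.integral_mono_ae_restrict h2T hPs
      ((hε.const_mul _).add ((hVi.const_mul _).const_mul _)) ?_
    rw [Measure.restrict_congr_set Ioc_ae_eq_Icc.symm]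
    filter_upwards [hae] with t ht
    exact (hslice t ht.1 ht.2).2.2
  rw [hid]
  have hA' := abs_le.1 hA
  constructor <;> linarith [hA'.1, hA'.2]

end

/-! ### Scales -/

lemma le_mul_rpow_of_rpow_le {r s p : ℝ} (hr : 0 ≤ r) (hp : 0 < p) (h : r ^ (1 / p) ≤ s) :
    r ≤ s ^ p := by
  have h1 : (r ^ (1 / p)) ^ p = r := by
    rw [← Real.rpow_mul hr, one_div_mul_cancel hp.ne', Real.rpow_one]
  rw [← h1]
  exact Real.rpow_le_rpow (Real.rpow_nonneg hr _) h hp.le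

lemma beta_pos {α C₀ : ℝ} {K₁ K₂ : ℕ} (hC₀ : 0 < C₀) (hK₁ : 0 < K₁) (hK₂ : 0 < K₂) :
    0 < beta α C₀ K₁ K₂ := by
  unfold beta
  have : 0 < 8 * C₀ * K₁ * K₂ := by positivity
  exact lt_min (Real.rpow_pos_of_pos this _) (Real.rpow_pos_of_pos this _)

/-- Above the dissipation scale the lower order averages are dominated by the dissipation. -/
lemma averages_le_of_sigma_le {α C₀ R₀ R v vs es : ℝ} {K₁ K₂ : ℕ} (hα₀ : 0 < α) (hC₀ : 0 < C₀)
    (hK₁ : 0 < K₁) (hK₂ : 0 < K₂) (hR₀ : 0 < R₀) (hR : 0 < R) (hv : 0 ≤ v) (hvs : 0 ≤ vs)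
    (hes : 0 < es) (h₀ : sigma α v vs es ≤ beta α C₀ K₁ K₂ * R₀)
    (h : sigma α v vs es ≤ beta α C₀ K₁ K₂ * R) :
    v * (8 * C₀ * K₁ * K₂) ≤ es * R₀ ^ α ∧ vs * (8 * C₀ * K₁ * K₂) ≤ es * R ^ 2 := by
  set N : ℝ := 8 * C₀ * K₁ * K₂ with hN
  have hN0 : 0 < N := by positivity
  have hβ := beta_pos (α := α) hC₀ hK₁ hK₂
  constructor
  · have h1 : v / es ≤ (beta α C₀ K₁ K₂ * R₀) ^ α :=
      le_mul_rpow_of_rpow_le (div_nonneg hv hes.le) hα₀ ((le_max_left _ _).trans h₀)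
    have h2 : beta α C₀ K₁ K₂ ^ α ≤ N⁻¹ := by
      calc beta α C₀ K₁ K₂ ^ α ≤ (N ^ (-(1 / α))) ^ α :=
            Real.rpow_le_rpow hβ.le (min_le_right _ _) hα₀.le
        _ = N⁻¹ := by
            rw [← Real.rpow_mul hN0.le, neg_mul, one_div_mul_cancel hα₀.ne', Real.rpow_neg_one]
    rw [Real.mul_rpow hβ.le hR₀.le] at h1
    have h3 : v / es ≤ N⁻¹ * R₀ ^ α := h1.trans (by gcongr)
    rw [div_le_iff₀ hes] at h3
    calc v * N ≤ N⁻¹ * R₀ ^ α * es * N := by gcongr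
      _ = es * R₀ ^ α := by field_simp
  · have h1 : vs / es ≤ (beta α C₀ K₁ K₂ * R) ^ (2 : ℝ) :=
      le_mul_rpow_of_rpow_le (div_nonneg hvs hes.le) two_pos ((le_max_right _ _).trans h)
    have h2 : beta α C₀ K₁ K₂ ^ (2 : ℝ) ≤ N⁻¹ := by
      calc beta α C₀ K₁ K₂ ^ (2 : ℝ) ≤ (N ^ (-(1 / 2) : ℝ)) ^ (2 : ℝ) :=
            Real.rpow_le_rpow hβ.le (min_le_left _ _) two_pos.le
        _ = N⁻¹ := by
            rw [← Real.rpow_mul hN0.le, neg_mul, one_div_mul_cancel two_ne_zero,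
              Real.rpow_neg_one]
    rw [Real.mul_rpow hβ.le hR.le, Real.rpow_two R] at h1
    have h3 : vs / es ≤ N⁻¹ * R ^ 2 := h1.trans (by gcongr)
    rw [div_le_iff₀ hes] at h3
    calc vs * N ≤ N⁻¹ * R ^ 2 * es * N := by gcongr
      _ = es * R ^ 2 := by field_simp

/-- The final comparison of the averages. -/
lemma average_bounds {α C₀ R₀ R T v vs es S r : ℝ} {K₁ K₂ : ℕ} (hK₁ : 0 < K₁)
    (hK₂ : 0 < K₂) (hR : 0 < R) (hT₀ : 0 < T) (hT : R₀ ^ α ≤ 2 * T)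
    (hes : 0 < es) (h1 : v * (8 * C₀ * K₁ * K₂) ≤ es * R₀ ^ α)
    (h2 : vs * (8 * C₀ * K₁ * K₂) ≤ es * R ^ 2) (hr : 1 ≤ K₁ * r) (hr1 : r ≤ 1) (hr0 : 0 ≤ r)
    (hlow : es - 4 * C₀ / R ^ 2 * (K₂ * vs) - C₀ / T * (K₂ * v) ≤ S)
    (hupp : S ≤ K₂ * es + 4 * C₀ / R ^ 2 * (K₂ * vs) + C₀ / T * (K₂ * v)) :
    1 / (4 * (K₁ : ℝ)) * es ≤ r * S ∧ r * S ≤ 4 * K₂ * es := by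
  have hK₁' : (1 : ℝ) ≤ K₁ := by exact_mod_cast hK₁
  have hK₂' : (1 : ℝ) ≤ K₂ := by exact_mod_cast hK₂
  have hk : (0 : ℝ) < K₁ := by linarith
  -- The `8` in `β` is spent here: `R₀^α ≤ 2T` leaves `1/4` for the temporal error, and the factor
  -- `4C₀` leaves `1/2` for the spatial one. Together they take at most three quarters of `es`.
  have e1 : C₀ / T * (K₂ * v) ≤ es / (4 * K₁) := by
    rw [div_mul_eq_mul_div, div_le_div_iff₀ hT₀ (by positivity)]
    have h3 : es * R₀ ^ α ≤ es * (2 * T) := by gcongr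
    linarith
  have e2 : 4 * C₀ / R ^ 2 * (K₂ * vs) ≤ es / (2 * K₁) := by
    rw [div_mul_eq_mul_div, div_le_div_iff₀ (by positivity) (by positivity)]
    linarith
  have e3 : es / (2 * K₁) + es / (4 * K₁) = 3 / (4 * K₁) * es := by field_simp; norm_num
  have e4 : 3 / (4 * (K₁ : ℝ)) ≤ 3 / 4 := by
    rw [div_le_div_iff₀ (by positivity) (by norm_num)]
    linarith
  have e5 : 3 / (4 * (K₁ : ℝ)) * es ≤ 3 / 4 * es := by gcongr
  constructor
  · have h3 : 1 / 4 * es ≤ S := by linarith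
    have h4 : 1 / (K₁ : ℝ) ≤ r := by rwa [div_le_iff₀ hk, mul_comm]
    calc 1 / (4 * (K₁ : ℝ)) * es = 1 / K₁ * (1 / 4 * es) := by field_simp
      _ ≤ r * S := by gcongr
  · have h3 : S ≤ 4 * K₂ * es := by
      have : es ≤ K₂ * es := le_mul_of_one_le_left hes.le hK₂'
      linarith
    have h4 : 0 ≤ 4 * K₂ * es := by positivity
    calc r * S ≤ r * (4 * K₂ * es) := by gcongr
      _ ≤ 1 * (4 * K₂ * es) := by gcongr
      _ = _ := one_mul _

lemma vartheta_nonneg {R₀ T δ : ℝ} {η : ℝ → ℝ} {ψ₀ : Plane → ℝ} {θ : ℝ → Plane → ℝ} (hT : 0 < T)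
    (hη : ∀ t, 0 ≤ η t) (hψ : ∀ x, 0 ≤ ψ₀ x) : 0 ≤ vartheta R₀ T δ η ψ₀ θ := by
  unfold vartheta
  refine mul_nonneg (by positivity) (intervalIntegral.integral_nonneg (by linarith) fun t _ =>
    mul_nonneg (by positivity) (integral_nonneg fun x => ?_))
  exact mul_nonneg (by positivity) (Real.rpow_nonneg (mul_nonneg (hη t) (hψ x)) _)

lemma varthetaStar_nonneg {α R₀ Rs C₀ T δ : ℝ} {η : ℝ → ℝ} {ψ₀ : Plane → ℝ} {ψs : ℝ → ℝ}
    {θ : ℝ → Plane → ℝ} (hα₀ : 0 < α) (hα₂ : α < 2) (hT : 0 < T) (hη : ∀ t, 0 ≤ η t)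
    (hψ : ∀ x, 0 ≤ ψ₀ x) (hs : IsVerticalCutoff α Rs R₀ C₀ δ ψs) :
    0 ≤ varthetaStar α R₀ T δ η ψ₀ ψs θ := by
  unfold varthetaStar
  refine mul_nonneg (by positivity) (intervalIntegral.integral_nonneg (by linarith) fun t _ =>
    mul_nonneg (by positivity) (integral_nonneg fun x =>
      setIntegral_nonneg measurableSet_Ioi fun z hz => ?_))
  have hw := (weight_pos hα₀ hα₂ hz).le
  exact mul_nonneg (by positivity)
    (Real.rpow_nonneg (mul_nonneg (mul_nonneg (hη t) (hψ x)) (hs.nonneg (le_of_lt hz))) _)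

/-- A non-integrable function has integral `0` by convention, so positivity of `ε₀*` already
contains integrability in time. -/
lemma intervalIntegrable_of_epsStar_pos {α R₀ T : ℝ} {η : ℝ → ℝ} {ψ₀ : Plane → ℝ} {ψs : ℝ → ℝ}
    {θ : ℝ → Plane → ℝ} (h : 0 < epsStar α R₀ T η ψ₀ ψs θ) :
    IntervalIntegrable (fun t => ∫ x, ∫ z in Ioi (0 : ℝ),
      weight α z * gradSq (ext α (θ t)) x z * (η t * ψ₀ x * ψs z)) volume 0 (2 * T) := by
  by_contra hn
  refine h.ne' ?_
  unfold epsStar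
  rw [intervalIntegral.integral_const_mul, intervalIntegral.integral_undef hn, mul_zero, mul_zero]

end SQG

end

theorem theorem2
    (α δ C₀ R₀ Rs T : ℝ) (x₀ : SQG.Plane) (K₁ K₂ : ℕ)
    (hα₀ : 0 < α) (hα₂ : α < 2) (hδ₀ : 1 / 2 < δ) (hδ₁ : δ < 1) (hC₀ : 0 < C₀)
    (hR₀ : 0 < R₀) (hRs : 0 < Rs) (hT₀ : 0 < T) (hT : R₀ ^ α ≤ 2 * T)
    (hK₁ : 0 < K₁) (hK₂ : 0 < K₂)
    (η : ℝ → ℝ) (ψ₀ : SQG.Plane → ℝ) (ψs : ℝ → ℝ)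
    (hη : SQG.IsTimeCutoff T C₀ δ η)
    (hψ₀ : SQG.IsMacroCutoff x₀ R₀ C₀ δ ψ₀)
    (hψs : SQG.IsVerticalCutoff α Rs R₀ C₀ δ ψs)
    (θ : ℝ → SQG.Plane → ℝ) (u : ℝ → SQG.Plane → SQG.Plane)
    (hsol : SQG.IsSolution α θ u)
    (hsmooth : SQG.SmoothOnMacro x₀ R₀ T θ u)
    (hε : 0 < SQG.epsStar α R₀ T η ψ₀ ψs θ)
    (hσ : SQG.sigma α (SQG.vartheta R₀ T δ η ψ₀ θ) (SQG.varthetaStar α R₀ T δ η ψ₀ ψs θ)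
        (SQG.epsStar α R₀ T η ψ₀ ψs θ) < SQG.beta α C₀ K₁ K₂ * R₀) :
    ∀ R : ℝ, 0 < R →
      SQG.sigma α (SQG.vartheta R₀ T δ η ψ₀ θ) (SQG.varthetaStar α R₀ T δ η ψ₀ ψs θ)
        (SQG.epsStar α R₀ T η ψ₀ ψs θ) / SQG.beta α C₀ K₁ K₂ ≤ R →
      R ≤ R₀ →
      ∀ (n : ℕ) (c : Fin n → SQG.Plane), SQG.IsCover K₁ K₂ x₀ R₀ R c →
      ∀ ψ : Fin n → SQG.Plane → ℝ,
        (∀ i, SQG.IsElementCutoff x₀ R₀ C₀ δ ψ₀ (c i) R (ψ i)) →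
        1 / (4 * (K₁ : ℝ)) * SQG.epsStar α R₀ T η ψ₀ ψs θ ≤ SQG.meanFlux R T η ψ θ u ∧
        SQG.meanFlux R T η ψ θ u ≤ 4 * (K₂ : ℝ) * SQG.epsStar α R₀ T η ψ₀ ψs θ := by
  intro R hR hσR hRR n c hc ψ hψ
  have hβ := SQG.beta_pos (α := α) hC₀ hK₁ hK₂
  have hn : (0 : ℝ) < n := lt_of_lt_of_le (by positivity) hc.le_card
  obtain ⟨h1, h2⟩ := SQG.averages_le_of_sigma_le hα₀ hC₀ hK₁ hK₂ hR₀ hR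
    (SQG.vartheta_nonneg hT₀ hη.nonneg hψ₀.cutoff.nonneg)
    (SQG.varthetaStar_nonneg hα₀ hα₂ hT₀ hη.nonneg hψ₀.cutoff.nonneg hψs) hε hσ.le
    (by rwa [div_le_iff₀' hβ] at hσR)
  obtain ⟨hlow, hupp⟩ := SQG.cover_flux_bounds hα₀ hα₂ hδ₀ hδ₁ hC₀ hRs hT₀ hR hRR hη hψs hψ₀ hc hψ
    hsol hsmooth (SQG.intervalIntegrable_of_epsStar_pos hε) rfl rfl rfl
  -- Passing from `1/R²` to `1/R₀²` leaves the factor `(R₀/R)²/n`, which the cardinality bounds of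
  -- the cover place between `1/K₁` and `1`.
  have hm : SQG.meanFlux R T η ψ θ u = (R₀ / R) ^ 2 / n * (1 / T * (1 / R₀ ^ 2 *
      ∑ i, ∫ t in (0 : ℝ)..(2 * T), ∫ x,
        1 / 2 * θ t x ^ 2 * fderiv ℝ (fun y => η t * ψ i y) x (u t x))) := by
    unfold SQG.meanFlux SQG.flux
    simp only [intervalIntegral.integral_const_mul, ← Finset.mul_sum]
    field_simp
  have hsc : (0 : ℝ) ≤ 1 / T * (1 / R₀ ^ 2) := by positivity
  have hlow' := mul_le_mul_of_nonneg_left hlow hsc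
  have hupp' := mul_le_mul_of_nonneg_left hupp hsc
  rw [hm]
  refine SQG.average_bounds hK₁ hK₂ hR hT₀ hT hε h1 h2 ?_ ?_ (by positivity) ?_ ?_
  · rw [← mul_div_assoc, le_div_iff₀ hn, one_mul]
    exact hc.card_le
  · rw [div_le_one hn]
    exact hc.le_card
  · unfold SQG.epsStar SQG.vartheta SQG.varthetaStar
    simp only [intervalIntegral.integral_const_mul]
    linarith
  · unfold SQG.epsStar SQG.vartheta SQG.varthetaStar
    simp only [intervalIntegral.integral_const_mul]
    linarith
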